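/- Let $\mathbb{T}=\mathbb{R}\cup\{-\infty\}=[-\infty,\infty)$. A function $g$ on an open set $G\subset\mathbb{T}^N$ is \emph{regular} if it is continuous with values in $\mathbb{T}$ and coincides on $G\cap\mathbb{R}^N$ with a tropical Laurent polynomial $x\mapsto\max_j(a_j+j\cdot x)$ (finitely many, at least one, $j\in\mathbb{Z}^N$, with $a_j\in\mathbb{R}$). Subsets of $\mathbb{T}^N$ carry the sheaf of functions that are locally restrictions of regular functions. A \emph{$k$-dimensional polyhedral complex} is the closure $Y\subset\mathbb{T}^N$ of a finite union of $k$-dimensional convex polyhedra (facets) with integer slopes in $\mathbb{R}^N$ such that any intersection of facets is their common face; facets have weight $1$. For a $(k-1)$-dimensional face $E$ with adjacent facets $F_1,\dots,F_l$, let $L\subset\mathbb{R}^N$ be an $(N-k)$-dimensional affine subspace with integer slope meeting the relative interior of $E$. A vector $v$ is generic if each $F_j\cap(L+v)$ is empty or a single point of the relative interior of $F_j$; put $\iota_L(v)=\sum_{j:\,F_j\cap(L+v)\ne\emptyset}[\mathbb{Z}^N:\Lambda_{F_j}+\Lambda_L]$, where $\Lambda$ denotes the lattice of parallel integer vectors.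 $Y$ is \emph{balanced} if for all such $E,L$ the number $\iota_L(v)$ is the same for all sufficiently small generic $v$. It is \emph{simply balanced} if, in addition, for all $E$ and $j$ there is such an $L$ with $\iota_L(v)=1$ for all small generic $v$, with $F_j\cap(L+v)\neq\emptyset$ for some small generic $v$, and such that for every small $v$ there is an affine hyperplane of $L+v$ having $Y\cap(L+v)$ entirely on one side and meeting $Y$ in exactly one point. A \emph{smooth tropical variety of dimension $k$} is a topological space with a sheaf of $\mathbb{T}$-valued functions that is locally isomorphic to open subsets of simply balanced $k$-dimensional polyhedral complexes with their sheaves. Let $n\ge 3$, and let $\overline{\mathcal M}_{0,n}$ be the space of trees with $n$ marked leaves and all other vertices of valence at least $3$, each edge having a length in $(0,+\infty]$ and each leaf edge having length $+\infty$, up to isomorphism. Its topology is that of the closed cells $[0,+\infty]^M$ of the combinatorial types ($M$ being the number of non-leaf edges), glued by contracting edges of length $0$. For each unordered pair of disjoint pairs $\{(ij),(kl)\}$ of markings (with a fixed order in each pair) the \emph{double ratio} $\rho:\overline{\mathcal M}_{0,n}\to[-\infty,+\infty]$ is the length of the intersection of the oriented path from $i$ to $j$ with the one from $k$ to $l$,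 with sign $+$ if the orientations agree and $-$ otherwise. For $x\in\overline{\mathcal M}_{0,n}$ let $D_x$ be the family of all double ratios, with the sign of $\rho$ reversed whenever $\rho(x)=+\infty$; near $x$ it takes values in $\mathbb{T}^N$, where $N=3\binom n4$. Let $\mathcal O$ be the sheaf on $\overline{\mathcal M}_{0,n}$ of the functions that near every point $x$ are of the form $g\circ D_x$ with $g$ regular. Then $\overline{\mathcal M}_{0,n}$ is a compact Hausdorff space, and $(\overline{\mathcal M}_{0,n},\mathcal O)$ is a smooth tropical variety of dimension $n-3$. Moreover, the charts are given by the double ratios: for every $x$ there are a simply balanced $(n-3)$-dimensional polyhedral complex $Y\subset\mathbb{T}^N$ and an open neighbourhood of $x$ that $D_x$ maps homeomorphically onto an open subset of $Y$, identifying the sheaves of regular functions. -/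

import Mathlib

open Set Topology
open scoped ENNReal

/-! ## Tropical numbers, Laurent polynomials and regular functions -/

/-- The tropical numbers `ℝ ∪ {-∞} = [-∞, ∞)`, with the Euclidean topology (the subspace topology
of the extended real line). Tropical affine space `𝕋^ι` is the product `ι → TropNum`. -/
abbrev TropNum : Type := {x : EReal // x ≠ ⊤}

/-- The inclusion `ℝ ⊂ 𝕋`. -/
def TropNum.ofReal (r : ℝ) : TropNum := ⟨(r : EReal), EReal.coe_ne_top r⟩

/-- The inclusion `ℝ^ι ⊂ 𝕋^ι`. -/
def realPoint {ι : Type} (x : ι → ℝ) : ι → TropNum := fun i => TropNum.ofReal (x i)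

/-- The inclusion `ℤ^ι ⊂ ℝ^ι`. -/
def intPoint {ι : Type} (z : ι → ℤ) : ι → ℝ := fun i => (z i : ℝ)

/-- A tropical Laurent polynomial in the variables `ι`: finitely many (and at least one) exponents
`j ∈ ℤ^ι`, with real coefficients `a_j`. -/
structure TropLaurent (ι : Type) where
  support : Finset (ι → ℤ)
  nonempty : support.Nonempty
  coeff : (ι → ℤ) → ℝ

/-- The function `x ↦ max_j (a_j + j x)` on `ℝ^ι`. -/
noncomputable def TropLaurent.eval {ι : Type} [Fintype ι] (P : TropLaurent ι) (x : ι → ℝ) : ℝ :=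
  P.support.sup' P.nonempty (fun j => P.coeff j + ∑ i, (j i : ℝ) * x i)

/-- `g` is regular on the open set `G ⊆ 𝕋^ι`: it is continuous there, and on the finite points of
`G` it is a tropical Laurent polynomial. The values of `g` outside `G` play no role. -/
def IsRegularOn {ι : Type} [Fintype ι] (G : Set (ι → TropNum)) (g : (ι → TropNum) → TropNum) :
    Prop :=
  ContinuousOn g G ∧ ∃ P : TropLaurent ι, ∀ x : ι → ℝ, realPoint x ∈ G →
    g (realPoint x) = TropNum.ofReal (P.eval x)

/-! ## Sheaves of tropical functions -/

/-- A sheaf of `𝕋`-valued functions on a topological space. -/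
structure TropSheaf (X : Type) [TopologicalSpace X] where
  /-- the sections over an open set -/
  sec : (U : TopologicalSpace.Opens X) → Set (U → TropNum)
  restrict : ∀ (U V : TopologicalSpace.Opens X) (h : U ≤ V) (f : V → TropNum),
    f ∈ sec V → (fun x : U => f ⟨x.1, h x.2⟩) ∈ sec U
  glue : ∀ (U : TopologicalSpace.Opens X) (f : U → TropNum),
    (∀ x : U, ∃ (V : TopologicalSpace.Opens X) (h : V ≤ U), x.1 ∈ V ∧
      (fun y : V => f ⟨y.1, h y.2⟩) ∈ sec V) → f ∈ sec U

/-- Let a map `φ x : X → [-∞, ∞]^ι` be given for every point `x` of `X`. This is the sheaf of those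
functions that near each point `x` are regular functions of the coordinates `φ x`, which have to
lie in `𝕋^ι` near `x`. -/
noncomputable def sheafOfCoordinates {X : Type} [TopologicalSpace X] {ι : Type} [Fintype ι]
    (φ : X → X → ι → EReal) : TropSheaf X where
  sec U := {f | ∀ x : U, ∃ (W : TopologicalSpace.Opens X) (G : Set (ι → TropNum))
    (g : (ι → TropNum) → TropNum), x.1 ∈ W ∧ IsOpen G ∧ IsRegularOn G g ∧
      ∀ y : U, y.1 ∈ W → ∃ z ∈ G, (∀ i, (z i : EReal) = φ x.1 y.1 i) ∧ f y = g z}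
  restrict U V h f hf := by
    intro x
    obtain ⟨W, G, g, hx, hG, hg, H⟩ := hf ⟨x.1, h x.2⟩
    exact ⟨W, G, g, hx, hG, hg, fun y hy => H ⟨y.1, h y.2⟩ hy⟩
  glue U f hf := by
    intro x
    obtain ⟨V, h, hx, hV⟩ := hf x
    obtain ⟨W, G, g, hxW, hG, hg, H⟩ := hV ⟨x.1, hx⟩
    exact ⟨W ⊓ V, G, g, ⟨hxW, hx⟩, hG, hg, fun y hy => H ⟨y.1, hy.2⟩ hy.1⟩

/-- The homeomorphism `e` between open subsets of `X` and `Y` is an isomorphism of the restricted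
sheaves of tropical functions. -/
def IsSheafIso {X Y : Type} [TopologicalSpace X] [TopologicalSpace Y]
    (e : OpenPartialHomeomorph X Y) (A : TropSheaf X) (B : TropSheaf Y) : Prop :=
  ∀ (U : TopologicalSpace.Opens X) (V : TopologicalSpace.Opens Y),
    (U : Set X) ⊆ e.source → e '' (U : Set X) = (V : Set Y) →
    ∀ (f : U → TropNum) (g : V → TropNum),
      (∀ (x : U) (y : V), e x.1 = y.1 → f x = g y) → (f ∈ A.sec U ↔ g ∈ B.sec V)

/-! ## Polyhedral complexes and the balancing property -/

/-- Nonempty convex polyhedra with integer slopes in `ℝ^ι` (possibly unbounded). -/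
def IsRationalPolyhedron {ι : Type} [Fintype ι] (P : Set (ι → ℝ)) : Prop :=
  P.Nonempty ∧ ∃ s : Finset ((ι → ℤ) × ℝ),
    P = {x | ∀ c ∈ s, ∑ i, (c.1 i : ℝ) * x i ≤ c.2}

/-- The dimension of (the affine span of) a nonempty subset of `ℝ^ι`. -/
noncomputable def affDim {ι : Type} (P : Set (ι → ℝ)) : ℕ :=
  Module.finrank ℝ (vectorSpan ℝ P)

/-- A `k`-dimensional polyhedral complex: finitely many `k`-dimensional polyhedra with integer
slopes in `ℝ^ι`, such that the intersection of any number of them is their common face. -/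
structure PolyComplex (ι : Type) [Fintype ι] (k : ℕ) where
  facets : Finset (Set (ι → ℝ))
  polyhedron : ∀ F ∈ facets, IsRationalPolyhedron F
  dim : ∀ F ∈ facets, affDim F = k
  inter : ∀ S : Set (Set (ι → ℝ)), S ⊆ facets → ∀ F ∈ S, IsExposed ℝ F (⋂₀ S)

namespace PolyComplex

variable {ι : Type} [Fintype ι] {k : ℕ}

/-- The finite part `Y ∩ ℝ^ι` of the complex. -/
def finitePart (Y : PolyComplex ι k) : Set (ι → ℝ) := {x | ∃ F ∈ Y.facets, x ∈ F}

/-- The complex as a subset of `𝕋^ι`: the closure in `𝕋^ι` of the union of its polyhedra. -/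
def carrier (Y : PolyComplex ι k) : Set (ι → TropNum) := closure (realPoint '' Y.finitePart)

/-- The sheaf on `Y` that is induced from the sheaf of regular functions on `𝕋^ι`. -/
noncomputable def sheaf (Y : PolyComplex ι k) : TropSheaf Y.carrier :=
  sheafOfCoordinates (fun _ y i => ((y.1 i : TropNum) : EReal))

/-- The `(k-1)`-dimensional faces of `Y`. -/
def IsCodimOneFace (Y : PolyComplex ι k) (E : Set (ι → ℝ)) : Prop :=
  E.Nonempty ∧ affDim E + 1 = k ∧ ∃ F ∈ Y.facets, IsExposed ℝ F E

open Classical in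
/-- The facets adjacent to `E`. -/
noncomputable def adjacent (Y : PolyComplex ι k) (E : Set (ι → ℝ)) : Finset (Set (ι → ℝ)) :=
  Y.facets.filter (fun F => IsExposed ℝ F E)

end PolyComplex

/-- The translate `L + v`. -/
def translateBy {ι : Type} (L : AffineSubspace ℝ (ι → ℝ)) (v : ι → ℝ) : Set (ι → ℝ) :=
  {x | x - v ∈ L}

/-- The integer vectors parallel to a subset of `ℝ^ι`. -/
def parallelLattice {ι : Type} (P : Set (ι → ℝ)) : AddSubgroup (ι → ℤ) where
  carrier := {z | intPoint z ∈ vectorSpan ℝ P}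
  zero_mem' := by
    have h : intPoint (0 : ι → ℤ) = 0 := by ext i; simp [intPoint]
    simp [h]
  add_mem' := by
    intro a b ha hb
    have h : intPoint (a + b) = intPoint a + intPoint b := by ext i; simp [intPoint]
    simpa [h] using add_mem ha hb
  neg_mem' := by
    intro a ha
    have h : intPoint (-a) = -intPoint a := by ext i; simp [intPoint]
    simpa [h] using ha

namespace PolyComplex

variable {ι : Type} [Fintype ι] {k : ℕ}

/-- `L` is an affine subspace of dimension `N - k` with an integer slope (its direction is spanned
by integer vectors), and it meets the (relative interior of the) face `E`. -/
def IsTestSpace (_Y : PolyComplex ι k) (E : Set (ι → ℝ)) (L : AffineSubspace ℝ (ι → ℝ)) : Prop :=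
  Module.finrank ℝ L.direction + k = Fintype.card ι ∧
  (∃ s : Set (ι → ℤ), L.direction = Submodule.span ℝ (intPoint '' s)) ∧
  ((L : Set (ι → ℝ)) ∩ intrinsicInterior ℝ E).Nonempty

/-- `v` is generic: `L + v` meets each facet adjacent to `E` either nowhere or in a single point,
which is in the relative interior of that facet. -/
def IsGeneric (Y : PolyComplex ι k) (E : Set (ι → ℝ)) (L : AffineSubspace ℝ (ι → ℝ))
    (v : ι → ℝ) : Prop :=
  ∀ F ∈ Y.adjacent E, F ∩ translateBy L v = ∅ ∨
    ∃ p ∈ intrinsicInterior ℝ F, F ∩ translateBy L v = {p}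

open Classical in
/-- The number `ι_L`: the sum, over the facets `F` adjacent to `E` that meet `L + v`, of the index
in `ℤ^ι` of the sum of the lattices of `F` and of `L`. All facets have weight one. -/
noncomputable def count (Y : PolyComplex ι k) (E : Set (ι → ℝ))
    (L : AffineSubspace ℝ (ι → ℝ)) (v : ι → ℝ) : ℕ :=
  ∑ F ∈ (Y.adjacent E).filter (fun F => (F ∩ translateBy L v).Nonempty),
    (parallelLattice F ⊔ parallelLattice (L : Set (ι → ℝ))).index

/-- The balancing property. -/
def IsBalanced (Y : PolyComplex ι k) : Prop :=
  ∀ E, Y.IsCodimOneFace E → ∀ L, Y.IsTestSpace E L →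
    ∃ (m : ℕ) (ε : ℝ), 0 < ε ∧ ∀ v, ‖v‖ < ε → Y.IsGeneric E L v → Y.count E L v = m

/-- There is an affine hyperplane of `L + v`, cut out by `h = c` with `h` not constant on `L`, such
that `Y ∩ (L + v)` lies entirely on one side of it and meets it in exactly one point. -/
def OneSided (Y : PolyComplex ι k) (L : AffineSubspace ℝ (ι → ℝ)) (v : ι → ℝ) : Prop :=
  ∃ (h : (ι → ℝ) →ₗ[ℝ] ℝ) (c : ℝ), (∃ d ∈ L.direction, h d ≠ 0) ∧
    (∀ x ∈ Y.finitePart ∩ translateBy L v, h x ≤ c) ∧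
    ∃ p, {x ∈ Y.finitePart ∩ translateBy L v | h x = c} = {p}

/-- `Y` is simply balanced: it is balanced, and for every codimension one face `E` and every
adjacent facet `F` there is an `L` with `ι_L = 1`, with `F ∩ (L + v)` nonempty for some small
generic `v`, and with the one-sidedness property for every small `v`. -/
def IsSimplyBalanced (Y : PolyComplex ι k) : Prop :=
  Y.IsBalanced ∧ ∀ E, Y.IsCodimOneFace E → ∀ F ∈ Y.adjacent E,
    ∃ L, Y.IsTestSpace E L ∧ ∃ ε : ℝ, 0 < ε ∧
      (∀ v, ‖v‖ < ε → Y.IsGeneric E L v → Y.count E L v = 1) ∧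
      (∃ v, ‖v‖ < ε ∧ Y.IsGeneric E L v ∧ (F ∩ translateBy L v).Nonempty) ∧
      (∀ v, ‖v‖ < ε → Y.OneSided L v)

end PolyComplex

/-- A topological space with a sheaf of tropical functions is a (smooth) tropical variety of
dimension `k` if it is locally isomorphic, as a space with a sheaf of tropical functions, to open
subsets of simply balanced `k`-dimensional polyhedral complexes in `𝕋^ι`, `ι` finite. -/
def IsSmoothTropicalVariety (k : ℕ) (X : Type) [TopologicalSpace X] (A : TropSheaf X) : Prop :=
  ∀ x : X, ∃ (ι : Type) (_ : Fintype ι) (Y : PolyComplex ι k), Y.IsSimplyBalanced ∧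
    ∃ e : OpenPartialHomeomorph X Y.carrier, x ∈ e.source ∧ IsSheafIso e A Y.sheaf

/-! ## The compactified moduli space -/

/-- A combinatorial type: a tree whose leaves (vertices of valence one) are marked bijectively by
`1, …, n` and whose other vertices have valence at least three. -/
structure MarkedTree (n : ℕ) where
  size : ℕ
  graph : SimpleGraph (Fin size)
  isTree : graph.IsTree
  leaf : Fin n → Fin size
  leaf_injective : Function.Injective leaf
  valence_leaf : ∀ i, (graph.neighborSet (leaf i)).ncard = 1
  valence_inner : ∀ v, v ∉ Set.range leaf → 3 ≤ (graph.neighborSet v).ncard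

namespace MarkedTree

variable {n : ℕ}

/-- The closed cell `[0, ∞]^M` of a combinatorial type with `M` bounded (non-leaf) edges: every
edge has a length in `[0, ∞]`, and the leaf edges have length `∞`. -/
abbrev Lengths (Γ : MarkedTree n) : Type :=
  {l : Γ.graph.edgeSet → ℝ≥0∞ // ∀ (e : Γ.graph.edgeSet) (i : Fin n), Γ.leaf i ∈ e.1 → l e = ⊤}

/-- The path in the tree from the `i`-th to the `j`-th leaf. -/
noncomputable def path (Γ : MarkedTree n) (i j : Fin n) :
    Γ.graph.Walk (Γ.leaf i) (Γ.leaf j) :=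
  (Γ.isTree.existsUnique_path (Γ.leaf i) (Γ.leaf j)).choose

theorem path_isPath (Γ : MarkedTree n) (i j : Fin n) : (Γ.path i j).IsPath :=
  (Γ.isTree.existsUnique_path (Γ.leaf i) (Γ.leaf j)).choose_spec.1

theorem path_unique (Γ : MarkedTree n) (i j : Fin n)
    (p : Γ.graph.Walk (Γ.leaf i) (Γ.leaf j)) (hp : p.IsPath) : p = Γ.path i j :=
  (Γ.isTree.existsUnique_path (Γ.leaf i) (Γ.leaf j)).choose_spec.2 p hp

end MarkedTree

/-- The disjoint union of the closed cells of all combinatorial types. -/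
abbrev TreeCells (n : ℕ) : Type := Σ Γ : MarkedTree n, Γ.Lengths

/-- `φ` contracts the tree `S` onto the tree `T`: it respects the markings, it collapses some edges
of length zero to points, and the other edges of `S` correspond one to one to edges of `T` of the
same length. When nothing is collapsed, `φ` is an isomorphism of marked trees with edge lengths. -/
structure IsContraction {n : ℕ} (S T : TreeCells n) (φ : Fin S.1.size → Fin T.1.size) : Prop where
  surj : Function.Surjective φ
  leaf : ∀ i, φ (S.1.leaf i) = T.1.leaf i
  edge : ∀ u v (h : S.1.graph.Adj u v), (φ u = φ v ∧ S.2.1 ⟨s(u, v), h⟩ = 0) ∨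
    ∃ h' : T.1.graph.Adj (φ u) (φ v), T.2.1 ⟨s(φ u, φ v), h'⟩ = S.2.1 ⟨s(u, v), h⟩
  inj : ∀ u v u' v', S.1.graph.Adj u v → S.1.graph.Adj u' v' → φ u ≠ φ v →
    φ u = φ u' → φ v = φ v' → u = u' ∧ v = v'

/-- The space of trees with `n` marked leaves, with edge lengths in `(0, ∞]` and leaf edges of
length `∞`. It is the union of the closed cells `[0, ∞]^M` of all combinatorial types, glued along
their faces by contracting edges of length zero, with the quotient topology. Each point is
represented by a tree with positive lengths, unique up to isomorphism. -/
abbrev ModuliBar (n : ℕ) : Type := Quot (fun S T : TreeCells n => ∃ φ, IsContraction S T φ)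

/-! ## Double ratios -/

open Classical in
/-- The length of the part that is common to the path from `i` to `j` and the path from `k` to `l`
and passed by the two paths in the same direction. -/
noncomputable def TreeCells.overlap {n : ℕ} (S : TreeCells n) (i j k l : Fin n) : ℝ≥0∞ :=
  ∑ d : S.1.graph.Dart with d ∈ (S.1.path i j).darts ∧ d ∈ (S.1.path k l).darts,
    S.2.1 ⟨d.edge, d.edge_mem⟩

/-- The double ratio of a tree: the length of the intersection of the oriented paths from `i` to
`j` and from `k` to `l`, with a positive sign if the orientations agree and with a negative sign
otherwise. (For distinct markings at most one of the two terms is nonzero.) -/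
noncomputable def TreeCells.doubleRatio {n : ℕ} (i j k l : Fin n) (S : TreeCells n) : EReal :=
  (S.overlap i j k l : EReal) - (S.overlap i j l k : EReal)

theorem IsContraction.exists_walk {n : ℕ} {S T : TreeCells n} {φ : Fin S.1.size → Fin T.1.size}
    (H : IsContraction S T φ) {u v : Fin S.1.size} (p : S.1.graph.Walk u v) :
    ∃ p' : T.1.graph.Walk (φ u) (φ v), p'.darts.map (fun d => d.toProd) =
      (p.darts.map (fun d => (φ d.fst, φ d.snd))).filter (fun q => q.1 ≠ q.2) := by
  induction p with
  | nil => exact ⟨.nil, by simp⟩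
  | @cons a b c h p ih =>
    obtain ⟨p', hp'⟩ := ih
    by_cases hab : φ a = φ b
    · rw [hab]
      refine ⟨p', ?_⟩
      rw [hp']
      simp [hab]
    · obtain ⟨h1, -⟩ | ⟨h', -⟩ := H.edge a b h
      · exact absurd h1 hab
      · refine ⟨.cons h' p', ?_⟩
        simp only [SimpleGraph.Walk.darts_cons, List.map_cons, hp']
        simp [hab]

theorem IsContraction.path {n : ℕ} {S T : TreeCells n} {φ : Fin S.1.size → Fin T.1.size}
    (H : IsContraction S T φ) (i j : Fin n) :
    (T.1.path i j).darts.map (fun d => d.toProd) =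
      ((S.1.path i j).darts.map (fun d => (φ d.fst, φ d.snd))).filter (fun q => q.1 ≠ q.2) := by
  obtain ⟨p', hp'⟩ := H.exists_walk (S.1.path i j)
  have htrail : p'.IsTrail := by
    rw [SimpleGraph.Walk.isTrail_def]
    have h1 : p'.edges = (p'.darts.map (fun d => d.toProd)).map (fun q => s(q.1, q.2)) := by
      simp only [SimpleGraph.Walk.edges, List.map_map]
      rfl
    have h2 := (S.1.path_isPath i j).isTrail.edges_nodup
    rw [h1, hp']
    simp only [SimpleGraph.Walk.edges, List.Nodup, List.pairwise_map, List.pairwise_filter] at h2 ⊢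
    refine h2.imp ?_
    intro a b hab ha hb heq
    simp only [ne_eq, decide_not, Bool.not_eq_true', decide_eq_false_iff_not] at ha hb
    apply hab
    rcases Sym2.eq_iff.1 heq with ⟨e1, e2⟩ | ⟨e1, e2⟩
    · obtain ⟨e3, e4⟩ := H.inj _ _ _ _ a.adj b.adj ha e1 e2
      exact Sym2.eq_iff.2 (Or.inl ⟨e3, e4⟩)
    · obtain ⟨e3, e4⟩ := H.inj _ _ _ _ a.adj b.adj.symm ha e1 e2
      exact Sym2.eq_iff.2 (Or.inr ⟨e3, e4⟩)
  have hpath := (T.1.isTree.isAcyclic.isPath_iff_isTrail p').2 htrail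
  have key : ∀ (a b : Fin T.1.size) (ha : a = T.1.leaf i) (hb : b = T.1.leaf j)
      (p : T.1.graph.Walk a b), p.IsPath → (T.1.path i j).darts = p.darts := by
    intro a b ha hb p hp
    subst ha hb
    rw [T.1.path_unique i j p hp]
  rw [key _ _ (H.leaf i) (H.leaf j) p' hpath, hp']

theorem IsContraction.overlap_eq {n : ℕ} {S T : TreeCells n} {φ : Fin S.1.size → Fin T.1.size}
    (H : IsContraction S T φ) (i j k l : Fin n) : S.overlap i j k l = T.overlap i j k l := by
  classical
  have mem : ∀ (i j : Fin n) (d : T.1.graph.Dart), d ∈ (T.1.path i j).darts ↔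
      ∃ c ∈ (S.1.path i j).darts, φ c.fst ≠ φ c.snd ∧ φ c.fst = d.fst ∧ φ c.snd = d.snd := by
    intro i j d
    have h0 : d ∈ (T.1.path i j).darts ↔
        d.toProd ∈ (T.1.path i j).darts.map (fun d => d.toProd) := by
      rw [List.mem_map]
      constructor
      · exact fun h => ⟨d, h, rfl⟩
      · rintro ⟨d', h, e⟩
        have : d' = d := SimpleGraph.Dart.ext _ _ e
        exact this ▸ h
    rw [h0, H.path i j]
    simp only [List.mem_filter, List.mem_map, Prod.ext_iff]
    constructor
    · rintro ⟨⟨c, hc, e1, e2⟩, hne⟩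
      refine ⟨c, hc, ?_, e1, e2⟩
      rw [e1, e2]
      simpa using hne
    · rintro ⟨c, hc, hne, e1, e2⟩
      refine ⟨⟨c, hc, e1, e2⟩, ?_⟩
      rw [e1, e2] at hne
      simp [hne]
  unfold TreeCells.overlap
  have hadj : ∀ c : S.1.graph.Dart, φ c.fst ≠ φ c.snd →
      ∃ h' : T.1.graph.Adj (φ c.fst) (φ c.snd),
        T.2.1 ⟨s(φ c.fst, φ c.snd), h'⟩ = S.2.1 ⟨c.edge, c.edge_mem⟩ := by
    intro c hc
    rcases H.edge c.fst c.snd c.adj with ⟨h1, -⟩ | h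
    · exact absurd h1 hc
    · exact h
  have hne : ∀ c : S.1.graph.Dart, S.2.1 ⟨c.edge, c.edge_mem⟩ ≠ 0 → φ c.fst ≠ φ c.snd := by
    intro c hc heq
    rcases H.edge c.fst c.snd c.adj with ⟨-, h1⟩ | ⟨h1, -⟩
    · exact hc h1
    · exact h1.ne heq
  refine Finset.sum_bij_ne_zero
    (fun c _ h => ⟨(φ c.fst, φ c.snd), (hadj c (hne c h)).1⟩) ?_ ?_ ?_ ?_
  · intro c hc h
    simp only [Finset.mem_filter, Finset.mem_univ, true_and] at hc ⊢
    exact ⟨(mem i j _).2 ⟨c, hc.1, hne c h, rfl, rfl⟩, (mem k l _).2 ⟨c, hc.2, hne c h, rfl, rfl⟩⟩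
  · intro c _ h c' _ h' heq
    have e := congrArg SimpleGraph.Dart.toProd heq
    simp only [Prod.ext_iff] at e
    obtain ⟨e1, e2⟩ := H.inj _ _ _ _ c.adj c'.adj (hne c h) e.1 e.2
    exact SimpleGraph.Dart.ext _ _ (Prod.ext e1 e2)
  · intro d hd h
    simp only [Finset.mem_filter, Finset.mem_univ, true_and] at hd
    obtain ⟨c, hc, hc0, e1, e2⟩ := (mem i j d).1 hd.1
    obtain ⟨c', hc', hc0', e1', e2'⟩ := (mem k l d).1 hd.2
    obtain ⟨e3, e4⟩ := H.inj _ _ _ _ c.adj c'.adj hc0 (e1.trans e1'.symm) (e2.trans e2'.symm)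
    have e5 : c = c' := SimpleGraph.Dart.ext _ _ (Prod.ext e3 e4)
    subst e5
    have hd' : d = ⟨(φ c.fst, φ c.snd), (hadj c hc0).1⟩ :=
      SimpleGraph.Dart.ext _ _ (Prod.ext e1.symm e2.symm)
    refine ⟨c, ?_, ?_, hd'.symm⟩
    · simp only [Finset.mem_filter, Finset.mem_univ, true_and]
      exact ⟨hc, hc'⟩
    · rw [← (hadj c hc0).2]
      rw [hd'] at h
      exact h
  · intro c _ h
    exact ((hadj c (hne c h)).2).symm

/-- The double ratio, as a function on the moduli space, with values in `[-∞, ∞]`. -/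
noncomputable def doubleRatio {n : ℕ} (i j k l : Fin n) : ModuliBar n → EReal :=
  Quot.lift (TreeCells.doubleRatio i j k l) (by
    rintro S T ⟨φ, H⟩
    simp only [TreeCells.doubleRatio, H.overlap_eq])

/-- The unordered pairs of disjoint pairs `{(ij), (kl)}` of markings, each one listed once, in the
order with `i < j`, `k < l` and `i < k`. -/
abbrev DoublePair (n : ℕ) : Type :=
  {q : Fin 4 → Fin n // q 0 < q 1 ∧ q 2 < q 3 ∧ q 0 < q 2 ∧ q 1 ≠ q 2 ∧ q 1 ≠ q 3}

/-- The double ratios as coordinates near the point `x`: one for each double pair, with the sign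
reversed for those that are `+∞` at `x` (so that they are `-∞` there). -/
noncomputable def doubleRatioCoord {n : ℕ} (x y : ModuliBar n) (q : DoublePair n) : EReal :=
  open Classical in
  if doubleRatio (q.1 0) (q.1 1) (q.1 2) (q.1 3) x = ⊤
  then -doubleRatio (q.1 0) (q.1 1) (q.1 2) (q.1 3) y
  else doubleRatio (q.1 0) (q.1 1) (q.1 2) (q.1 3) y

/-- The tropical structure of the moduli space: a function is regular if near each point `x` it is
a regular function of the double ratios, with signs chosen at `x` as above. -/
noncomputable def ModuliBar.sheaf (n : ℕ) : TropSheaf (ModuliBar n) :=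
  sheafOfCoordinates (ι := DoublePair n) doubleRatioCoord

/-! Fix a marking `r` as root. A bounded edge of a tree is then recorded by its cluster, the set of
markings beyond the edge as seen from `r`, and a tree with edge lengths becomes a laminar family of
clusters (pairwise disjoint or nested) with weights in (0, ∞]. The edge with cluster `A` contributes
its length times (1_A(i) − 1_A(j))(1_A(k) − 1_A(l)) to the double ratio of {(ij), (kl)}; these
numbers form the vector `splitVec A`. Compatible clusters never contribute to one double ratio with
opposite signs, so infinite lengths never lead to ∞ − ∞.

Topology. Up to sign, the positive or negative part of a double ratio involving `r` is the total
weight of the clusters separating i, k from j and r. These sums determine the weights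
(`laminar_weight_ext`), so the double ratios form a continuous injection into a power of [-∞, ∞].
Since finitely many compact cells cover the space, it is compact and Hausdorff, and the coordinates
at any `x` are a closed embedding. Truncating infinite weights shows that the part of the image
inside 𝕋^N is the closure of a fan: its cones are spanned by the `splitVec A` with `A` in a laminar
family (`mem_carrier_iff`).

The fan. What has to be known about it is collected in `IsSmoothFan`, which implies simple balancing
(`IsSmoothFan.isSimplyBalanced`) and is verified in `isSmoothFan_splitVec`. Maximal cones are rooted
binary trees. Choosing one marking in each of the two children of every cluster (a linkage) gives
functionals: products 1_A(a)1_A(b) at the linked pair of a cluster minus the product at the pair of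
its parent. They are integer combinations of double ratios and dual to the generators, so the cones
are unimodular. Removing a cluster creates a vertex of valence four, which can be resolved in three
ways. The quadratic identity `splitVec_relation` puts the sum of the three new generators into the
lattice of the common face, and balancing follows.

One-sidedness comes from an ultrametric inequality. The total weight of the clusters containing both
a and b (`meetWeight`) behaves like a similarity. If `w'` has the same dual coordinates as `w`,
their meet weights differ by a constant on the linked pairs, and `min_meetWeight_le` turns this into
an inequality for all pairs. Hence minus the sum of the normalized meet weights, a linear functional
of the double ratios, is maximal at `w` only.

Sheaves. The coordinates at a point `y` of the chart at `x` differ from those at `x` by sign changes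
of coordinates that are finite at `y`; such changes preserve Laurent polynomials, so the two notions
of regular function agree. -/

set_option linter.unusedSectionVars false

/-! ## Laminar families and binary hierarchies -/

section Hierarchy

variable {α : Type}

/-- Two finite sets are compatible if they are disjoint or nested. -/
def Compatible (A B : Finset α) : Prop := Disjoint A B ∨ A ⊆ B ∨ B ⊆ A

theorem Compatible.symm {A B : Finset α} (h : Compatible A B) : Compatible B A := by
  rcases h with h | h | h
  · exact Or.inl h.symm
  · exact Or.inr (Or.inr h)
  · exact Or.inr (Or.inl h)

theorem Compatible.refl (A : Finset α) : Compatible A A := Or.inr (Or.inl subset_rfl)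

theorem Compatible.of_mem {A B : Finset α} (h : Compatible A B) {x : α} (hA : x ∈ A)
    (hB : x ∈ B) : A ⊆ B ∨ B ⊆ A :=
  h.resolve_left fun hd => Finset.disjoint_left.1 hd hA hB

theorem compatible_singleton [DecidableEq α] (A : Finset α) (x : α) : Compatible A {x} := by
  by_cases hx : x ∈ A
  · exact Or.inr (Or.inr (Finset.singleton_subset_iff.2 hx))
  · exact Or.inl (Finset.disjoint_singleton_right.2 hx)

theorem Compatible.not_crossing {A B : Finset α} (h : Compatible A B) {x y z : α}
    (hxA : x ∈ A) (hxB : x ∈ B) (hyA : y ∈ A) (hyB : y ∉ B) (hzB : z ∈ B) (hzA : z ∉ A) :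
    False := by
  rcases h.of_mem hxA hxB with h | h
  · exact hyB (h hyA)
  · exact hzA (h hzB)

theorem not_compatible_iff {A B : Finset α} :
    ¬ Compatible A B ↔ (∃ x, x ∈ A ∧ x ∈ B) ∧ (∃ y, y ∈ A ∧ y ∉ B) ∧ ∃ z, z ∈ B ∧ z ∉ A := by
  simp only [Compatible, not_or, Finset.not_disjoint_iff, Finset.not_subset]

variable [DecidableEq α]

/-- `F` is the family of clusters with at least two elements of a rooted binary tree whose leaves
are the elements of `D`. -/
inductive BinaryHierarchy : Finset α → Finset (Finset α) → Prop
  | leaf (x : α) : BinaryHierarchy {x} ∅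
  | node {D₁ D₂ : Finset α} {F₁ F₂ : Finset (Finset α)} : Disjoint D₁ D₂ →
      BinaryHierarchy D₁ F₁ → BinaryHierarchy D₂ F₂ →
      BinaryHierarchy (D₁ ∪ D₂) (insert (D₁ ∪ D₂) (F₁ ∪ F₂))

/-- A block of a family of sets is a member of the family or a singleton. -/
def IsBlock (F : Finset (Finset α)) (C : Finset α) : Prop := C ∈ F ∨ ∃ x, C = {x}

omit [DecidableEq α] in
theorem IsBlock.mono {F G : Finset (Finset α)} {C : Finset α} (h : IsBlock F C) (hFG : F ⊆ G) :
    IsBlock G C := h.imp_left fun hC => hFG hC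

theorem IsBlock.compatible {F : Finset (Finset α)} {C B : Finset α} (h : IsBlock F C)
    (hF : ∀ A ∈ F, Compatible B A) : Compatible B C := by
  rcases h with h | ⟨x, rfl⟩
  · exact hF C h
  · exact compatible_singleton B x

namespace BinaryHierarchy

variable {D : Finset α} {F : Finset (Finset α)}

theorem nonempty (h : BinaryHierarchy D F) : D.Nonempty := by
  induction h with
  | leaf x => exact Finset.singleton_nonempty x
  | node _ _ _ h₁ _ => exact h₁.mono Finset.subset_union_left

theorem subset (h : BinaryHierarchy D F) : ∀ B ∈ F, B ⊆ D := by
  induction h with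
  | leaf x => simp
  | node _ _ _ h₁ h₂ =>
    intro B hB
    rcases Finset.mem_insert.1 hB with rfl | hB
    · exact subset_rfl
    · rcases Finset.mem_union.1 hB with hB | hB
      · exact (h₁ B hB).trans Finset.subset_union_left
      · exact (h₂ B hB).trans Finset.subset_union_right

theorem block (h : BinaryHierarchy D F) : IsBlock F D := by
  cases h with
  | leaf x => exact Or.inr ⟨x, rfl⟩
  | node => exact Or.inl (Finset.mem_insert_self _ _)

theorem two_le_card (h : BinaryHierarchy D F) : ∀ B ∈ F, 2 ≤ B.card := by
  induction h with
  | leaf x => simp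
  | node hd h₁ h₂ ih₁ ih₂ =>
    intro B hB
    rcases Finset.mem_insert.1 hB with rfl | hB
    · rw [Finset.card_union_of_disjoint hd]
      have := h₁.nonempty.card_pos
      have := h₂.nonempty.card_pos
      omega
    · rcases Finset.mem_union.1 hB with hB | hB
      · exact ih₁ B hB
      · exact ih₂ B hB

/-- A binary tree has one inner vertex fewer than leaves. This count is what makes maximal laminar
families have exactly `n - 3` members. -/
theorem card (h : BinaryHierarchy D F) : F.card + 1 = D.card := by
  induction h with
  | leaf x => simp
  | @node D₁ D₂ F₁ F₂ hd h₁ h₂ ih₁ ih₂ =>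
    rw [Finset.card_union_of_disjoint hd, Finset.card_insert_of_notMem,
      Finset.card_union_of_disjoint]
    · omega
    · rw [Finset.disjoint_left]
      intro B hB hB'
      have h2 := h₁.two_le_card B hB
      obtain ⟨x, hx⟩ : B.Nonempty := Finset.card_pos.1 (by omega)
      exact Finset.disjoint_left.1 hd (h₁.subset B hB hx) (h₂.subset B hB' hx)
    · intro hmem
      obtain ⟨x, hx⟩ := h₁.nonempty
      obtain ⟨y, hy⟩ := h₂.nonempty
      rcases Finset.mem_union.1 hmem with hB | hB
      · exact Finset.disjoint_left.1 hd (h₁.subset _ hB (Finset.mem_union_right _ hy)) hy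
      · exact Finset.disjoint_left.1 hd hx (h₂.subset _ hB (Finset.mem_union_left _ hx))

theorem compatible (h : BinaryHierarchy D F) : ∀ A ∈ F, ∀ B ∈ F, Compatible A B := by
  induction h with
  | leaf x => simp
  | @node D₁ D₂ F₁ F₂ hd h₁ h₂ ih₁ ih₂ =>
    have key := (BinaryHierarchy.node hd h₁ h₂).subset
    intro A hA B hB
    rcases Finset.mem_insert.1 hA with rfl | hA'
    · exact Or.inr (Or.inr (key B hB))
    rcases Finset.mem_insert.1 hB with rfl | hB'
    · exact Or.inr (Or.inl (key A hA))
    rcases Finset.mem_union.1 hA' with hA' | hA' <;> rcases Finset.mem_union.1 hB' with hB' | hB'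
    · exact ih₁ A hA' B hB'
    · exact Or.inl (Finset.disjoint_of_subset_left (h₁.subset A hA')
        (Finset.disjoint_of_subset_right (h₂.subset B hB') hd))
    · exact Or.inl (Finset.disjoint_of_subset_left (h₂.subset A hA')
        (Finset.disjoint_of_subset_right (h₁.subset B hB') hd.symm))
    · exact ih₂ A hA' B hB'

theorem exists_children (h : BinaryHierarchy D F) : ∀ B ∈ F, ∃ C₁ C₂ : Finset α,
    C₁.Nonempty ∧ C₂.Nonempty ∧ Disjoint C₁ C₂ ∧ B = C₁ ∪ C₂ ∧ IsBlock F C₁ ∧ IsBlock F C₂ := by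
  induction h with
  | leaf x => simp
  | @node D₁ D₂ F₁ F₂ hd h₁ h₂ ih₁ ih₂ =>
    have s₁ : F₁ ⊆ insert (D₁ ∪ D₂) (F₁ ∪ F₂) :=
      Finset.subset_union_left.trans (Finset.subset_insert _ _)
    have s₂ : F₂ ⊆ insert (D₁ ∪ D₂) (F₁ ∪ F₂) :=
      Finset.subset_union_right.trans (Finset.subset_insert _ _)
    intro B hB
    rcases Finset.mem_insert.1 hB with rfl | hB
    · exact ⟨D₁, D₂, h₁.nonempty, h₂.nonempty, hd, rfl, h₁.block.mono s₁, h₂.block.mono s₂⟩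
    · rcases Finset.mem_union.1 hB with hB | hB
      · obtain ⟨C₁, C₂, a, b, c, d, e, f⟩ := ih₁ B hB
        exact ⟨C₁, C₂, a, b, c, d, e.mono s₁, f.mono s₁⟩
      · obtain ⟨C₁, C₂, a, b, c, d, e, f⟩ := ih₂ B hB
        exact ⟨C₁, C₂, a, b, c, d, e.mono s₂, f.mono s₂⟩

/-- The block `C` is the other child of the parent of `A`, and `A ∪ C` is that parent. -/
theorem exists_sibling (h : BinaryHierarchy D F) : ∀ A ∈ F, A ≠ D → ∃ C : Finset α,
    C.Nonempty ∧ Disjoint A C ∧ A ∪ C ∈ F ∧ IsBlock F C := by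
  induction h with
  | leaf x => simp
  | @node D₁ D₂ F₁ F₂ hd h₁ h₂ ih₁ ih₂ =>
    have s₁ : F₁ ⊆ insert (D₁ ∪ D₂) (F₁ ∪ F₂) :=
      Finset.subset_union_left.trans (Finset.subset_insert _ _)
    have s₂ : F₂ ⊆ insert (D₁ ∪ D₂) (F₁ ∪ F₂) :=
      Finset.subset_union_right.trans (Finset.subset_insert _ _)
    intro A hA hne
    rcases Finset.mem_insert.1 hA with rfl | hA
    · exact absurd rfl hne
    · rcases Finset.mem_union.1 hA with hA | hA
      · by_cases hAD : A = D₁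
        · subst hAD
          exact ⟨D₂, h₂.nonempty, hd, Finset.mem_insert_self _ _, h₂.block.mono s₂⟩
        · obtain ⟨C, a, b, c, d⟩ := ih₁ A hA hAD
          exact ⟨C, a, b, s₁ c, d.mono s₁⟩
      · by_cases hAD : A = D₂
        · subst hAD
          exact ⟨D₁, h₁.nonempty, hd.symm, by rw [Finset.union_comm]; exact Finset.mem_insert_self _ _,
            h₁.block.mono s₁⟩
        · obtain ⟨C, a, b, c, d⟩ := ih₂ A hA hAD
          exact ⟨C, a, b, s₂ c, d.mono s₂⟩

end BinaryHierarchy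

/-- Every laminar family extends to a binary hierarchy. -/
theorem exists_binaryHierarchy (D : Finset α) (hD : D.Nonempty) (L : Finset (Finset α))
    (hsub : ∀ B ∈ L, B ⊆ D) (hcard : ∀ B ∈ L, 2 ≤ B.card)
    (hcomp : ∀ A ∈ L, ∀ B ∈ L, Compatible A B) :
    ∃ F, L ⊆ F ∧ BinaryHierarchy D F := by
  induction hm : D.card using Nat.strong_induction_on generalizing D L with
  | _ m ih =>
  -- If every member of `L` other than `D` lies inside `M` or misses it, the two halves `M` and `D \
  -- M` can be treated by induction with the restricted families.
  have split : ∀ M : Finset α, M ⊂ D → M.Nonempty →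
      (∀ B ∈ L, B = D ∨ B ⊆ M ∨ Disjoint B M) → ∃ F, L ⊆ F ∧ BinaryHierarchy D F := by
    intro M hM hMne hL
    have hne2 : (D \ M).Nonempty := by
      rw [Finset.sdiff_nonempty]; exact hM.2
    obtain ⟨F₁, hF₁, hB₁⟩ := ih M.card (hm ▸ Finset.card_lt_card hM) M hMne (L.filter (· ⊆ M))
      (fun B hB => (Finset.mem_filter.1 hB).2)
      (fun B hB => hcard B (Finset.mem_filter.1 hB).1)
      (fun A hA B hB => hcomp A (Finset.mem_filter.1 hA).1 B (Finset.mem_filter.1 hB).1) rfl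
    have hlt : (D \ M).card < m := by
      rw [← hm]
      exact Finset.card_lt_card (Finset.sdiff_ssubset hM.1 hMne)
    obtain ⟨F₂, hF₂, hB₂⟩ := ih (D \ M).card hlt (D \ M) hne2 (L.filter (· ⊆ D \ M))
      (fun B hB => (Finset.mem_filter.1 hB).2)
      (fun B hB => hcard B (Finset.mem_filter.1 hB).1)
      (fun A hA B hB => hcomp A (Finset.mem_filter.1 hA).1 B (Finset.mem_filter.1 hB).1) rfl
    have hDM : M ∪ D \ M = D := Finset.union_sdiff_of_subset hM.1
    have := BinaryHierarchy.node Finset.disjoint_sdiff hB₁ hB₂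
    rw [hDM] at this
    refine ⟨_, fun B hB => ?_, this⟩
    rcases hL B hB with h | h | h
    · rw [h]; exact Finset.mem_insert_self _ _
    · exact Finset.mem_insert_of_mem (Finset.mem_union_left _ (hF₁ (Finset.mem_filter.2 ⟨hB, h⟩)))
    · refine Finset.mem_insert_of_mem (Finset.mem_union_right _ (hF₂ (Finset.mem_filter.2 ⟨hB, ?_⟩)))
      exact Finset.subset_sdiff.2 ⟨hsub B hB, h⟩
  by_cases hex : (L.erase D).Nonempty
  -- A proper member of largest cardinality is maximal for inclusion, so by compatibility it can
  -- serve as one of the two halves.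
  · obtain ⟨M, hM, hmax⟩ := Finset.exists_max_image (L.erase D) Finset.card hex
    have hML := Finset.mem_of_mem_erase hM
    have hMD : M ⊂ D := lt_of_le_of_ne (hsub M hML) (Finset.ne_of_mem_erase hM)
    refine split M hMD (Finset.card_pos.1 (by have := hcard M hML; omega)) fun B hB => ?_
    by_cases hBD : B = D
    · exact Or.inl hBD
    right
    rcases hcomp B hB M hML with h | h | h
    · exact Or.inr h
    · exact Or.inl h
    · exact Or.inl (Finset.eq_of_subset_of_card_le h
        (hmax B (Finset.mem_erase.2 ⟨hBD, hB⟩))).symm.subset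
  · have hL : ∀ B ∈ L, B = D := by
      intro B hB
      by_contra hne
      exact hex ⟨B, Finset.mem_erase.2 ⟨hne, hB⟩⟩
    obtain ⟨x, hx⟩ := hD
    by_cases hxD : D = {x}
    · subst hxD
      refine ⟨∅, fun B hB => ?_, BinaryHierarchy.leaf x⟩
      have := hcard B hB
      rw [hL B hB] at this
      simp at this
    -- Without proper members every splitting is allowed; a single point is cut off.
    · refine split {x} ?_ (Finset.singleton_nonempty x) fun B hB => Or.inl (hL B hB)
      exact lt_of_le_of_ne (Finset.singleton_subset_iff.2 hx) (Ne.symm hxD)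

end Hierarchy

/-! ## Clusters: splits of the markings, seen from a root -/

section Cluster

variable {n : ℕ}

/-- The subsets of the markings not containing the root `r` that are one side of a bounded edge. -/
def IsCluster (r : Fin n) (A : Finset (Fin n)) : Prop :=
  r ∉ A ∧ 2 ≤ A.card ∧ A ≠ Finset.univ.erase r

/-- Families of pairwise compatible clusters. -/
def IsLaminar (r : Fin n) (σ : Finset (Finset (Fin n))) : Prop :=
  (∀ A ∈ σ, IsCluster r A) ∧ ∀ A ∈ σ, ∀ B ∈ σ, Compatible A B

theorem IsLaminar.mono {r : Fin n} {σ τ : Finset (Finset (Fin n))} (h : IsLaminar r σ)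
    (hτ : τ ⊆ σ) : IsLaminar r τ :=
  ⟨fun A hA => h.1 A (hτ hA), fun A hA B hB => h.2 A (hτ hA) B (hτ hB)⟩

theorem IsCluster.subset {r : Fin n} {A : Finset (Fin n)} (h : IsCluster r A) :
    A ⊆ Finset.univ.erase r :=
  fun x hx => Finset.mem_erase.2 ⟨fun e => h.1 (e ▸ hx), Finset.mem_univ x⟩

/-- The top set `univ.erase r` belongs to every hierarchy on the markings other than `r`, but it
corresponds to the leaf edge of `r` and is no cluster; hence it is erased. -/
theorem IsLaminar.exists_binaryHierarchy (hn : 3 ≤ n) {r : Fin n} {σ : Finset (Finset (Fin n))}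
    (h : IsLaminar r σ) :
    ∃ F, σ ⊆ F.erase (Finset.univ.erase r) ∧ BinaryHierarchy (Finset.univ.erase r) F := by
  obtain ⟨F, hF, hB⟩ := _root_.exists_binaryHierarchy (Finset.univ.erase r)
    (Finset.card_pos.1 (by rw [Finset.card_erase_of_mem (Finset.mem_univ r)]; simp; omega)) σ
    (fun B hB => (h.1 B hB).subset) (fun B hB => (h.1 B hB).2.1) h.2
  exact ⟨F, fun A hA => Finset.mem_erase.2 ⟨(h.1 A hA).2.2, hF hA⟩, hB⟩

theorem BinaryHierarchy.root_mem (hn : 3 ≤ n) {r : Fin n} {F : Finset (Finset (Fin n))}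
    (h : BinaryHierarchy (Finset.univ.erase r) F) : Finset.univ.erase r ∈ F := by
  rcases h.block with h | ⟨x, hx⟩
  · exact h
  · have := congrArg Finset.card hx
    rw [Finset.card_erase_of_mem (Finset.mem_univ r)] at this
    simp at this
    omega

theorem BinaryHierarchy.isCluster {r : Fin n} {F : Finset (Finset (Fin n))}
    (h : BinaryHierarchy (Finset.univ.erase r) F) {A : Finset (Fin n)} (hA : A ∈ F)
    (hne : A ≠ Finset.univ.erase r) : IsCluster r A :=
  ⟨fun hr => Finset.notMem_erase r _ (h.subset A hA hr), h.two_le_card A hA, hne⟩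

theorem BinaryHierarchy.isLaminar {r : Fin n} {F : Finset (Finset (Fin n))}
    (h : BinaryHierarchy (Finset.univ.erase r) F) :
    IsLaminar r (F.erase (Finset.univ.erase r)) :=
  ⟨fun _ hA => h.isCluster (Finset.mem_of_mem_erase hA) (Finset.ne_of_mem_erase hA),
    fun A hA B hB => h.compatible A (Finset.mem_of_mem_erase hA) B (Finset.mem_of_mem_erase hB)⟩

theorem BinaryHierarchy.card_erase (hn : 3 ≤ n) {r : Fin n} {F : Finset (Finset (Fin n))}
    (h : BinaryHierarchy (Finset.univ.erase r) F) :
    (F.erase (Finset.univ.erase r)).card = n - 3 := by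
  have h1 := h.card
  rw [Finset.card_erase_of_mem (Finset.mem_univ r)] at h1
  rw [Finset.card_erase_of_mem (h.root_mem hn)]
  simp at h1
  omega

theorem IsLaminar.exists_extension (hn : 3 ≤ n) {r : Fin n} {σ : Finset (Finset (Fin n))}
    (h : IsLaminar r σ) : ∃ σ', IsLaminar r σ' ∧ σ ⊆ σ' ∧ σ'.card = n - 3 := by
  obtain ⟨F, hF, hB⟩ := h.exists_binaryHierarchy hn
  exact ⟨_, hB.isLaminar, hF, hB.card_erase hn⟩

/-- A family of `n - 3` clusters already has the cardinality of any hierarchy extending it, so it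
equals that hierarchy up to the top set. -/
theorem IsLaminar.binaryHierarchy (hn : 3 ≤ n) {r : Fin n} {σ : Finset (Finset (Fin n))}
    (h : IsLaminar r σ) (hc : σ.card = n - 3) :
    BinaryHierarchy (Finset.univ.erase r) (insert (Finset.univ.erase r) σ) := by
  obtain ⟨F, hF, hB⟩ := h.exists_binaryHierarchy hn
  have e := Finset.eq_of_subset_of_card_le hF (by rw [hB.card_erase hn, hc])
  rw [e, Finset.insert_erase (hB.root_mem hn)]
  exact hB

/-- A block containing elements of both children of a member of a laminar family contains it. -/
theorem subset_of_mem_children {α : Type} [DecidableEq α] {F : Finset (Finset α)}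
    {B C₁ C₂ : Finset α} (hB : ∀ A ∈ F, Compatible B A) (h₁ : IsBlock F C₁) (h₂ : IsBlock F C₂)
    (hd : Disjoint C₁ C₂) {x y : α} (hx : x ∈ C₁) (hy : y ∈ C₂) (hxB : x ∈ B) (hyB : y ∈ B) :
    C₁ ∪ C₂ ⊆ B := by
  refine Finset.union_subset ?_ ?_
  · refine ((h₁.compatible hB).of_mem hxB hx).resolve_left fun h => ?_
    exact Finset.disjoint_left.1 hd (h hyB) hy
  · refine ((h₂.compatible hB).of_mem hyB hy).resolve_left fun h => ?_
    exact Finset.disjoint_left.1 hd hx (h hxB)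

/-- In a laminar weighted family the weight of any cluster `A` is bounded below by the total
weight of the clusters separating `i, k` from `j` and the root, for suitable `i, k ∈ A`, `j ∉ A`. -/
theorem exists_separating_le (hn : 3 ≤ n) {r : Fin n} {σ : Finset (Finset (Fin n))}
    (hσ : IsLaminar r σ) (w : Finset (Fin n) → ℝ≥0∞) (hw : ∀ A ∉ σ, w A = 0)
    {A : Finset (Fin n)} (hA : IsCluster r A) :
    ∃ i k j, i ∈ A ∧ k ∈ A ∧ j ∉ A ∧ i ≠ k ∧ j ≠ r ∧
      ∑ B with i ∈ B ∧ k ∈ B ∧ j ∉ B ∧ r ∉ B, w B ≤ w A := by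
  by_cases hcomp : ∀ B ∈ σ, Compatible A B
  -- `A` can be adjoined and the family refined to a binary tree. Take `i`, `k` from the two
  -- children of `A` and `j` from its sibling: a member containing `i` and `k` contains `A`, and if
  -- it is larger it contains the parent of `A` and therefore `j`. So only `A` itself contributes to
  -- the sum.
  · have hlam : IsLaminar r (insert A σ) := by
      refine ⟨fun B hB => ?_, fun B hB C hC => ?_⟩
      · rcases Finset.mem_insert.1 hB with rfl | hB
        · exact hA
        · exact hσ.1 B hB
      · rcases Finset.mem_insert.1 hB with hB' | hB' <;>
          rcases Finset.mem_insert.1 hC with hC' | hC'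
        · rw [hB', hC']; exact Compatible.refl _
        · rw [hB']; exact hcomp C hC'
        · rw [hC']; exact (hcomp B hB').symm
        · exact hσ.2 B hB' C hC'
    obtain ⟨F, hF, hB⟩ := hlam.exists_binaryHierarchy hn
    have hAF : A ∈ F := Finset.mem_of_mem_erase (hF (Finset.mem_insert_self _ _))
    obtain ⟨C₁, C₂, ⟨i, hi⟩, ⟨k, hk⟩, hd, hAC, hb₁, hb₂⟩ := hB.exists_children A hAF
    obtain ⟨C₃, ⟨j, hj⟩, hd', hPF, hb₃⟩ := hB.exists_sibling A hAF hA.2.2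
    refine ⟨i, k, j, hAC ▸ Finset.mem_union_left _ hi, hAC ▸ Finset.mem_union_right _ hk,
      fun h => Finset.disjoint_left.1 hd' h hj, ?_, ?_, ?_⟩
    · rintro rfl
      exact Finset.disjoint_left.1 hd hi hk
    · rintro rfl
      exact Finset.notMem_erase j _ (hB.subset _ hPF (Finset.mem_union_right _ hj))
    · rw [Finset.sum_eq_single A]
      · intro B hBm hBA
        refine hw B fun hBσ => hBA ?_
        obtain ⟨-, hiB, hkB, hjB, -⟩ := Finset.mem_filter.1 hBm
        have hBF : B ∈ F := Finset.mem_of_mem_erase (hF (Finset.mem_insert_of_mem hBσ))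
        have hsub := subset_of_mem_children (hB.compatible B hBF) hb₁ hb₂ hd hi hk hiB hkB
        rw [← hAC] at hsub
        by_contra hne
        obtain ⟨x, hxB, hxA⟩ := Finset.not_subset.1 fun h => hne (Finset.Subset.antisymm h hsub)
        rcases hB.compatible B hBF _ hPF with h | h | h
        · exact Finset.disjoint_left.1 h hiB (Finset.mem_union_left _
            (hAC ▸ Finset.mem_union_left _ hi))
        · have hx3 : x ∈ C₃ := (Finset.mem_union.1 (h hxB)).resolve_left hxA
          exact hjB ((subset_of_mem_children (hB.compatible B hBF) (Or.inl hAF) hb₃ hd'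
            (hAC ▸ Finset.mem_union_left _ hi) hx3 hiB hxB) (Finset.mem_union_right _ hj))
        · exact hjB (h (Finset.mem_union_right _ hj))
      · intro hAm
        refine absurd (Finset.mem_filter.2 ⟨Finset.mem_univ _, ?_⟩) hAm
        exact ⟨hAC ▸ Finset.mem_union_left _ hi, hAC ▸ Finset.mem_union_right _ hk,
          fun h => Finset.disjoint_left.1 hd' h hj, hA.1⟩
  · push Not at hcomp
    obtain ⟨B, hBσ, hAB⟩ := hcomp
    -- When some `B` of the family crosses `A`, the three markings are taken from `A ∩ B`, `A \ B`
    -- and `B \ A`. A cluster with `i` and `k` but not `j` would cross `B`, so the sum is zero.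
    obtain ⟨⟨i, hiA, hiB⟩, ⟨k, hkA, hkB⟩, ⟨j, hjB, hjA⟩⟩ := not_compatible_iff.1 hAB
    refine ⟨i, k, j, hiA, hkA, hjA, ?_, ?_, ?_⟩
    · rintro rfl
      exact hkB hiB
    · rintro rfl
      exact (hσ.1 B hBσ).1 hjB
    · rw [Finset.sum_eq_zero]
      · exact zero_le
      · intro C hC
        obtain ⟨-, hiC, hkC, hjC, -⟩ := Finset.mem_filter.1 hC
        refine hw C fun hCσ => ?_
        exact (hσ.2 C hCσ B hBσ).not_crossing hiC hiB hkC hkB hjB hjC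

/-- A laminar weight is determined by the total weights of the clusters separating two markings
from a third one and from the root. -/
theorem laminar_weight_ext (hn : 3 ≤ n) {r : Fin n} {σ σ' : Finset (Finset (Fin n))}
    (hσ : IsLaminar r σ) (hσ' : IsLaminar r σ') (w w' : Finset (Fin n) → ℝ≥0∞)
    (hw : ∀ A ∉ σ, w A = 0) (hw' : ∀ A ∉ σ', w' A = 0)
    (h : ∀ i k j : Fin n, i ≠ k → i ≠ j → k ≠ j → i ≠ r → k ≠ r → j ≠ r →
      ∑ B with i ∈ B ∧ k ∈ B ∧ j ∉ B ∧ r ∉ B, w B = ∑ B with i ∈ B ∧ k ∈ B ∧ j ∉ B ∧ r ∉ B, w' B) :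
    w = w' := by
  have key : ∀ (σ σ' : Finset (Finset (Fin n))), IsLaminar r σ → IsLaminar r σ' →
      ∀ w w' : Finset (Fin n) → ℝ≥0∞, (∀ A ∉ σ, w A = 0) → (∀ A ∉ σ', w' A = 0) →
      (∀ i k j : Fin n, i ≠ k → i ≠ j → k ≠ j → i ≠ r → k ≠ r → j ≠ r →
      ∑ B with i ∈ B ∧ k ∈ B ∧ j ∉ B ∧ r ∉ B, w B =
        ∑ B with i ∈ B ∧ k ∈ B ∧ j ∉ B ∧ r ∉ B, w' B) → ∀ A, w A ≤ w' A := by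
    intro σ σ' hσ hσ' w w' hw hw' h A
    by_cases hA : A ∈ σ
    · have hcl := hσ.1 A hA
      obtain ⟨i, k, j, hi, hk, hj, hik, hjr, hle⟩ := exists_separating_le hn hσ' w' hw' hcl
      have hir : i ≠ r := fun e => hcl.1 (e ▸ hi)
      have hkr : k ≠ r := fun e => hcl.1 (e ▸ hk)
      have hij : i ≠ j := fun e => hj (e ▸ hi)
      have hkj : k ≠ j := fun e => hj (e ▸ hk)
      -- `w A` is one term of the separating sum of `w`; that sum equals the one of `w'`, which the
      -- choice of `i`, `k`, `j` bounds by `w' A`.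
      refine le_trans ?_ ((h i k j hik hij hkj hir hkr hjr).le.trans hle)
      exact Finset.single_le_sum (f := w) (fun _ _ => zero_le)
        (Finset.mem_filter.2 ⟨Finset.mem_univ A, hi, hk, hj, hcl.1⟩)
    · rw [hw A hA]; exact zero_le
  ext1 A
  exact le_antisymm (key σ σ' hσ hσ' w w' hw hw' h A)
    (key σ' σ hσ' hσ w' w hw' hw (fun i k j a b c d e f => (h i k j a b c d e f).symm) A)

end Cluster

/-! ## Relative interiors -/

section Interior

variable {E : Type} [NormedAddCommGroup E] [NormedSpace ℝ E]

/-- The line through `x` in direction `u` stays in the affine span, so the relative neighbourhood of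
`x` in `s` pulls back to a neighbourhood of `0` in ℝ. -/
theorem exists_add_smul_mem_of_mem_intrinsicInterior {s : Set E} {x : E}
    (hx : x ∈ intrinsicInterior ℝ s) {u : E} (hu : u ∈ vectorSpan ℝ s) :
    ∃ ε : ℝ, 0 < ε ∧ ∀ t : ℝ, |t| < ε → x + t • u ∈ s := by
  obtain ⟨y, hy, rfl⟩ := mem_intrinsicInterior.1 hx
  have hmem : ∀ t : ℝ, (y : E) + t • u ∈ affineSpan ℝ s := by
    intro t
    have := AffineSubspace.vadd_mem_of_mem_direction (s := affineSpan ℝ s) (v := t • u)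
      (by rw [direction_affineSpan]; exact Submodule.smul_mem _ _ hu) y.2
    simpa [add_comm] using this
  have hcont : Continuous fun t : ℝ => (⟨(y : E) + t • u, hmem t⟩ : affineSpan ℝ s) := by
    fun_prop
  have h0 : (fun t : ℝ => (⟨(y : E) + t • u, hmem t⟩ : affineSpan ℝ s)) 0 = y := by
    ext; simp
  have hnhds := (hcont.continuousAt (x := 0)).preimage_mem_nhds
    (t := (↑) ⁻¹' s) (by simpa [h0] using mem_interior_iff_mem_nhds.1 hy)
  obtain ⟨ε, hε, hball⟩ := Metric.mem_nhds_iff.1 hnhds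
  refine ⟨ε, hε, fun t ht => ?_⟩
  have := hball (show t ∈ Metric.ball (0 : ℝ) ε by simpa using ht)
  simpa using this

theorem mem_intrinsicInterior_of_isOpen {s U : Set E} {x : E} (hx : x ∈ s) (hU : IsOpen U)
    (hxU : x ∈ U) (h : ∀ y ∈ affineSpan ℝ s, y ∈ U → y ∈ s) : x ∈ intrinsicInterior ℝ s := by
  refine mem_intrinsicInterior.2 ⟨⟨x, subset_affineSpan ℝ s hx⟩, ?_, rfl⟩
  exact mem_interior.2 ⟨((↑) : affineSpan ℝ s → E) ⁻¹' U, fun y hy => h y y.2 hy,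
    hU.preimage continuous_subtype_val, hxU⟩

end Interior

/-! ## Unimodular simplicial cones -/

section Cone

variable {ι κ : Type} [Fintype ι] [Fintype κ] [DecidableEq κ]

/-- The linear functional with integer coefficients `l`. -/
noncomputable def intFunctional (l : ι → ℤ) : (ι → ℝ) →ₗ[ℝ] ℝ :=
  ∑ i, (l i : ℝ) • LinearMap.proj i

omit [Fintype κ] [DecidableEq κ] in
theorem intFunctional_apply (l : ι → ℤ) (x : ι → ℝ) :
    intFunctional l x = ∑ i, (l i : ℝ) * x i := by
  simp [intFunctional]

/-- The linear map sending the weight `w` to the vector `∑ w_A d_A`. -/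
noncomputable def weightMap (d : κ → ι → ℤ) : (κ → ℝ) →ₗ[ℝ] (ι → ℝ) :=
  Fintype.linearCombination ℝ fun A => intPoint (d A)

theorem weightMap_apply (d : κ → ι → ℤ) (w : κ → ℝ) (i : ι) :
    weightMap d w i = ∑ A, w A * d A i := by
  simp [weightMap, Fintype.linearCombination_apply, intPoint]

theorem weightMap_single (d : κ → ι → ℤ) (A : κ) (t : ℝ) :
    weightMap d (Pi.single A t) = t • intPoint (d A) := by
  ext i
  rw [weightMap_apply, Finset.sum_eq_single A] <;> simp +contextual [intPoint]

theorem intFunctional_weightMap (d : κ → ι → ℤ) (l : ι → ℤ) (w : κ → ℝ) :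
    intFunctional l (weightMap d w) = ∑ A, w A * ((∑ i, l i * d A i : ℤ) : ℝ) := by
  simp only [intFunctional_apply, weightMap_apply, Finset.mul_sum]
  rw [Finset.sum_comm]
  refine Finset.sum_congr rfl fun A _ => ?_
  push_cast
  rw [Finset.mul_sum]
  exact Finset.sum_congr rfl fun i _ => by ring

omit [Fintype κ] [DecidableEq κ] in
theorem intFunctional_intPoint (l z : ι → ℤ) :
    intFunctional l (intPoint z) = ((∑ i, l i * z i : ℤ) : ℝ) := by
  simp [intFunctional_apply, intPoint]

/-- The cone spanned by the vectors `d_A` with `A ∈ σ`. -/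
def coneOf (d : κ → ι → ℤ) (σ : Finset κ) : Set (ι → ℝ) :=
  weightMap d '' {w | (∀ A, 0 ≤ w A) ∧ ∀ A ∉ σ, w A = 0}

/-- The integer functionals `l` are dual to the vectors `d_A`, `A ∈ σ`. -/
def IsDualOn (d l : κ → ι → ℤ) (σ : Finset κ) : Prop :=
  ∀ A ∈ σ, ∀ B ∈ σ, ∑ i, l A i * d B i = if A = B then 1 else 0

/-- The linear span of the vectors `d_A` with `A ∈ σ`. -/
def coneSpan (d : κ → ι → ℤ) (σ : Finset κ) : Submodule ℝ (ι → ℝ) :=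
  Submodule.span ℝ (Set.range fun A : σ => intPoint (d A))

variable {d l : κ → ι → ℤ} {σ τ : Finset κ}

theorem coneOf_mono (d : κ → ι → ℤ) (h : τ ⊆ σ) : coneOf d τ ⊆ coneOf d σ :=
  Set.image_mono fun _ hw => ⟨hw.1, fun A hA => hw.2 A fun h' => hA (h h')⟩

theorem zero_mem_coneOf (d : κ → ι → ℤ) (σ : Finset κ) : (0 : ι → ℝ) ∈ coneOf d σ :=
  ⟨0, ⟨fun _ => le_rfl, fun _ _ => rfl⟩, map_zero _⟩

theorem smul_mem_coneOf (d : κ → ι → ℤ) {A : κ} (hA : A ∈ σ) {t : ℝ} (ht : 0 ≤ t) :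
    t • intPoint (d A) ∈ coneOf d σ := by
  refine ⟨Pi.single A t, ⟨fun B => ?_, fun B hB => ?_⟩, weightMap_single d A t⟩
  · by_cases h : B = A
    · subst h; simpa using ht
    · simp [h]
  · have : B ≠ A := fun e => hB (e ▸ hA)
    simp [this]

theorem intPoint_mem_coneSpan (d : κ → ι → ℤ) {A : κ} (hA : A ∈ σ) :
    intPoint (d A) ∈ coneSpan d σ :=
  Submodule.subset_span ⟨⟨A, hA⟩, rfl⟩

theorem weightMap_mem_coneSpan (d : κ → ι → ℤ) {w : κ → ℝ} (hw : ∀ A ∉ σ, w A = 0) :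
    weightMap d w ∈ coneSpan d σ := by
  rw [weightMap, Fintype.linearCombination_apply]
  refine Submodule.sum_mem _ fun A _ => ?_
  by_cases hA : A ∈ σ
  · exact Submodule.smul_mem _ _ (intPoint_mem_coneSpan d hA)
  · simp [hw A hA]

theorem mem_coneSpan_iff {x : ι → ℝ} :
    x ∈ coneSpan d σ ↔ ∃ w : κ → ℝ, (∀ A ∉ σ, w A = 0) ∧ weightMap d w = x := by
  constructor
  · intro hx
    induction hx using Submodule.span_induction with
    | mem x hx =>
      obtain ⟨A, rfl⟩ := hx
      refine ⟨Pi.single A.1 1, fun B hB => ?_, by rw [weightMap_single, one_smul]⟩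
      have : B ≠ A.1 := fun e => hB (e ▸ A.2)
      simp [this]
    | zero => exact ⟨0, fun _ _ => rfl, map_zero _⟩
    | add x y _ _ hx hy =>
      obtain ⟨w, hw, rfl⟩ := hx
      obtain ⟨w', hw', rfl⟩ := hy
      exact ⟨w + w', fun A hA => by simp [hw A hA, hw' A hA], map_add _ _ _⟩
    | smul a x _ hx =>
      obtain ⟨w, hw, rfl⟩ := hx
      exact ⟨a • w, fun A hA => by simp [hw A hA], map_smul _ _ _⟩
  · rintro ⟨w, hw, rfl⟩
    exact weightMap_mem_coneSpan d hw

theorem vectorSpan_coneOf (d : κ → ι → ℤ) (σ : Finset κ) :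
    vectorSpan ℝ (coneOf d σ) = coneSpan d σ := by
  rw [vectorSpan_eq_span_vsub_set_right ℝ (zero_mem_coneOf d σ)]
  apply le_antisymm
  · refine Submodule.span_le.2 ?_
    rintro _ ⟨_, ⟨w, hw, rfl⟩, rfl⟩
    simpa using weightMap_mem_coneSpan d hw.2
  · refine Submodule.span_le.2 ?_
    rintro _ ⟨A, rfl⟩
    refine Submodule.subset_span ⟨intPoint (d A), ?_, by simp⟩
    simpa using smul_mem_coneOf d A.2 zero_le_one

theorem mem_affineSpan_coneOf {x : ι → ℝ} :
    x ∈ affineSpan ℝ (coneOf d σ) ↔ x ∈ coneSpan d σ := by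
  rw [← AffineSubspace.vsub_right_mem_direction_iff_mem
    (subset_affineSpan ℝ _ (zero_mem_coneOf d σ)), direction_affineSpan, vectorSpan_coneOf]
  simp

namespace IsDualOn

theorem mono (h : IsDualOn d l σ) (hτ : τ ⊆ σ) : IsDualOn d l τ :=
  fun A hA B hB => h A (hτ hA) B (hτ hB)

/-- The dual functionals read off the weights, so they serve as coordinates on the span of the cone.
-/
theorem apply_weightMap (h : IsDualOn d l σ) {w : κ → ℝ} (hw : ∀ A ∉ σ, w A = 0) {A : κ}
    (hA : A ∈ σ) : intFunctional (l A) (weightMap d w) = w A := by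
  rw [intFunctional_weightMap, Finset.sum_eq_single A]
  · rw [h A hA A hA]; simp
  · intro B _ hBA
    by_cases hB : B ∈ σ
    · rw [h A hA B hB, if_neg (Ne.symm hBA)]; simp
    · rw [hw B hB, zero_mul]
  · intro hn; exact absurd (Finset.mem_univ A) hn

theorem linearIndependent (h : IsDualOn d l σ) :
    LinearIndependent ℝ fun A : σ => intPoint (d A) := by
  rw [Fintype.linearIndependent_iff]
  intro g hg A
  have h1 := congrArg (intFunctional (l A)) hg
  rw [map_sum, map_zero, Finset.sum_eq_single A] at h1
  · rw [map_smul, intFunctional_intPoint, h A A.2 A A.2] at h1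
    simpa using h1
  · intro B _ hBA
    rw [map_smul, intFunctional_intPoint, h A A.2 B B.2, if_neg fun e => hBA (Subtype.ext e.symm)]
    simp
  · intro hn; exact absurd (Finset.mem_univ A) hn

theorem finrank_coneSpan (h : IsDualOn d l σ) : Module.finrank ℝ (coneSpan d σ) = σ.card := by
  rw [coneSpan, finrank_span_eq_card h.linearIndependent, Fintype.card_coe]

theorem affDim_coneOf (h : IsDualOn d l σ) : affDim (coneOf d σ) = σ.card := by
  rw [affDim, vectorSpan_coneOf, h.finrank_coneSpan]

/-- A vector of the span of the cone is the combination of the generators with the values of the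
dual functionals as coefficients. -/
theorem eq_sum (h : IsDualOn d l σ) {x : ι → ℝ} (hx : x ∈ coneSpan d σ) :
    x = ∑ A ∈ σ, intFunctional (l A) x • intPoint (d A) := by
  obtain ⟨w, hw, rfl⟩ := mem_coneSpan_iff.1 hx
  rw [Finset.sum_congr rfl fun A hA => by rw [h.apply_weightMap hw hA], weightMap,
    Fintype.linearCombination_apply]
  exact (Finset.sum_subset (Finset.subset_univ σ) fun A _ hA => by rw [hw A hA, zero_smul]).symm

theorem mem_coneOf_iff (h : IsDualOn d l σ) {x : ι → ℝ} :
    x ∈ coneOf d σ ↔ x ∈ coneSpan d σ ∧ ∀ A ∈ σ, 0 ≤ intFunctional (l A) x := by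
  constructor
  · rintro ⟨w, hw, rfl⟩
    exact ⟨weightMap_mem_coneSpan d hw.2, fun A hA => by
      rw [h.apply_weightMap hw.2 hA]; exact hw.1 A⟩
  · rintro ⟨hx, hpos⟩
    obtain ⟨w, hw, rfl⟩ := mem_coneSpan_iff.1 hx
    refine ⟨w, ⟨fun A => ?_, hw⟩, rfl⟩
    by_cases hA : A ∈ σ
    · rw [← h.apply_weightMap hw hA]; exact hpos A hA
    · rw [hw A hA]

/-- The span is cut out by the integer equations x_i = ∑ l_A(x) d_A(i), each written as two
inequalities, and inside it the cone is given by l_A ≥ 0. -/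
theorem isRationalPolyhedron (h : IsDualOn d l σ) : IsRationalPolyhedron (coneOf d σ) := by
  classical
  refine ⟨⟨0, zero_mem_coneOf d σ⟩, ?_⟩
  let e : ι → ι → ℤ := fun i j => (if i = j then 1 else 0) - ∑ A ∈ σ, l A j * d A i
  have he : ∀ (i : ι) (x : ι → ℝ), ∑ j, (e i j : ℝ) * x j =
      x i - ∑ A ∈ σ, intFunctional (l A) x * d A i := by
    intro i x
    simp only [e, intFunctional_apply]
    push_cast
    simp only [sub_mul, Finset.sum_sub_distrib, Finset.sum_mul]
    rw [Finset.sum_comm]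
    congr 1
    · simp
    · exact Finset.sum_congr rfl fun A _ => Finset.sum_congr rfl fun i _ => by ring
  refine ⟨(σ.image fun A => (-l A, 0)) ∪ (Finset.univ.image fun i => (e i, 0)) ∪
    (Finset.univ.image fun i => (-e i, 0)), ?_⟩
  ext x
  rw [h.mem_coneOf_iff]
  simp only [Finset.mem_union, Finset.mem_image, Finset.mem_univ, true_and, Set.mem_ofPred_eq]
  constructor
  · rintro ⟨hx, hpos⟩
    have hz : ∀ i, x i - ∑ A ∈ σ, intFunctional (l A) x * d A i = 0 := by
      intro i
      have := congrFun (h.eq_sum hx) i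
      simp only [Finset.sum_apply, Pi.smul_apply, smul_eq_mul, intPoint] at this
      exact sub_eq_zero.2 this
    rintro c ((⟨A, hA, rfl⟩ | ⟨i, rfl⟩) | ⟨i, rfl⟩)
    · have := hpos A hA
      rw [intFunctional_apply] at this
      simp only [Pi.neg_apply, Int.cast_neg, neg_mul, Finset.sum_neg_distrib]
      linarith
    · simp only [he, hz]; exact le_rfl
    · simp only [Pi.neg_apply, Int.cast_neg, neg_mul, Finset.sum_neg_distrib, he, hz, neg_zero]
      exact le_rfl
  · intro hc
    refine ⟨?_, fun A hA => ?_⟩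
    · have : x = ∑ A ∈ σ, intFunctional (l A) x • intPoint (d A) := by
        ext i
        have h1 := hc (e i, 0) (Or.inl (Or.inr ⟨i, rfl⟩))
        have h2 := hc (-e i, 0) (Or.inr ⟨i, rfl⟩)
        simp only [Pi.neg_apply, Int.cast_neg, neg_mul, Finset.sum_neg_distrib, he] at h1 h2
        simp only [Finset.sum_apply, Pi.smul_apply, smul_eq_mul, intPoint]
        linarith
      rw [this]
      exact Submodule.sum_mem _ fun A hA => Submodule.smul_mem _ _ (intPoint_mem_coneSpan d hA)
    · have h1 := hc (-l A, 0) (Or.inl (Or.inl ⟨A, hA, rfl⟩))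
      simp only [Pi.neg_apply, Int.cast_neg, neg_mul, Finset.sum_neg_distrib] at h1
      rw [intFunctional_apply]
      linarith

/-- The functional −∑ l_A over `A ∈ σ \ τ` is nonpositive on the cone and vanishes exactly on the
face spanned by `τ`. -/
theorem isExposed_of_subset (h : IsDualOn d l σ) (hτ : τ ⊆ σ) :
    IsExposed ℝ (coneOf d σ) (coneOf d τ) := by
  intro _
  let f : (ι → ℝ) →ₗ[ℝ] ℝ := -∑ A ∈ σ \ τ, intFunctional (l A)
  refine ⟨LinearMap.toContinuousLinearMap f, ?_⟩
  have hf : ∀ x ∈ coneOf d σ, f x ≤ 0 := by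
    intro x hx
    simp only [f, LinearMap.neg_apply, LinearMap.sum_apply, Left.neg_nonpos_iff]
    exact Finset.sum_nonneg fun A hA => (h.mem_coneOf_iff.1 hx).2 A (Finset.sdiff_subset hA)
  ext x
  simp only [LinearMap.coe_toContinuousLinearMap', Set.mem_ofPred_eq]
  constructor
  · intro hx
    refine ⟨coneOf_mono d hτ hx, fun y hy => ?_⟩
    have : f x = 0 := by
      obtain ⟨w, hw, rfl⟩ := hx
      simp only [f, LinearMap.neg_apply, LinearMap.sum_apply, neg_eq_zero]
      refine Finset.sum_eq_zero fun A hA => ?_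
      rw [h.apply_weightMap (fun A hA => hw.2 A fun h' => hA (hτ h')) (Finset.sdiff_subset hA)]
      exact hw.2 A (Finset.mem_sdiff.1 hA).2
    rw [this]
    exact hf y hy
  · rintro ⟨⟨w, hw, rfl⟩, hmax⟩
    have h0 := hmax 0 (zero_mem_coneOf d σ)
    rw [map_zero] at h0
    have hz : ∑ A ∈ σ \ τ, w A = 0 := by
      apply le_antisymm _ (Finset.sum_nonneg fun A _ => hw.1 A)
      simp only [f, LinearMap.neg_apply, LinearMap.sum_apply] at h0
      rw [Finset.sum_congr rfl fun A hA => h.apply_weightMap hw.2 (Finset.sdiff_subset hA)] at h0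
      linarith
    refine ⟨w, ⟨hw.1, fun A hA => ?_⟩, rfl⟩
    by_cases hAσ : A ∈ σ
    · exact (Finset.sum_eq_zero_iff_of_nonneg fun A _ => hw.1 A).1 hz A
        (Finset.mem_sdiff.2 ⟨hAσ, hA⟩)
    · exact hw.2 A hAσ

end IsDualOn

/-- A functional attaining its maximum on a cone has maximum 0, by scaling. It is then nonpositive
on the generators, and its maximal face is spanned by the generators on which it vanishes. -/
theorem exists_subset_of_isExposed {E : Set (ι → ℝ)} (hE : E.Nonempty)
    (h : IsExposed ℝ (coneOf d σ) E) : ∃ τ ⊆ σ, E = coneOf d τ := by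
  classical
  obtain ⟨f, rfl⟩ := h hE
  obtain ⟨x, hx, hmax⟩ := hE
  have hsmul : ∀ y ∈ coneOf d σ, ∀ t : ℝ, 0 ≤ t → t • y ∈ coneOf d σ := by
    rintro _ ⟨w, hw, rfl⟩ t ht
    exact ⟨t • w, ⟨fun A => mul_nonneg ht (hw.1 A), fun A hA => by simp [hw.2 A hA]⟩,
      map_smul _ _ _⟩
  have h0 : 0 ≤ f x := by simpa using hmax 0 (zero_mem_coneOf d σ)
  have hx0 : f x = 0 := by
    have := hmax _ (hsmul x hx 2 (by norm_num))
    rw [map_smul, smul_eq_mul] at this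
    linarith
  have hle : ∀ y ∈ coneOf d σ, f y ≤ 0 := fun y hy => hx0 ▸ hmax y hy
  have hgen : ∀ A ∈ σ, f (intPoint (d A)) ≤ 0 := fun A hA => by
    simpa using hle _ (smul_mem_coneOf d hA zero_le_one)
  refine ⟨σ.filter fun A => f (intPoint (d A)) = 0, Finset.filter_subset _ _, ?_⟩
  have hfw : ∀ w : κ → ℝ, f (weightMap d w) = ∑ A, w A * f (intPoint (d A)) := by
    intro w
    rw [weightMap, Fintype.linearCombination_apply, map_sum]
    simp
  ext y
  constructor
  · rintro ⟨⟨w, hw, rfl⟩, hy⟩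
    refine ⟨w, ⟨hw.1, fun A hA => ?_⟩, rfl⟩
    by_cases hAσ : A ∈ σ
    · have hz : f (weightMap d w) = 0 :=
        le_antisymm (hle _ ⟨w, hw, rfl⟩) (by simpa using hy 0 (zero_mem_coneOf d σ))
      rw [hfw] at hz
      have hterm : ∀ B ∈ Finset.univ, w B * f (intPoint (d B)) ≤ 0 := by
        intro B _
        by_cases hB : B ∈ σ
        · exact mul_nonpos_of_nonneg_of_nonpos (hw.1 B) (hgen B hB)
        · rw [hw.2 B hB, zero_mul]
      have := (Finset.sum_eq_zero_iff_of_nonpos hterm).1 hz A (Finset.mem_univ A)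
      rcases mul_eq_zero.1 this with h | h
      · exact h
      · exact absurd (Finset.mem_filter.2 ⟨hAσ, h⟩) hA
    · exact hw.2 A hAσ
  · rintro ⟨w, hw, rfl⟩
    have hz : f (weightMap d w) = 0 := by
      rw [hfw]
      refine Finset.sum_eq_zero fun A _ => ?_
      by_cases hA : A ∈ σ.filter fun A => f (intPoint (d A)) = 0
      · rw [(Finset.mem_filter.1 hA).2, mul_zero]
      · rw [hw.2 A hA, zero_mul]
    refine ⟨⟨w, ⟨hw.1, fun A hA => hw.2 A fun h' => hA (Finset.filter_subset _ _ h')⟩, rfl⟩, ?_⟩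
    rw [hz]
    exact hle

namespace IsDualOn

/-- A relatively interior point can be moved a little by a negative multiple of d_A without leaving
the cone, and this lowers the value of l_A. -/
theorem pos_of_mem_intrinsicInterior (h : IsDualOn d l σ) {x : ι → ℝ}
    (hx : x ∈ intrinsicInterior ℝ (coneOf d σ)) {A : κ} (hA : A ∈ σ) :
    0 < intFunctional (l A) x := by
  obtain ⟨ε, hε, H⟩ := exists_add_smul_mem_of_mem_intrinsicInterior hx
    (u := intPoint (d A)) (by rw [vectorSpan_coneOf]; exact intPoint_mem_coneSpan d hA)
  have h1 := (h.mem_coneOf_iff.1 (H (-(ε / 2)) (by rw [abs_neg, abs_of_pos] <;> linarith))).2 A hA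
  rw [map_add, map_smul, intFunctional_intPoint, h A hA A hA] at h1
  simp at h1
  linarith

theorem mem_intrinsicInterior (h : IsDualOn d l σ) {x : ι → ℝ} (hx : x ∈ coneSpan d σ)
    (hpos : ∀ A ∈ σ, 0 < intFunctional (l A) x) : x ∈ intrinsicInterior ℝ (coneOf d σ) := by
  refine mem_intrinsicInterior_of_isOpen (U := ⋂ A ∈ σ, {y | 0 < intFunctional (l A) y})
    (h.mem_coneOf_iff.2 ⟨hx, fun A hA => (hpos A hA).le⟩) ?_ ?_ ?_
  · refine isOpen_biInter_finset fun A _ => isOpen_lt continuous_const ?_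
    exact LinearMap.continuous_of_finiteDimensional _
  · simpa using hpos
  · intro y hy hyU
    simp only [Set.mem_iInter, Set.mem_ofPred_eq] at hyU
    exact h.mem_coneOf_iff.2 ⟨mem_affineSpan_coneOf.1 hy, fun A hA => (hyU A hA).le⟩

end IsDualOn

end Cone

/-! ## Lattices and indices -/

section Lattice

/-- The image of `H + ℤx` under `φ` is generated by `φ x`, and its intersection with the kernel is
`H`, because a + m x lies in the kernel only if m = 0. With `H` fixed, the index of `H + ℤx` is thus
proportional to |φ x|; this is how the multiplicities of the facets around a face are compared. -/
theorem index_sup_zmultiples {G : Type} [AddCommGroup G] (φ : G →+ ℤ) (H : AddSubgroup G)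
    (hH : H ≤ φ.ker) (x : G) (hx : φ x ≠ 0) :
    (H ⊔ AddSubgroup.zmultiples x).index * φ.range.index = H.relIndex φ.ker * (φ x).natAbs := by
  have hmap : (H ⊔ AddSubgroup.zmultiples x).map φ = AddSubgroup.zmultiples (φ x) := by
    rw [AddSubgroup.map_sup, (AddSubgroup.map_eq_bot_iff H).2 hH, bot_sup_eq, AddMonoidHom.map_zmultiples]
  have h1 := AddSubgroup.index_map (H ⊔ AddSubgroup.zmultiples x) φ
  rw [hmap, Int.index_zmultiples] at h1
  have h2 := AddSubgroup.relIndex_mul_index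
    (le_sup_left : H ⊔ AddSubgroup.zmultiples x ≤ (H ⊔ AddSubgroup.zmultiples x) ⊔ φ.ker)
  rw [AddSubgroup.relIndex_sup_left] at h2
  have h3 : (H ⊔ AddSubgroup.zmultiples x).relIndex φ.ker = H.relIndex φ.ker := by
    rw [← AddSubgroup.inf_relIndex_right, ← AddSubgroup.inf_relIndex_right H]
    congr 1
    refine le_antisymm (le_inf ?_ inf_le_right) (inf_le_inf_right _ le_sup_left)
    rintro y ⟨hy, hyk⟩
    obtain ⟨a, ha, b, hb, rfl⟩ := AddSubgroup.mem_sup.1 hy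
    obtain ⟨m, rfl⟩ := AddSubgroup.mem_zmultiples_iff.1 hb
    have hk : φ (a + m • x) = 0 := hyk
    rw [map_add, (hH ha : φ a = 0), zero_add, map_zsmul, smul_eq_mul] at hk
    rcases mul_eq_zero.1 hk with h | h
    · simpa [h] using ha
    · exact absurd h hx
  rw [← h2, h3, h1, mul_assoc]

variable {ι : Type} [Fintype ι]

/-- A proper real span of integer vectors comes from a proper rational span, since the latter would
otherwise contain the standard basis. Over ℚ there is a nonzero functional vanishing on it, and its
denominators can be cleared. -/
theorem exists_intFunctional_eq_zero (s : Set (ι → ℤ))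
    (hs : Submodule.span ℝ (intPoint '' s) ≠ ⊤) :
    ∃ a : ι → ℤ, a ≠ 0 ∧ ∀ x ∈ Submodule.span ℝ (intPoint '' s), intFunctional a x = 0 := by
  classical
  let K : Submodule ℚ (ι → ℚ) := Submodule.span ℚ ((fun z i => (z i : ℚ)) '' s)
  have hK : K < ⊤ := by
    refine lt_top_iff_ne_top.2 fun htop => hs ?_
    have hcast : ∀ x ∈ K, (fun i => (x i : ℝ)) ∈ Submodule.span ℝ (intPoint '' s) := by
      intro x hx
      induction hx using Submodule.span_induction with
      | mem x hx =>
        obtain ⟨z, hz, rfl⟩ := hx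
        refine Submodule.subset_span ⟨z, hz, ?_⟩
        ext i; simp [intPoint]
      | zero =>
        have : (fun i : ι => (((0 : ι → ℚ) i : ℚ) : ℝ)) = 0 := by ext i; simp
        rw [this]
        exact Submodule.zero_mem _
      | add x y _ _ hx hy =>
        convert Submodule.add_mem _ hx hy using 1
        ext i; simp
      | smul a x _ hx =>
        convert Submodule.smul_mem _ (a : ℝ) hx using 1
        ext i; simp
    rw [eq_top_iff]
    intro x _
    rw [pi_eq_sum_univ' x]
    refine Submodule.sum_mem _ fun i _ => Submodule.smul_mem _ _ ?_
    have h := hcast (fun j => if i = j then 1 else 0) (htop ▸ Submodule.mem_top)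
    convert h using 2 with j
    by_cases hij : i = j
    · subst hij; simp
    · simp [hij, Ne.symm hij]
  obtain ⟨f, hf, hKf⟩ := Submodule.exists_le_ker_of_lt_top K hK
  let e : ι → ℚ := fun i => f (Pi.single i 1)
  have hfe : ∀ x : ι → ℚ, f x = ∑ i, e i * x i := by
    intro x
    rw [LinearMap.pi_apply_eq_sum_univ f x]
    refine Finset.sum_congr rfl fun i _ => ?_
    rw [smul_eq_mul, mul_comm]
    congr 2
    ext j
    simp [Pi.single_apply, eq_comm]
  -- The product of the denominators is a common denominator of the coefficients of `f`.
  let N : ℕ := ∏ i, (e i).den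
  have hN : N ≠ 0 := Finset.prod_ne_zero_iff.2 fun i _ => (e i).den_nz
  have ha : ∀ i, ∃ m : ℤ, (m : ℚ) = N * e i := by
    intro i
    obtain ⟨c, hc⟩ := Finset.dvd_prod_of_mem (fun i => (e i).den) (Finset.mem_univ i)
    refine ⟨c * (e i).num, ?_⟩
    have : (N : ℚ) = (e i).den * c := by exact_mod_cast hc
    rw [this]
    push_cast
    have h2 : ((e i).den : ℚ) * e i = (e i).num := Rat.den_mul_eq_num _
    linear_combination -(c : ℚ) * h2
  choose a ha using ha
  refine ⟨a, ?_, ?_⟩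
  · rintro rfl
    apply hf
    ext i
    have := ha i
    simp only [Pi.zero_apply, Int.cast_zero] at this
    rcases mul_eq_zero.1 this.symm with h | h
    · exact absurd (by exact_mod_cast h) hN
    · simpa [e] using h
  · intro x hx
    have hle : Submodule.span ℝ (intPoint '' s) ≤ LinearMap.ker (intFunctional a) := by
      refine Submodule.span_le.2 ?_
      rintro _ ⟨z, hz, rfl⟩
      have h0 : f (fun i => (z i : ℚ)) = 0 := hKf (Submodule.subset_span ⟨z, hz, rfl⟩)
      rw [hfe] at h0
      have h1 : ((∑ i, a i * z i : ℤ) : ℚ) = 0 := by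
        push_cast
        simp only [ha, mul_assoc]
        rw [← Finset.mul_sum, h0, mul_zero]
      rw [SetLike.mem_coe, LinearMap.mem_ker, intFunctional_intPoint]
      have h2 : (∑ i, a i * z i : ℤ) = 0 := by exact_mod_cast h1
      rw [h2, Int.cast_zero]
    exact hle hx

theorem mem_parallelLattice_coe {L : AffineSubspace ℝ (ι → ℝ)} {z : ι → ℤ} :
    z ∈ parallelLattice (L : Set (ι → ℝ)) ↔ intPoint z ∈ L.direction := by
  rw [AffineSubspace.direction_eq_vectorSpan]
  rfl

theorem mem_translateBy_iff {L : AffineSubspace ℝ (ι → ℝ)} {p v x : ι → ℝ} (hp : p ∈ L) :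
    x ∈ translateBy L v ↔ x - v - p ∈ L.direction := by
  rw [← vsub_eq_sub (x - v) p, AffineSubspace.vsub_right_mem_direction_iff_mem hp]
  rfl

variable {κ : Type} [Fintype κ] [DecidableEq κ] {d l : κ → ι → ℤ} {σ τ : Finset κ}

theorem mem_parallelLattice_coneOf {z : ι → ℤ} :
    z ∈ parallelLattice (coneOf d σ) ↔ intPoint z ∈ coneSpan d σ := by
  rw [← vectorSpan_coneOf]
  rfl

theorem intPoint_sub (a b : ι → ℤ) : intPoint (a - b) = intPoint a - intPoint b := by
  ext i; simp [intPoint]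

theorem intPoint_zsmul (m : ℤ) (a : ι → ℤ) : intPoint (m • a) = (m : ℝ) • intPoint a := by
  ext i; simp [intPoint]

theorem intPoint_sum {β : Type} (s : Finset β) (f : β → ι → ℤ) :
    intPoint (∑ b ∈ s, f b) = ∑ b ∈ s, intPoint (f b) := by
  ext i; simp [intPoint]

/-- The coefficient of d_A in an integer vector of the span is the integer l_A(z). Subtracting this
multiple leaves an integer vector in the span of `τ`. -/
theorem parallelLattice_coneOf_insert {A : κ} (hA : A ∉ τ) (h : IsDualOn d l (insert A τ)) :
    parallelLattice (coneOf d (insert A τ)) =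
      parallelLattice (coneOf d τ) ⊔ AddSubgroup.zmultiples (d A) := by
  apply le_antisymm
  · intro z hz
    have hz' := h.eq_sum (mem_parallelLattice_coneOf.1 hz)
    rw [Finset.sum_insert hA] at hz'
    refine AddSubgroup.mem_sup.2 ⟨z - (∑ i, l A i * z i) • d A, ?_, (∑ i, l A i * z i) • d A,
      AddSubgroup.mem_zmultiples_iff.2 ⟨_, rfl⟩, sub_add_cancel _ _⟩
    rw [mem_parallelLattice_coneOf, intPoint_sub, intPoint_zsmul, ← intFunctional_intPoint]
    nth_rewrite 1 [hz']
    rw [add_sub_cancel_left]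
    exact Submodule.sum_mem _ fun B hB => Submodule.smul_mem _ _ (intPoint_mem_coneSpan d hB)
  · refine sup_le (fun z hz => ?_) ?_
    · rw [mem_parallelLattice_coneOf] at hz ⊢
      refine Submodule.span_mono ?_ hz
      rintro _ ⟨B, rfl⟩
      exact ⟨⟨B.1, Finset.mem_insert_of_mem B.2⟩, rfl⟩
    · rw [AddSubgroup.zmultiples_le, mem_parallelLattice_coneOf]
      exact intPoint_mem_coneSpan d (Finset.mem_insert_self _ _)

end Lattice

/-! ## Fans of unimodular simplicial cones -/

section Fan

variable {ι κ : Type} [Fintype ι] [Fintype κ] [DecidableEq κ]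

/-- The weights with nonnegative values and with support in `σ`. -/
def IsWeightOn (σ : Finset κ) (w : κ → ℝ) : Prop := (∀ A, 0 ≤ w A) ∧ ∀ A ∉ σ, w A = 0

theorem IsWeightOn.mono {σ τ : Finset κ} {w : κ → ℝ} (h : IsWeightOn τ w) (hτ : τ ⊆ σ) :
    IsWeightOn σ w := ⟨h.1, fun A hA => h.2 A fun h' => hA (hτ h')⟩

/-- A pure simplicial fan of dimension `k` with unimodular cones spanned by vectors `d_A`, in
which around each codimension one cone there are three maximal cones whose additional generators
add up to an integer vector parallel to it, and in which the points of the fan with prescribed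
values of suitable integer functionals are bounded in some direction. -/
structure IsSmoothFan (k : ℕ) (Δ : Set (Finset κ)) (d : κ → ι → ℤ) : Prop where
  down : ∀ σ ∈ Δ, ∀ τ ⊆ σ, τ ∈ Δ
  pure : ∀ σ ∈ Δ, ∃ σ' ∈ Δ, σ ⊆ σ' ∧ σ'.card = k
  dual : ∀ σ ∈ Δ, σ.card = k → ∃ l, IsDualOn d l σ
  inj : ∀ σ ∈ Δ, ∀ σ' ∈ Δ, ∀ w w', IsWeightOn σ w → IsWeightOn σ' w' →
    weightMap d w = weightMap d w' → w = w'
  star : ∀ τ ∈ Δ, τ.card + 1 = k → ∀ A ∉ τ, insert A τ ∈ Δ →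
    ∃ (A' A'' : κ) (c : κ → ℤ) (l : κ → ι → ℤ) (h : ι → ℤ),
      A' ∉ τ ∧ A'' ∉ τ ∧ A ≠ A' ∧ A ≠ A'' ∧ A' ≠ A'' ∧ insert A' τ ∈ Δ ∧ insert A'' τ ∈ Δ ∧
      (∀ B ∉ τ, insert B τ ∈ Δ → B = A ∨ B = A' ∨ B = A'') ∧
      (∀ i, d A i + d A' i + d A'' i = ∑ B ∈ τ, c B * d B i) ∧
      IsDualOn d l (insert A τ) ∧ ∑ i, l A i * d A' i = -1 ∧
      ∀ w, IsWeightOn (insert A τ) w ∨ IsWeightOn (insert A' τ) w →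
        ∀ σ' ∈ Δ, ∀ w', IsWeightOn σ' w' →
        (∀ B ∈ insert A τ, intFunctional (l B) (weightMap d w') =
          intFunctional (l B) (weightMap d w)) →
        intFunctional h (weightMap d w') ≤ intFunctional h (weightMap d w) ∧
        (intFunctional h (weightMap d w') = intFunctional h (weightMap d w) → w' = w)

namespace IsSmoothFan

variable {k : ℕ} {Δ : Set (Finset κ)} {d : κ → ι → ℤ}

/-- By `inj` a point determines its weight regardless of the cone used, and the weight of the
generator d_A is supported at `A`. -/
theorem coneOf_subset (H : IsSmoothFan k Δ d) {σ τ : Finset κ} (hσ : σ ∈ Δ) (hτ : τ ∈ Δ)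
    (h : coneOf d τ ⊆ coneOf d σ) : τ ⊆ σ := by
  intro A hA
  obtain ⟨w, hw, he⟩ := h (smul_mem_coneOf d hA zero_le_one)
  have hs : IsWeightOn τ (Pi.single A (1 : ℝ)) := by
    refine ⟨fun B => ?_, fun B hB => ?_⟩
    · by_cases h : B = A
      · subst h; simp
      · simp [h]
    · have : B ≠ A := fun e => hB (e ▸ hA)
      simp [this]
  have := H.inj σ hσ τ hτ w _ hw hs (by rw [he, weightMap_single])
  by_contra hAσ
  have h0 := hw.2 A hAσ
  rw [this] at h0
  simp at h0

theorem coneOf_injective (H : IsSmoothFan k Δ d) {σ τ : Finset κ} (hσ : σ ∈ Δ) (hτ : τ ∈ Δ)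
    (h : coneOf d τ = coneOf d σ) : τ = σ :=
  Finset.Subset.antisymm (H.coneOf_subset hσ hτ h.subset) (H.coneOf_subset hτ hσ h.superset)

open Classical in
/-- The polyhedral complex whose facets are the maximal cones of the fan. -/
noncomputable def polyComplex (H : IsSmoothFan k Δ d) : PolyComplex ι k where
  facets := (Finset.univ.filter fun σ => σ ∈ Δ ∧ σ.card = k).image (coneOf d)
  polyhedron F hF := by
    obtain ⟨σ, hσ, rfl⟩ := Finset.mem_image.1 hF
    obtain ⟨-, hσ, hk⟩ := Finset.mem_filter.1 hσ
    obtain ⟨l, hl⟩ := H.dual σ hσ hk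
    exact hl.isRationalPolyhedron
  dim F hF := by
    obtain ⟨σ, hσ, rfl⟩ := Finset.mem_image.1 hF
    obtain ⟨-, hσ, hk⟩ := Finset.mem_filter.1 hσ
    obtain ⟨l, hl⟩ := H.dual σ hσ hk
    rw [hl.affDim_coneOf, hk]
  inter S hS F hF := by
    obtain ⟨σ, hσ, rfl⟩ := Finset.mem_image.1 (hS hF)
    obtain ⟨-, hσ, hk⟩ := Finset.mem_filter.1 hσ
    obtain ⟨l, hl⟩ := H.dual σ hσ hk
    -- A common point has the same weight in all the cones, so this weight is supported on the
    -- common generators.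
    have : ⋂₀ S = coneOf d (σ.filter fun A => ∀ σ' ∈ Δ, coneOf d σ' ∈ S → A ∈ σ') := by
      ext x
      constructor
      · intro hx
        obtain ⟨w, hw, rfl⟩ := hx _ hF
        refine ⟨w, ⟨hw.1, fun A hA => ?_⟩, rfl⟩
        by_contra hwA
        apply hA
        refine Finset.mem_filter.2 ⟨by_contra fun h => hwA (hw.2 A h), fun σ' hσ' hS' => ?_⟩
        obtain ⟨w', hw', he⟩ := hx _ hS'
        have := H.inj σ' hσ' σ hσ w' w hw' hw he
        subst this
        exact by_contra fun h => hwA (hw'.2 A h)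
      · rintro ⟨w, hw, rfl⟩ G hG
        obtain ⟨σ', hσ', rfl⟩ := Finset.mem_image.1 (hS hG)
        obtain ⟨-, hσ', -⟩ := Finset.mem_filter.1 hσ'
        exact ⟨w, ⟨hw.1, fun A hA => hw.2 A fun h => hA ((Finset.mem_filter.1 h).2 σ' hσ' hG)⟩, rfl⟩
    rw [this]
    exact hl.isExposed_of_subset (Finset.filter_subset _ _)

theorem mem_facets (H : IsSmoothFan k Δ d) {F : Set (ι → ℝ)} :
    F ∈ H.polyComplex.facets ↔ ∃ σ ∈ Δ, σ.card = k ∧ F = coneOf d σ := by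
  classical
  simp only [polyComplex, Finset.mem_image, Finset.mem_filter, Finset.mem_univ, true_and]
  constructor
  · rintro ⟨σ, ⟨h1, h2⟩, rfl⟩
    exact ⟨σ, h1, h2, rfl⟩
  · rintro ⟨σ, h1, h2, rfl⟩
    exact ⟨σ, ⟨h1, h2⟩, rfl⟩

theorem mem_finitePart (H : IsSmoothFan k Δ d) {x : ι → ℝ} :
    x ∈ H.polyComplex.finitePart ↔ ∃ σ ∈ Δ, ∃ w, IsWeightOn σ w ∧ weightMap d w = x := by
  constructor
  · rintro ⟨F, hF, hx⟩
    obtain ⟨σ, hσ, -, rfl⟩ := H.mem_facets.1 hF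
    obtain ⟨w, hw, rfl⟩ := hx
    exact ⟨σ, hσ, w, hw, rfl⟩
  · rintro ⟨σ, hσ, w, hw, rfl⟩
    obtain ⟨σ', hσ', hsub, hk⟩ := H.pure σ hσ
    exact ⟨_, H.mem_facets.2 ⟨σ', hσ', hk, rfl⟩, w, hw.mono hsub, rfl⟩

theorem exists_of_isCodimOneFace (H : IsSmoothFan k Δ d) {E : Set (ι → ℝ)}
    (hE : H.polyComplex.IsCodimOneFace E) : ∃ τ ∈ Δ, τ.card + 1 = k ∧ E = coneOf d τ := by
  obtain ⟨hne, hdim, F, hF, hex⟩ := hE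
  obtain ⟨σ, hσ, hk, rfl⟩ := H.mem_facets.1 hF
  obtain ⟨τ, hτ, rfl⟩ := exists_subset_of_isExposed hne hex
  obtain ⟨l, hl⟩ := H.dual σ hσ hk
  exact ⟨τ, H.down σ hσ τ hτ, by rw [← hdim, (hl.mono hτ).affDim_coneOf], rfl⟩

open Classical in
/-- The additional generators of the maximal cones containing the cone `τ`. -/
noncomputable def extensions (_H : IsSmoothFan k Δ d) (τ : Finset κ) : Finset κ :=
  Finset.univ.filter fun A => A ∉ τ ∧ insert A τ ∈ Δ

theorem mem_extensions (H : IsSmoothFan k Δ d) {τ : Finset κ} {A : κ} :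
    A ∈ H.extensions τ ↔ A ∉ τ ∧ insert A τ ∈ Δ := by
  simp [extensions]

theorem mem_adjacent (H : IsSmoothFan k Δ d) {τ : Finset κ} (hτ : τ ∈ Δ) (hk : τ.card + 1 = k)
    {F : Set (ι → ℝ)} : F ∈ H.polyComplex.adjacent (coneOf d τ) ↔
      ∃ A ∈ H.extensions τ, F = coneOf d (insert A τ) := by
  classical
  simp only [PolyComplex.adjacent, Finset.mem_filter, H.mem_facets, H.mem_extensions]
  constructor
  · rintro ⟨⟨σ, hσ, hσk, rfl⟩, hex⟩
    obtain ⟨τ', hτ', he⟩ := exists_subset_of_isExposed ⟨0, zero_mem_coneOf d τ⟩ hex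
    have := H.coneOf_injective (H.down σ hσ τ' hτ') hτ he
    subst this
    obtain ⟨A, hA, rfl⟩ := Finset.exists_eq_insert_iff.2 ⟨hτ', by omega⟩
    exact ⟨A, ⟨hA, hσ⟩, rfl⟩
  · rintro ⟨A, ⟨hA, hAΔ⟩, rfl⟩
    have hc : (insert A τ).card = k := by rw [Finset.card_insert_of_notMem hA, hk]
    obtain ⟨l, hl⟩ := H.dual _ hAΔ hc
    exact ⟨⟨_, hAΔ, hc, rfl⟩, hl.isExposed_of_subset (Finset.subset_insert _ _)⟩

open Classical in
theorem count_eq (H : IsSmoothFan k Δ d) {τ : Finset κ} (hτ : τ ∈ Δ) (hk : τ.card + 1 = k)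
    (L : AffineSubspace ℝ (ι → ℝ)) (v : ι → ℝ) :
    H.polyComplex.count (coneOf d τ) L v =
      ∑ A ∈ (H.extensions τ).filter fun A => (coneOf d (insert A τ) ∩ translateBy L v).Nonempty,
        (parallelLattice (coneOf d (insert A τ)) ⊔
          parallelLattice (L : Set (ι → ℝ))).index := by
  rw [PolyComplex.count]
  symm
  refine Finset.sum_bij (fun A _ => coneOf d (insert A τ)) ?_ ?_ ?_ ?_
  · intro A hA
    rw [Finset.mem_filter] at hA ⊢
    exact ⟨(H.mem_adjacent hτ hk).2 ⟨A, hA.1, rfl⟩, hA.2⟩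
  · intro A hA B hB he
    rw [Finset.mem_filter, H.mem_extensions] at hA hB
    have := H.coneOf_injective hB.1.2 hA.1.2 he
    have hAB : A ∈ insert B τ := this ▸ Finset.mem_insert_self A τ
    exact (Finset.mem_insert.1 hAB).resolve_right hA.1.1
  · intro F hF
    rw [Finset.mem_filter, H.mem_adjacent hτ hk] at hF
    obtain ⟨⟨A, hA, rfl⟩, hne⟩ := hF
    exact ⟨A, Finset.mem_filter.2 ⟨hA, hne⟩, rfl⟩
  · intro A _
    rfl

end IsSmoothFan

end Fan

/-! ### Balancing of smooth fans -/

section Fan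

variable {ι κ : Type} [Fintype ι] [Fintype κ] [DecidableEq κ]

namespace IsSmoothFan

variable {k : ℕ} {Δ : Set (Finset κ)} {d : κ → ι → ℤ}

/-- If no adjacent facet is transversal to `L`, generic translates miss all of them and the count is
0. Otherwise the direction of `L` and the span of `τ` fill a hyperplane, the kernel of an integer
functional φ. The facet generated by `τ` and d_A is transversal when φ(d_A) ≠ 0; its index is then a
fixed multiple of |φ(d_A)|, and a small generic translate by `v` meets it exactly when φ(d_A) has
the sign of φ(v). Since the φ(d_A) add up to 0, both signs give the same count. -/
theorem isBalanced (H : IsSmoothFan k Δ d) : H.polyComplex.IsBalanced := by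
  classical
  intro E hE L hL
  obtain ⟨τ, hτ, hk, rfl⟩ := H.exists_of_isCodimOneFace hE
  obtain ⟨hfin, ⟨s, hs⟩, p, hpL, hpE⟩ := hL
  have hcard : ∀ A ∈ H.extensions τ, (insert A τ).card = k := fun A hA => by
    rw [Finset.card_insert_of_notMem (H.mem_extensions.1 hA).1, hk]
  have hdual : ∀ A ∈ H.extensions τ, ∃ l, IsDualOn d l (insert A τ) := fun A hA =>
    H.dual _ (H.mem_extensions.1 hA).2 (hcard A hA)
  choose! l hl using hdual
  have hsub : ∀ A, coneSpan d τ ≤ coneSpan d (insert A τ) := by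
    intro A
    refine Submodule.span_le.2 ?_
    rintro _ ⟨B, rfl⟩
    exact intPoint_mem_coneSpan d (Finset.mem_insert_of_mem B.2)
  have hpτ : p ∈ coneSpan d τ := mem_affineSpan_coneOf.1
    (subset_affineSpan ℝ _ (intrinsicInterior_subset hpE))
  -- a generic translate meets a facet in one interior point
  have hgen : ∀ v, H.polyComplex.IsGeneric (coneOf d τ) L v → ∀ A ∈ H.extensions τ,
      (coneOf d (insert A τ) ∩ translateBy L v).Nonempty →
      ∃ q ∈ intrinsicInterior ℝ (coneOf d (insert A τ)),
        coneOf d (insert A τ) ∩ translateBy L v = {q} := by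
    intro v hv A hA hne
    rcases hv _ ((H.mem_adjacent hτ hk).2 ⟨A, hA, rfl⟩) with h | h
    · exact absurd h hne.ne_empty
    · exact h
  -- A common direction would allow the intersection point, which is relatively interior, to move
  -- inside the intersection.
  have hdisj : ∀ v, H.polyComplex.IsGeneric (coneOf d τ) L v → ∀ A ∈ H.extensions τ,
      (coneOf d (insert A τ) ∩ translateBy L v).Nonempty →
      Disjoint L.direction (coneSpan d (insert A τ)) := by
    intro v hv A hA hne
    obtain ⟨q, hq, hqe⟩ := hgen v hv A hA hne
    rw [Submodule.disjoint_def]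
    intro u huD huV
    obtain ⟨ε, hε, hmem⟩ := exists_add_smul_mem_of_mem_intrinsicInterior hq (u := u)
      (by rw [vectorSpan_coneOf]; exact huV)
    have h1 := hmem (ε / 2) (by rw [abs_of_pos] <;> linarith)
    have hqL : q ∈ translateBy L v := (hqe ▸ rfl : q ∈ coneOf d (insert A τ) ∩ translateBy L v).2
    have h2 : q + (ε / 2) • u ∈ translateBy L v := by
      rw [mem_translateBy_iff hpL] at hqL ⊢
      have := L.direction.add_mem hqL (L.direction.smul_mem (ε / 2) huD)
      convert this using 1
      abel
    have h3 : q + (ε / 2) • u ∈ ({q} : Set (ι → ℝ)) := hqe ▸ ⟨h1, h2⟩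
    have h4 : (ε / 2) • u = 0 := by simpa using h3
    rcases smul_eq_zero.1 h4 with h | h
    · linarith
    · exact h
  by_cases hT : ∃ A ∈ H.extensions τ, Disjoint L.direction (coneSpan d (insert A τ))
  swap
  · refine ⟨0, 1, one_pos, fun v _ hv => ?_⟩
    rw [H.count_eq hτ hk, Finset.sum_eq_zero]
    intro A hA
    rw [Finset.mem_filter] at hA
    exact absurd ⟨A, hA.1, hdisj v hv A hA.1 hA.2⟩ hT
  obtain ⟨A₀, hA₀, hd₀⟩ := hT
  have hfinτ : Module.finrank ℝ (coneSpan d τ) = τ.card :=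
    ((hl A₀ hA₀).mono (Finset.subset_insert _ _)).finrank_coneSpan
  have hspan : L.direction ⊔ coneSpan d τ =
      Submodule.span ℝ (intPoint '' (s ∪ d '' (τ : Set κ))) := by
    rw [Set.image_union, Submodule.span_union, ← hs, coneSpan]
    congr 2
    ext x
    simp
  -- The dimensions N − k and k − 1 add up to less than N.
  have hne_top : Submodule.span ℝ (intPoint '' (s ∪ d '' (τ : Set κ))) ≠ ⊤ := by
    rw [← hspan]
    intro htop
    have h1 := Submodule.finrank_add_le_finrank_add_finrank L.direction (coneSpan d τ)
    rw [htop, finrank_top, Module.finrank_fintype_fun_eq_card, hfinτ] at h1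
    omega
  obtain ⟨a, ha0, ha⟩ := exists_intFunctional_eq_zero _ hne_top
  rw [← hspan] at ha
  have haD : ∀ x ∈ L.direction, intFunctional a x = 0 := fun x hx =>
    ha x (Submodule.mem_sup_left hx)
  have haτ : ∀ x ∈ coneSpan d τ, intFunctional a x = 0 := fun x hx =>
    ha x (Submodule.mem_sup_right hx)
  let φ : (ι → ℤ) →+ ℤ :=
    { toFun := fun z => ∑ i, a i * z i
      map_zero' := by simp
      map_add' := fun x y => by simp [mul_add, Finset.sum_add_distrib] }
  have hφ : ∀ z, intFunctional a (intPoint z) = φ z := fun z => intFunctional_intPoint a z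
  obtain ⟨i₀, hi₀⟩ := Function.ne_iff.1 ha0
  have hφi : φ (Pi.single i₀ 1) = a i₀ := by
    simp [φ, Pi.single_apply]
  -- transversality in terms of the functional
  have hcompl : ∀ A ∈ H.extensions τ, φ (d A) ≠ 0 →
      IsCompl L.direction (coneSpan d (insert A τ)) := by
    intro A hA hne
    have hdis : Disjoint L.direction (coneSpan d (insert A τ)) := by
      have hdτ : Disjoint L.direction (coneSpan d τ) := hd₀.mono_right (hsub A₀)
      rw [Submodule.disjoint_def] at hdτ ⊢
      intro x hxD hxV
      have hx := (hl A hA).eq_sum hxV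
      rw [Finset.sum_insert (H.mem_extensions.1 hA).1] at hx
      have hy : ∑ B ∈ τ, intFunctional (l A B) x • intPoint (d B) ∈ coneSpan d τ :=
        Submodule.sum_mem _ fun B hB => Submodule.smul_mem _ _ (intPoint_mem_coneSpan d hB)
      have h0 := haD x hxD
      rw [hx, map_add, map_smul, hφ, haτ _ hy, add_zero, smul_eq_mul] at h0
      have h1 : intFunctional (l A A) x = 0 :=
        (mul_eq_zero.1 h0).resolve_right (by exact_mod_cast hne)
      rw [h1, zero_smul, zero_add] at hx
      exact hdτ x hxD (hx ▸ hy)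
    refine ⟨hdis, codisjoint_iff.2 (Submodule.eq_top_of_finrank_eq ?_)⟩
    have h1 := Submodule.finrank_sup_add_finrank_inf_eq L.direction (coneSpan d (insert A τ))
    rw [hdis.eq_bot, finrank_bot, (hl A hA).finrank_coneSpan, hcard A hA] at h1
    rw [Module.finrank_fintype_fun_eq_card]
    omega
  -- Otherwise φ would vanish on the direction of `L` plus the span of the transversal facet, that
  -- is on everything.
  have hφA₀ : φ (d A₀) ≠ 0 := by
    intro h0
    have hle : L.direction ⊔ coneSpan d (insert A₀ τ) ≤ LinearMap.ker (intFunctional a) := by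
      refine sup_le (fun x hx => haD x hx) (Submodule.span_le.2 ?_)
      rintro _ ⟨⟨B, hB⟩, rfl⟩
      rcases Finset.mem_insert.1 hB with rfl | hB
      · change intFunctional a (intPoint (d B)) = 0
        rw [hφ, h0, Int.cast_zero]
      · exact haτ _ (intPoint_mem_coneSpan d hB)
    have h1 := Submodule.finrank_sup_add_finrank_inf_eq L.direction (coneSpan d (insert A₀ τ))
    rw [hd₀.eq_bot, finrank_bot, (hl A₀ hA₀).finrank_coneSpan, hcard A₀ hA₀] at h1
    have htop : L.direction ⊔ coneSpan d (insert A₀ τ) = ⊤ :=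
      Submodule.eq_top_of_finrank_eq (by rw [Module.finrank_fintype_fun_eq_card]; omega)
    rw [htop, top_le_iff] at hle
    have h2 : intFunctional a (intPoint (Pi.single i₀ 1)) = 0 := by
      have : intPoint (Pi.single i₀ 1) ∈ LinearMap.ker (intFunctional a) := hle ▸ Submodule.mem_top
      exact this
    rw [hφ, hφi] at h2
    exact hi₀ (by exact_mod_cast h2)
  -- Project onto the span of the facet along the direction of `L`; then p + π v is the point where
  -- `L + v` meets that span.
  have hproj : ∀ A ∈ H.extensions τ, ∃ π : (ι → ℝ) →ₗ[ℝ] (ι → ℝ), φ (d A) ≠ 0 →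
      ∀ v, π v ∈ coneSpan d (insert A τ) ∧ v - π v ∈ L.direction := by
    intro A hA
    by_cases h : φ (d A) ≠ 0
    · exact ⟨Submodule.projection _ _ (hcompl A hA h).symm, fun _ v =>
        ⟨Submodule.projection_apply_mem _ v, Submodule.sub_projection_mem _ v⟩⟩
    · exact ⟨0, fun h' => absurd h' h⟩
  choose! π hπ using hproj
  have hlpos : ∀ A ∈ H.extensions τ, ∀ B ∈ τ, 0 < intFunctional (l A B) p := fun A hA B hB =>
    ((hl A hA).mono (Finset.subset_insert _ _)).pos_of_mem_intrinsicInterior hpE hB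
  have hlA : ∀ A ∈ H.extensions τ, intFunctional (l A A) p = 0 := by
    intro A hA
    obtain ⟨w, hw, rfl⟩ := mem_coneSpan_iff.1 hpτ
    rw [(hl A hA).apply_weightMap (fun B hB => hw B fun h => hB (Finset.mem_insert_of_mem h))
      (Finset.mem_insert_self _ _)]
    exact hw A (H.mem_extensions.1 hA).1
  -- Since `p` is relatively interior in the cone of `τ`, the coordinates at `τ` stay positive for
  -- small `v`. Only the coordinate at `A` decides whether p + π v lies in the facet, and by `hpt`
  -- it equals φ(v)/φ(d_A).
  have hev : ∀ᶠ v in 𝓝 (0 : ι → ℝ), ∀ A ∈ H.extensions τ, ∀ B ∈ τ,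
      0 < intFunctional (l A B) (p + π A v) := by
    refine (Filter.eventually_all_finset _).2 fun A hA =>
      (Filter.eventually_all_finset _).2 fun B hB => ?_
    have hc : Continuous fun v => intFunctional (l A B) (p + π A v) :=
      (LinearMap.continuous_of_finiteDimensional _).comp
        (continuous_const.add (LinearMap.continuous_of_finiteDimensional _))
    refine (continuousAt_const (y := (0 : ℝ))).eventually_lt hc.continuousAt ?_
    rw [map_zero, add_zero]
    exact hlpos A hA B hB
  obtain ⟨ε, hε, hball⟩ := Metric.eventually_nhds_iff.1 hev
  -- the intersection with a transversal facet
  have hpt : ∀ v A, A ∈ H.extensions τ → φ (d A) ≠ 0 → p + π A v ∈ coneSpan d (insert A τ) ∧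
      p + π A v ∈ translateBy L v ∧
      intFunctional (l A A) (p + π A v) * φ (d A) = intFunctional a v := by
    intro v A hA hne
    obtain ⟨h1, h2⟩ := hπ A hA hne v
    have hV := Submodule.add_mem _ (hsub A hpτ) h1
    refine ⟨hV, ?_, ?_⟩
    · rw [mem_translateBy_iff hpL]
      convert L.direction.neg_mem h2 using 1
      abel
    · have h3 := (hl A hA).eq_sum hV
      rw [Finset.sum_insert (H.mem_extensions.1 hA).1] at h3
      have h4 := congrArg (intFunctional a) h3
      have hy : ∑ B ∈ τ, intFunctional (l A B) (p + π A v) • intPoint (d B) ∈ coneSpan d τ :=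
        Submodule.sum_mem _ fun B hB => Submodule.smul_mem _ _ (intPoint_mem_coneSpan d hB)
      rw [map_add _ (_ • _), map_smul, hφ, haτ _ hy, add_zero, map_add, haτ p hpτ, zero_add,
        smul_eq_mul] at h4
      have h5 := haD _ h2
      rw [map_sub] at h5
      linarith
  have hval : ∀ v, ∀ x ∈ translateBy L v, intFunctional a x = intFunctional a v := by
    intro v x hx
    have := haD _ ((mem_translateBy_iff hpL).1 hx)
    rw [map_sub, map_sub, haτ p hpτ] at this
    linarith
  have hmeet : ∀ v, dist v 0 < ε → H.polyComplex.IsGeneric (coneOf d τ) L v →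
      intFunctional a v ≠ 0 ∧ ∀ A ∈ H.extensions τ,
        ((coneOf d (insert A τ) ∩ translateBy L v).Nonempty ↔ 0 < intFunctional a v * φ (d A)) := by
    intro v hv hvg
    have hin : ∀ A ∈ H.extensions τ, φ (d A) ≠ 0 → 0 ≤ intFunctional (l A A) (p + π A v) →
        p + π A v ∈ coneOf d (insert A τ) ∩ translateBy L v := by
      intro A hA hne h0
      obtain ⟨h1, h2, -⟩ := hpt v A hA hne
      refine ⟨(hl A hA).mem_coneOf_iff.2 ⟨h1, fun B hB => ?_⟩, h2⟩
      rcases Finset.mem_insert.1 hB with rfl | hB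
      · exact h0
      · exact (hball hv A hA B hB).le
    -- If φ(v) were 0, the translate would meet the transversal facet of `A₀` in a point with zero
    -- coordinate at `A₀`, on its boundary, contradicting genericity.
    have hv0 : intFunctional a v ≠ 0 := by
      intro h0
      have h3 := (hpt v A₀ hA₀ hφA₀).2.2
      rw [h0] at h3
      have h4 : intFunctional (l A₀ A₀) (p + π A₀ v) = 0 :=
        (mul_eq_zero.1 h3).resolve_right (by exact_mod_cast hφA₀)
      have h5 := hin A₀ hA₀ hφA₀ h4.ge
      obtain ⟨q, hq, hqe⟩ := hgen v hvg A₀ hA₀ ⟨_, h5⟩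
      rw [hqe] at h5
      have h6 := (hl A₀ hA₀).pos_of_mem_intrinsicInterior hq (Finset.mem_insert_self _ _)
      rw [← Set.mem_singleton_iff.1 h5, h4] at h6
      exact lt_irrefl _ h6
    refine ⟨hv0, fun A hA => ⟨?_, fun hpos => ?_⟩⟩
    · rintro ⟨x, hxF, hxL⟩
      have h1 := hval v x hxL
      obtain ⟨hxV, hxpos⟩ := (hl A hA).mem_coneOf_iff.1 hxF
      have h2 := (hl A hA).eq_sum hxV
      rw [Finset.sum_insert (H.mem_extensions.1 hA).1] at h2
      have hy : ∑ B ∈ τ, intFunctional (l A B) x • intPoint (d B) ∈ coneSpan d τ :=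
        Submodule.sum_mem _ fun B hB => Submodule.smul_mem _ _ (intPoint_mem_coneSpan d hB)
      have h4 := congrArg (intFunctional a) h2
      rw [map_add, map_smul, hφ, haτ _ hy, add_zero, h1, smul_eq_mul] at h4
      have h5 := hxpos A (Finset.mem_insert_self _ _)
      have h6 : intFunctional a v * φ (d A) = intFunctional (l A A) x * (φ (d A) : ℝ) ^ 2 := by
        rw [h4]; ring
      have h7 : 0 ≤ intFunctional a v * φ (d A) := by rw [h6]; positivity
      refine lt_of_le_of_ne h7 fun h8 => ?_
      rcases mul_eq_zero.1 h8.symm with h | h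
      · exact hv0 h
      · rw [h, mul_zero] at h4; exact hv0 h4
    · have hne : φ (d A) ≠ 0 := by
        intro h
        rw [h] at hpos
        simp at hpos
      refine ⟨_, hin A hA hne ?_⟩
      have h3 := (hpt v A hA hne).2.2
      rw [← h3] at hpos
      have h4 : 0 < intFunctional (l A A) (p + π A v) * (φ (d A) : ℝ) ^ 2 := by
        calc _ < _ := hpos
          _ = _ := by ring
      exact (pos_of_mul_pos_left h4 (by positivity)).le
  -- the indices
  let Λ : AddSubgroup (ι → ℤ) := parallelLattice (coneOf d τ) ⊔ parallelLattice (L : Set (ι → ℝ))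
  have hΛ : Λ ≤ φ.ker := by
    refine sup_le (fun z hz => ?_) fun z hz => ?_
    · have := haτ _ (mem_parallelLattice_coneOf.1 hz)
      rw [hφ] at this
      exact_mod_cast this
    · have := haD _ (mem_parallelLattice_coe.1 hz)
      rw [hφ] at this
      exact_mod_cast this
  have hidx : ∀ A ∈ H.extensions τ, φ (d A) ≠ 0 →
      (parallelLattice (coneOf d (insert A τ)) ⊔ parallelLattice (L : Set (ι → ℝ))).index *
        φ.range.index = Λ.relIndex φ.ker * (φ (d A)).natAbs := by
    intro A hA hne
    rw [← index_sup_zmultiples φ Λ hΛ (d A) hne,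
      parallelLattice_coneOf_insert (H.mem_extensions.1 hA).1 (hl A hA), sup_right_comm]
  -- An infinite index counts as 0; here the range contains the nonzero integer φ(d_{A₀}), so the
  -- index is finite and can be cancelled.
  have hg : φ.range.index ≠ 0 := by
    intro h0
    have h1 := index_sup_zmultiples φ ⊥ bot_le (d A₀) hφA₀
    have h2 : φ.range.index ∣ (AddSubgroup.zmultiples (φ (d A₀))).index :=
      AddSubgroup.index_dvd_of_le (AddSubgroup.zmultiples_le.2 ⟨d A₀, rfl⟩)
    rw [h0, Int.index_zmultiples, zero_dvd_iff, Int.natAbs_eq_zero] at h2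
    exact hφA₀ h2
  -- the sum of the values of the functional vanishes
  have hsum : ∑ A ∈ H.extensions τ, φ (d A) = 0 := by
    obtain ⟨A', A'', c, -, -, h1, h2, h3, h4, h5, h6, h7, h8, h9, -, -, -⟩ :=
      H.star τ hτ hk A₀ (H.mem_extensions.1 hA₀).1 (H.mem_extensions.1 hA₀).2
    have hext : H.extensions τ = {A₀, A', A''} := by
      ext B
      simp only [Finset.mem_insert, Finset.mem_singleton]
      constructor
      · intro hB
        exact h8 B (H.mem_extensions.1 hB).1 (H.mem_extensions.1 hB).2
      · rintro (rfl | rfl | rfl)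
        · exact hA₀
        · exact H.mem_extensions.2 ⟨h1, h6⟩
        · exact H.mem_extensions.2 ⟨h2, h7⟩
    rw [hext, Finset.sum_insert (by simp [h3, h4]), Finset.sum_insert (by simpa using h5),
      Finset.sum_singleton, ← map_add, ← map_add]
    have h10 : d A₀ + (d A' + d A'') = ∑ B ∈ τ, c B • d B := by
      ext i
      rw [Finset.sum_apply, Pi.add_apply, Pi.add_apply, ← add_assoc, h9 i]
      rfl
    rw [h10, map_sum]
    refine Finset.sum_eq_zero fun B hB => ?_
    have := haτ _ (intPoint_mem_coneSpan d hB)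
    rw [hφ] at this
    rw [map_zsmul, (by exact_mod_cast this : φ (d B) = 0), smul_zero]
  -- A vanishing sum of integers has equal positive and negative parts.
  have hposneg : ∑ A ∈ (H.extensions τ).filter (fun A => 0 < φ (d A)), (φ (d A)).natAbs =
      ∑ A ∈ (H.extensions τ).filter (fun A => φ (d A) < 0), (φ (d A)).natAbs := by
    zify
    rw [Finset.sum_filter, Finset.sum_filter, ← sub_eq_zero, ← Finset.sum_sub_distrib]
    refine Eq.trans ?_ hsum
    refine Finset.sum_congr rfl fun A _ => ?_
    rcases lt_trichotomy (φ (d A)) 0 with h | h | h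
    · rw [if_neg h.not_gt, if_pos h, abs_of_neg h]; ring
    · rw [if_neg h.not_gt, if_neg h.not_lt, h, sub_zero]
    · rw [if_pos h, if_neg h.not_gt, abs_of_pos h, sub_zero]
  -- The count is computed from the facets on the positive side; the division is exact by `hidx`.
  refine ⟨(Λ.relIndex φ.ker * ∑ A ∈ (H.extensions τ).filter (fun A => 0 < φ (d A)),
    (φ (d A)).natAbs) / φ.range.index, ε, hε, fun v hv hvg => ?_⟩
  obtain ⟨hv0, hmeet⟩ := hmeet v (by simpa using hv) hvg
  refine (Nat.div_eq_of_eq_mul_left (Nat.pos_of_ne_zero hg) ?_).symm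
  rw [H.count_eq hτ hk, Finset.sum_mul]
  have hfilter : (H.extensions τ).filter
      (fun A => (coneOf d (insert A τ) ∩ translateBy L v).Nonempty) =
      (H.extensions τ).filter (fun A => 0 < intFunctional a v * φ (d A)) :=
    Finset.filter_congr fun A hA => hmeet A hA
  rw [hfilter, Finset.sum_congr rfl fun A hA => hidx A (Finset.mem_filter.1 hA).1 ?_,
    ← Finset.mul_sum]
  swap
  · intro h
    have := (Finset.mem_filter.1 hA).2
    rw [h] at this
    simp at this
  congr 1
  rcases lt_or_gt_of_ne hv0 with h | h
  · rw [hposneg]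
    refine Finset.sum_congr (Finset.filter_congr fun A _ => ?_) fun _ _ => rfl
    rw [← smul_eq_mul, smul_pos_iff_of_neg_left h]
    exact_mod_cast Iff.rfl
  · refine Finset.sum_congr (Finset.filter_congr fun A _ => ?_) fun _ _ => rfl
    rw [mul_pos_iff_of_pos_left h]
    exact_mod_cast Iff.rfl

end IsSmoothFan

end Fan

/-! ### Test spaces, simple balancing and sign changes of smooth fans -/

section Fan

variable {ι κ : Type} [Fintype ι] [Fintype κ] [DecidableEq κ]

namespace IsDualOn

variable {d l : κ → ι → ℤ} {σ : Finset κ}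

/-- The common kernel of the functionals. -/
noncomputable def kernel (l : κ → ι → ℤ) (σ : Finset κ) : Submodule ℝ (ι → ℝ) :=
  LinearMap.ker (LinearMap.pi fun B : σ => intFunctional (l B))

theorem mem_kernel {x : ι → ℝ} : x ∈ kernel l σ ↔ ∀ B ∈ σ, intFunctional (l B) x = 0 := by
  rw [kernel, LinearMap.mem_ker, funext_iff]
  simp

/-- The generators dual to the functionals show that the functionals are jointly surjective, and
rank–nullity applies. -/
theorem finrank_kernel (h : IsDualOn d l σ) :
    Module.finrank ℝ (kernel l σ) + σ.card = Fintype.card ι := by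
  have hsurj : LinearMap.range (LinearMap.pi fun B : σ => intFunctional (l B)) = ⊤ := by
    rw [LinearMap.range_eq_top]
    intro t
    refine ⟨weightMap d fun B => if h : B ∈ σ then t ⟨B, h⟩ else 0, ?_⟩
    ext B
    rw [LinearMap.pi_apply, h.apply_weightMap (fun A hA => by rw [dif_neg hA]) B.2, dif_pos B.2]
  have := LinearMap.finrank_range_add_finrank_ker (LinearMap.pi fun B : σ => intFunctional (l B))
  rw [hsurj, finrank_top, Module.finrank_fintype_fun_eq_card, Module.finrank_fintype_fun_eq_card,
    Fintype.card_coe] at this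
  rw [kernel]
  omega

/-- The projection of integer vectors to the common kernel of the functionals. -/
theorem sub_sum_mem_kernel (h : IsDualOn d l σ) (z : ι → ℤ) :
    intPoint (z - ∑ B ∈ σ, (∑ i, l B i * z i) • d B) ∈ kernel l σ := by
  rw [mem_kernel]
  intro C hC
  rw [intPoint_sub, intPoint_sum, map_sub, map_sum, Finset.sum_eq_single_of_mem C hC,
    intPoint_zsmul, map_smul, intFunctional_intPoint, intFunctional_intPoint, h C hC C hC]
  · simp
  · intro B hB hBC
    rw [intPoint_zsmul, map_smul, intFunctional_intPoint, h C hC B hB, if_neg (Ne.symm hBC)]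
    simp

/-- The projection z ↦ z − ∑ l_B(z) d_B onto the kernel preserves integrality, so the kernel is
spanned by the images of the standard basis vectors. This provides the integer slope of the test
spaces. -/
theorem kernel_eq_span (h : IsDualOn d l σ) :
    kernel l σ = Submodule.span ℝ (intPoint '' {z | intPoint z ∈ kernel l σ}) := by
  classical
  apply le_antisymm
  · intro x hx
    have hx' : x = ∑ j, x j • intPoint
        ((Pi.single j 1 : ι → ℤ) - ∑ B ∈ σ, (∑ i, l B i * (Pi.single j 1 : ι → ℤ) i) • d B) := by
      have h1 : ∀ j, intPoint
          ((Pi.single j 1 : ι → ℤ) - ∑ B ∈ σ, (∑ i, l B i * (Pi.single j 1 : ι → ℤ) i) • d B) =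
          Pi.single j (1 : ℝ) - ∑ B ∈ σ, (l B j : ℝ) • intPoint (d B) := by
        intro j
        rw [intPoint_sub, intPoint_sum]
        congr 1
        · ext i
          by_cases hij : i = j
          · subst hij; simp [intPoint]
          · simp [intPoint, hij]
        · refine Finset.sum_congr rfl fun B _ => ?_
          rw [intPoint_zsmul]
          simp [Pi.single_apply]
      simp only [h1, smul_sub, Finset.sum_sub_distrib, Finset.smul_sum]
      rw [Finset.sum_comm (s := Finset.univ)]
      have h2 : ∑ B ∈ σ, ∑ j, x j • (l B j : ℝ) • intPoint (d B) = 0 := by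
        refine Finset.sum_eq_zero fun B hB => ?_
        have h3 := mem_kernel.1 hx B hB
        rw [intFunctional_apply] at h3
        simp only [smul_smul]
        rw [← Finset.sum_smul]
        simp only [mul_comm (x _)]
        rw [h3, zero_smul]
      rw [h2, sub_zero]
      ext i
      simp [Pi.single_apply]
    rw [hx']
    exact Submodule.sum_mem _ fun j _ => Submodule.smul_mem _ _
      (Submodule.subset_span ⟨_, h.sub_sum_mem_kernel _, rfl⟩)
  · refine Submodule.span_le.2 ?_
    rintro _ ⟨z, hz, rfl⟩
    exact hz

end IsDualOn

namespace IsSmoothFan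

variable {k : ℕ} {Δ : Set (Finset κ)} {d : κ → ι → ℤ}

/-- The test space passes through an interior point of the cone of `τ`, parallel to the common
kernel of the functionals dual to `insert A τ`. The functional l_A is 1, −1, 0 on the generators of
`A`, `A'`, `A''`, so shifting by a positive multiple of d_A leaves only the facet of `A`, with index
1. By balancing every small generic count is then 1. A translate fixes the values of the dual
functionals, so its one-sidedness is the last clause of `star`. -/
theorem isSimplyBalanced (H : IsSmoothFan k Δ d) : H.polyComplex.IsSimplyBalanced := by
  classical
  refine ⟨H.isBalanced, ?_⟩
  intro E hE F hF
  obtain ⟨τ, hτ, hk, rfl⟩ := H.exists_of_isCodimOneFace hE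
  obtain ⟨A, hA, rfl⟩ := (H.mem_adjacent hτ hk).1 hF
  obtain ⟨hAτ, hAΔ⟩ := H.mem_extensions.1 hA
  obtain ⟨A', A'', c, l, h, hA'τ, hA''τ, hne', hne'', hne, hA'Δ, hA''Δ, hall, hrel, hl, hlA', hh⟩ :=
    H.star τ hτ hk A hAτ hAΔ
  have hAσ : A ∈ insert A τ := Finset.mem_insert_self _ _
  have hτσ : τ ⊆ insert A τ := Finset.subset_insert _ _
  have hlτ : ∀ B ∈ τ, ∑ i, l A i * d B i = 0 := fun B hB => by
    have hAB : A ≠ B := fun e => hAτ (e ▸ hB)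
    rw [hl A hAσ B (hτσ hB), if_neg hAB]
  -- Apply l_A to the relation of the three generators: 1 − 1 + l_A(d_{A''}) = 0.
  have hlA'' : ∑ i, l A i * d A'' i = 0 := by
    have h1 : ∑ i, l A i * (d A i + d A' i + d A'' i) = 0 := by
      simp only [hrel, Finset.mul_sum]
      rw [Finset.sum_comm]
      refine Finset.sum_eq_zero fun B hB => ?_
      have := congrArg (fun t => c B * t) (hlτ B hB)
      simp only [mul_zero, Finset.mul_sum] at this
      rw [← this]
      exact Finset.sum_congr rfl fun i _ => by ring
    simp only [mul_add, Finset.sum_add_distrib] at h1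
    rw [hl A hAσ A hAσ, if_pos rfl, hlA'] at h1
    linarith
  -- values of the functional `l A` on the other facets
  have hval : ∀ B ∉ τ, ∀ w, IsWeightOn (insert B τ) w →
      intFunctional (l A) (weightMap d w) = w B * ((∑ i, l A i * d B i : ℤ) : ℝ) := by
    intro B hB w hw
    rw [intFunctional_weightMap, Finset.sum_eq_single B]
    · intro C _ hCB
      by_cases hC : C ∈ τ
      · rw [hlτ C hC]; simp
      · rw [hw.2 C (by simp [hCB, hC]), zero_mul]
    · intro h; exact absurd (Finset.mem_univ B) h
  -- All weights 1 on `τ` give a relatively interior point of its cone.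
  let w₀ : κ → ℝ := fun B => if B ∈ τ then 1 else 0
  have hw₀ : IsWeightOn τ w₀ := ⟨fun B => by simp only [w₀]; split_ifs <;> norm_num,
    fun B hB => if_neg hB⟩
  let p := weightMap d w₀
  have hlp : ∀ B ∈ insert A τ, intFunctional (l B) p = w₀ B := fun B hB =>
    hl.apply_weightMap (hw₀.mono hτσ).2 hB
  have hw₀A : w₀ A = 0 := if_neg hAτ
  let L : AffineSubspace ℝ (ι → ℝ) := AffineSubspace.mk' p (IsDualOn.kernel l (insert A τ))
  have hpL : p ∈ L := AffineSubspace.self_mem_mk' _ _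
  have hdir : L.direction = IsDualOn.kernel l (insert A τ) := AffineSubspace.direction_mk' _ _
  have htr : ∀ v x, x ∈ translateBy L v ↔ ∀ B ∈ insert A τ,
      intFunctional (l B) x = intFunctional (l B) v + w₀ B := by
    intro v x
    rw [mem_translateBy_iff hpL, hdir, IsDualOn.mem_kernel]
    refine forall₂_congr fun B hB => ?_
    rw [map_sub, map_sub, hlp B hB]
    constructor <;> intro h <;> linarith
  have hcard : (insert A τ).card = k := by rw [Finset.card_insert_of_notMem hAτ, hk]
  have hL : H.polyComplex.IsTestSpace (coneOf d τ) L := by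
    refine ⟨?_, ⟨_, hdir.trans hl.kernel_eq_span⟩, p, hpL, ?_⟩
    · rw [hdir, ← hcard]
      exact hl.finrank_kernel
    · refine (hl.mono hτσ).mem_intrinsicInterior (weightMap_mem_coneSpan d hw₀.2) fun B hB => ?_
      rw [hlp B (hτσ hB)]
      simp [w₀, hB]
  obtain ⟨m, ε₀, hε₀, hm⟩ := H.isBalanced _ hE L hL
  -- a small generic vector whose translate meets the facet
  have hgen : ∀ t : ℝ, 0 < t → H.polyComplex.IsGeneric (coneOf d τ) L (t • intPoint (d A)) ∧
      (coneOf d (insert A τ) ∩ translateBy L (t • intPoint (d A))).Nonempty ∧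
      H.polyComplex.count (coneOf d τ) L (t • intPoint (d A)) = 1 := by
    intro t ht
    have hlv : ∀ B ∈ insert A τ, intFunctional (l B) (t • intPoint (d A)) = if B = A then t else 0 := by
      intro B hB
      rw [map_smul, intFunctional_intPoint, hl B hB A hAσ]
      split_ifs <;> simp
    let q := weightMap d (w₀ + Pi.single A t)
    have hqw : IsWeightOn (insert A τ) (w₀ + Pi.single A t) := by
      refine ⟨fun B => add_nonneg (hw₀.1 B) ?_, fun B hB => ?_⟩
      · by_cases hBA : B = A
        · subst hBA; simpa using ht.le
        · simp [hBA]
      · rw [Finset.mem_insert, not_or] at hB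
        simp [w₀, hB.1, hB.2]
    have hlq : ∀ B ∈ insert A τ, intFunctional (l B) q = w₀ B + if B = A then t else 0 := by
      intro B hB
      rw [hl.apply_weightMap hqw.2 hB, Pi.add_apply]
      by_cases hBA : B = A
      · subst hBA; simp
      · simp [hBA]
    have hqmem : q ∈ coneOf d (insert A τ) ∩ translateBy L (t • intPoint (d A)) := by
      refine ⟨⟨_, hqw, rfl⟩, (htr _ _).2 fun B hB => ?_⟩
      rw [hlq B hB, hlv B hB, add_comm]
    -- On the translate l_A equals t > 0, whereas it is nonpositive on the facets of `A'` and `A''`.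
    have hempty : ∀ B ∈ H.extensions τ, B ≠ A →
        coneOf d (insert B τ) ∩ translateBy L (t • intPoint (d A)) = ∅ := by
      intro B hB hBA
      rw [Set.eq_empty_iff_forall_notMem]
      rintro _ ⟨⟨w, hw, rfl⟩, hxL⟩
      have h1 := (htr _ _).1 hxL A hAσ
      obtain ⟨hBτ, hBΔ⟩ := H.mem_extensions.1 hB
      rw [hval B hBτ w hw, hlv A hAσ, if_pos rfl, hw₀A, add_zero] at h1
      rcases hall B hBτ hBΔ with rfl | rfl | rfl
      · exact hBA rfl
      · rw [hlA'] at h1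
        have := hw.1 B
        push_cast at h1
        linarith
      · rw [hlA''] at h1
        simp at h1
        linarith
    refine ⟨?_, ⟨q, hqmem⟩, ?_⟩
    · intro G hG
      obtain ⟨B, hB, rfl⟩ := (H.mem_adjacent hτ hk).1 hG
      by_cases hBA : B = A
      · subst hBA
        right
        refine ⟨q, ?_, ?_⟩
        · refine hl.mem_intrinsicInterior (weightMap_mem_coneSpan d hqw.2) fun C hC => ?_
          rw [hlq C hC]
          rcases Finset.mem_insert.1 hC with rfl | hC'
          · rw [hw₀A, if_pos rfl, zero_add]; exact ht
          · have : C ≠ B := fun e => hAτ (e ▸ hC')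
            simp [w₀, hC', this]
        · refine Set.eq_singleton_iff_unique_mem.2 ⟨hqmem, ?_⟩
          rintro x ⟨hxF, hxL⟩
          have h1 := hl.eq_sum (hl.mem_coneOf_iff.1 hxF).1
          have h2 := hl.eq_sum (hl.mem_coneOf_iff.1 hqmem.1).1
          rw [h1, h2]
          refine Finset.sum_congr rfl fun C hC => ?_
          rw [(htr _ _).1 hxL C hC, (htr _ _).1 hqmem.2 C hC]
      · exact Or.inl (hempty B hB hBA)
    · rw [H.count_eq hτ hk, Finset.sum_eq_single_of_mem A (Finset.mem_filter.2 ⟨hA, q, hqmem⟩)]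
      -- Every integer vector z is the sum of ∑ l_B(z) d_B, parallel to the facet, and an integer
      -- vector of the kernel, parallel to `L`.
      · rw [AddSubgroup.index_eq_one, eq_top_iff]
        intro z _
        refine AddSubgroup.mem_sup.2 ⟨∑ B ∈ insert A τ, (∑ i, l B i * z i) • d B, ?_, _, ?_,
          add_sub_cancel _ z⟩
        · rw [mem_parallelLattice_coneOf, intPoint_sum]
          refine Submodule.sum_mem _ fun B hB => ?_
          rw [intPoint_zsmul]
          exact Submodule.smul_mem _ _ (intPoint_mem_coneSpan d hB)
        · rw [mem_parallelLattice_coe, hdir]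
          exact hl.sub_sum_mem_kernel z
      · intro B hB hBA
        obtain ⟨hB, hBne⟩ := Finset.mem_filter.1 hB
        exact absurd (hempty B hB hBA) hBne.ne_empty
  have hsmall : ∀ ε : ℝ, 0 < ε → ∃ t : ℝ, 0 < t ∧ ‖t • intPoint (d A)‖ < ε := by
    intro ε hε
    refine ⟨ε / (‖intPoint (d A)‖ + 1), by positivity, ?_⟩
    rw [norm_smul, Real.norm_of_nonneg (by positivity), div_mul_eq_mul_div, div_lt_iff₀ (by positivity)]
    nlinarith [norm_nonneg (intPoint (d A))]
  have hm1 : m = 1 := by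
    obtain ⟨t, ht, htε⟩ := hsmall ε₀ hε₀
    rw [← hm _ htε (hgen t ht).1, (hgen t ht).2.2]
  subst hm1
  -- the functional is not constant on the test space
  have hdne : ∃ u ∈ L.direction, intFunctional h u ≠ 0 := by
    let b : κ → ℝ := fun B => ((∑ i, l B i * d A'' i : ℤ) : ℝ)
    -- Small enough for the corrected weights 1 − t b_B below to be nonnegative.
    let t : ℝ := 1 / (1 + ∑ B ∈ τ, |b B|)
    have hS : 0 ≤ ∑ B ∈ τ, |b B| := Finset.sum_nonneg fun B _ => abs_nonneg _
    have ht : 0 < t := by positivity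
    have htb : ∀ B ∈ τ, t * b B ≤ 1 := by
      intro B hB
      have h1 : |b B| ≤ ∑ B ∈ τ, |b B| :=
        Finset.single_le_sum (f := fun B => |b B|) (fun _ _ => abs_nonneg _) hB
      have h2 := le_abs_self (b B)
      simp only [t]
      rw [div_mul_eq_mul_div, div_le_one (by positivity)]
      linarith
    -- The correction by −t b_B compensates the dual coordinates of t d_{A''}. The resulting point
    -- of the third facet lies in `L` and differs from `p`, so by the uniqueness clause of `star`
    -- the functional h distinguishes the two.
    let w₁ : κ → ℝ := fun B => if B ∈ τ then 1 - t * b B else 0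
    have hw₁ : ∀ B ∉ insert A τ, w₁ B = 0 := fun B hB => if_neg fun h' => hB (hτσ h')
    have hw : IsWeightOn (insert A'' τ) (w₁ + Pi.single A'' t) := by
      refine ⟨fun B => add_nonneg ?_ ?_, fun B hB => ?_⟩
      · simp only [w₁]
        split_ifs with hB
        · linarith [htb B hB]
        · exact le_rfl
      · by_cases hBA : B = A''
        · subst hBA; simpa using ht.le
        · simp [hBA]
      · rw [Finset.mem_insert, not_or] at hB
        simp [w₁, hB.1, hB.2]
    have hlw : ∀ B ∈ insert A τ, intFunctional (l B) (weightMap d (w₁ + Pi.single A'' t)) =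
        intFunctional (l B) p := by
      intro B hB
      rw [map_add, map_add, hl.apply_weightMap hw₁ hB, weightMap_single, map_smul,
        intFunctional_intPoint, hlp B hB]
      rcases Finset.mem_insert.1 hB with rfl | hB'
      · simp [w₁, w₀, hAτ, hlA'']
      · simp [w₁, w₀, hB', b]
    obtain ⟨hle, heq⟩ := hh w₀ (Or.inl (hw₀.mono hτσ)) _ hA''Δ _ hw hlw
    refine ⟨weightMap d (w₁ + Pi.single A'' t) - p, ?_, ?_⟩
    · rw [hdir, IsDualOn.mem_kernel]
      intro B hB
      rw [map_sub, hlw B hB, sub_self]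
    · intro h0
      rw [map_sub, sub_eq_zero] at h0
      have := congrFun (heq h0) A''
      simp [w₁, w₀, hA''τ] at this
      linarith
  -- the points of the translates near the face
  have hev : ∀ᶠ v in 𝓝 (0 : ι → ℝ), ∀ B ∈ τ, 0 < 1 + intFunctional (l B) v ∧
      0 < 1 + intFunctional (l B) v + intFunctional (l A) v * ((∑ i, l B i * d A' i : ℤ) : ℝ) := by
    refine (Filter.eventually_all_finset _).2 fun B hB => ?_
    have hc : ∀ C, Continuous fun v => intFunctional (l C) v := fun C =>
      LinearMap.continuous_of_finiteDimensional _
    refine Filter.Eventually.and ?_ ?_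
    · refine (continuousAt_const (y := (0 : ℝ))).eventually_lt
        (continuous_const.add (hc B)).continuousAt ?_
      simp
    · refine (continuousAt_const (y := (0 : ℝ))).eventually_lt
        ((continuous_const.add (hc B)).add ((hc A).mul continuous_const)).continuousAt ?_
      simp
  obtain ⟨ε₁, hε₁, hball⟩ := Metric.eventually_nhds_iff.1 hev
  have hpt : ∀ v, ‖v‖ < ε₁ → ∃ w, (IsWeightOn (insert A τ) w ∨ IsWeightOn (insert A' τ) w) ∧
      weightMap d w ∈ translateBy L v := by
    intro v hv
    have hpos := hball (y := v) (by simpa using hv)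
    -- The sign of l_A(v) decides which facet is met: that of `A`, or that of `A'` with weight
    -- −l_A(v) at `A'`, since l_A(d_{A'}) = −1; the weights on `τ` then absorb the other coordinates
    -- of d_{A'}.
    rcases le_or_gt 0 (intFunctional (l A) v) with h0 | h0
    · have hw : IsWeightOn (insert A τ)
          (fun B => if B ∈ insert A τ then intFunctional (l B) v + w₀ B else 0) := by
        refine ⟨fun B => ?_, fun B hB => if_neg hB⟩
        dsimp only
        split_ifs with hB
        · rcases Finset.mem_insert.1 hB with rfl | hB'
          · rw [hw₀A, add_zero]; exact h0
          · have := (hpos B hB').1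
            simp only [w₀, if_pos hB']
            linarith
        · exact le_rfl
      refine ⟨_, Or.inl hw, (htr _ _).2 fun B hB => ?_⟩
      rw [hl.apply_weightMap hw.2 hB]
      simp only [if_pos hB]
    · let w₁ : κ → ℝ := fun B => if B ∈ τ then 1 + intFunctional (l B) v +
        intFunctional (l A) v * ((∑ i, l B i * d A' i : ℤ) : ℝ) else 0
      have hw₁ : ∀ B ∉ insert A τ, w₁ B = 0 := fun B hB => if_neg fun h' => hB (hτσ h')
      refine ⟨w₁ + Pi.single A' (-intFunctional (l A) v), Or.inr ⟨fun B => add_nonneg ?_ ?_,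
        fun B hB => ?_⟩, (htr _ _).2 fun B hB => ?_⟩
      · simp only [w₁]
        split_ifs with hB
        · exact (hpos B hB).2.le
        · exact le_rfl
      · by_cases hBA : B = A'
        · subst hBA; simpa using h0.le
        · simp [hBA]
      · rw [Finset.mem_insert, not_or] at hB
        simp [w₁, hB.1, hB.2]
      · rw [map_add, map_add, hl.apply_weightMap hw₁ hB, weightMap_single, map_smul,
          intFunctional_intPoint]
        rcases Finset.mem_insert.1 hB with rfl | hB'
        · rw [hlA', hw₀A]
          simp [w₁, hAτ]
        · simp only [w₁, w₀, if_pos hB', smul_eq_mul]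
          ring
  refine ⟨L, hL, min ε₀ ε₁, lt_min hε₀ hε₁, fun v hv hvg => hm v (hv.trans_le (min_le_left _ _)) hvg,
    ?_, fun v hv => ?_⟩
  · obtain ⟨t, ht, htε⟩ := hsmall _ (lt_min hε₀ hε₁)
    exact ⟨_, htε, (hgen t ht).1, (hgen t ht).2.1⟩
  · obtain ⟨w, hw, hwL⟩ := hpt v (hv.trans_le (min_le_right _ _))
    have hwY : weightMap d w ∈ H.polyComplex.finitePart := by
      rw [H.mem_finitePart]
      rcases hw with hw | hw
      · exact ⟨_, hAΔ, w, hw, rfl⟩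
      · exact ⟨_, hA'Δ, w, hw, rfl⟩
    have key : ∀ x ∈ H.polyComplex.finitePart ∩ translateBy L v,
        intFunctional h x ≤ intFunctional h (weightMap d w) ∧
        (intFunctional h x = intFunctional h (weightMap d w) → x = weightMap d w) := by
      rintro x ⟨hxY, hxL⟩
      obtain ⟨σ', hσ', w', hw', rfl⟩ := H.mem_finitePart.1 hxY
      obtain ⟨h1, h2⟩ := hh w hw σ' hσ' w' hw' fun B hB => by
        rw [(htr _ _).1 hxL B hB, (htr _ _).1 hwL B hB]
      exact ⟨h1, fun e => by rw [h2 e]⟩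
    refine ⟨intFunctional h, intFunctional h (weightMap d w), hdne, fun x hx => (key x hx).1,
      weightMap d w, Set.eq_singleton_iff_unique_mem.2 ⟨⟨⟨hwY, hwL⟩, rfl⟩, fun x hx => ?_⟩⟩
    exact (key x hx.1).2 hx.2

end IsSmoothFan

theorem weightMap_mul (s : ι → ℤ) (d : κ → ι → ℤ) (w : κ → ℝ) (i : ι) :
    weightMap (fun A i => s i * d A i) w i = s i * weightMap d w i := by
  rw [weightMap_apply, weightMap_apply, Finset.mul_sum]
  refine Finset.sum_congr rfl fun A _ => ?_
  push_cast
  ring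

/-- Changing the signs of some coordinates preserves smooth fans. -/
theorem IsSmoothFan.flip {k : ℕ} {Δ : Set (Finset κ)} {d : κ → ι → ℤ} (H : IsSmoothFan k Δ d)
    (s : ι → ℤ) (hs : ∀ i, s i * s i = 1) : IsSmoothFan k Δ fun A i => s i * d A i := by
  have hpair : ∀ l e : ι → ℤ, ∑ i, s i * l i * (s i * e i) = ∑ i, l i * e i := fun l e =>
    Finset.sum_congr rfl fun i _ => by linear_combination (l i * e i) * hs i
  have hdual : ∀ l σ, IsDualOn d l σ → IsDualOn (fun A i => s i * d A i) (fun A i => s i * l A i) σ :=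
    fun l σ h A hA B hB => (hpair (l A) (d B)).trans (h A hA B hB)
  have hfun : ∀ (l : ι → ℤ) (w : κ → ℝ), intFunctional (fun i => s i * l i)
      (weightMap (fun A i => s i * d A i) w) = intFunctional l (weightMap d w) := by
    intro l w
    rw [intFunctional_weightMap, intFunctional_weightMap]
    refine Finset.sum_congr rfl fun A _ => ?_
    rw [hpair l (d A)]
  refine ⟨H.down, H.pure, fun σ hσ hk => ?_, fun σ hσ σ' hσ' w w' hw hw' h => ?_,
    fun τ hτ hk A hA hAΔ => ?_⟩
  · obtain ⟨l, hl⟩ := H.dual σ hσ hk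
    exact ⟨_, hdual l σ hl⟩
  · refine H.inj σ hσ σ' hσ' w w' hw hw' ?_
    ext i
    have h1 := congrFun h i
    rw [weightMap_mul, weightMap_mul] at h1
    have h2 : ((s i : ℝ)) * s i = 1 := by exact_mod_cast hs i
    calc weightMap d w i = s i * s i * weightMap d w i := by rw [h2, one_mul]
      _ = s i * s i * weightMap d w' i := by rw [mul_assoc, h1, mul_assoc]
      _ = weightMap d w' i := by rw [h2, one_mul]
  · obtain ⟨A', A'', c, l, h, h1, h2, h3, h4, h5, h6, h7, h8, h9, h10, h11, h12⟩ :=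
      H.star τ hτ hk A hA hAΔ
    refine ⟨A', A'', c, fun B i => s i * l B i, fun i => s i * h i, h1, h2, h3, h4, h5, h6, h7, h8,
      fun i => ?_, hdual l _ h10, (hpair _ _).trans h11, ?_⟩
    · rw [← mul_add, ← mul_add, h9, Finset.mul_sum]
      exact Finset.sum_congr rfl fun B _ => by ring
    · intro w hw σ' hσ' w' hw' hl
      simp only [hfun] at hl ⊢
      exact h12 w hw σ' hσ' w' hw' hl

end Fan

/-! ## Linkages of binary hierarchies -/

section Linkage

variable {α : Type} [DecidableEq α]

/-- A choice, for every member of a family, of one element from each of its two children. -/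
def IsLinkage (F : Finset (Finset α)) (e : Finset α → α × α) : Prop :=
  ∀ B ∈ F, ∃ C₁ C₂, Disjoint C₁ C₂ ∧ B = C₁ ∪ C₂ ∧ IsBlock F C₁ ∧ IsBlock F C₂ ∧
    (e B).1 ∈ C₁ ∧ (e B).2 ∈ C₂

theorem BinaryHierarchy.exists_isLinkage {D : Finset α} {F : Finset (Finset α)}
    (h : BinaryHierarchy D F) : ∃ e, IsLinkage F e := by
  have hex : ∀ B ∈ F, ∃ p : α × α, ∃ C₁ C₂, Disjoint C₁ C₂ ∧ B = C₁ ∪ C₂ ∧ IsBlock F C₁ ∧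
      IsBlock F C₂ ∧ p.1 ∈ C₁ ∧ p.2 ∈ C₂ := by
    intro B hB
    obtain ⟨C₁, C₂, ⟨x, hx⟩, ⟨y, hy⟩, h1, h2, h3, h4⟩ := h.exists_children B hB
    exact ⟨(x, y), C₁, C₂, h1, h2, h3, h4, hx, hy⟩
  obtain ⟨x, -⟩ := h.nonempty
  have : Nonempty α := ⟨x⟩
  choose! e he using hex
  exact ⟨e, he⟩

/-- A set compatible with the family that meets both children of `B` contains both. Products of two
indicators at linked pairs therefore test inclusions, which makes the dual functionals computable.
-/
theorem IsLinkage.subset_iff {F : Finset (Finset α)} {e : Finset α → α × α} (h : IsLinkage F e)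
    {B B' : Finset α} (hB : B ∈ F) (hB' : ∀ A ∈ F, Compatible B' A) :
    ((e B).1 ∈ B' ∧ (e B).2 ∈ B') ↔ B ⊆ B' := by
  obtain ⟨C₁, C₂, hd, hBC, h₁, h₂, hx, hy⟩ := h B hB
  constructor
  · rintro ⟨hx', hy'⟩
    rw [hBC]
    exact subset_of_mem_children hB' h₁ h₂ hd hx hy hx' hy'
  · intro hsub
    exact ⟨hsub (hBC.superset (Finset.mem_union_left _ hx)), hsub (hBC.superset (Finset.mem_union_right _ hy))⟩

theorem IsLinkage.mem {F : Finset (Finset α)} {e : Finset α → α × α} (h : IsLinkage F e)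
    {B : Finset α} (hB : B ∈ F) : (e B).1 ∈ B ∧ (e B).2 ∈ B ∧ (e B).1 ≠ (e B).2 := by
  obtain ⟨C₁, C₂, hd, hBC, h₁, h₂, hx, hy⟩ := h B hB
  refine ⟨hBC.superset (Finset.mem_union_left _ hx), hBC.superset (Finset.mem_union_right _ hy), fun he => ?_⟩
  exact Finset.disjoint_left.1 hd hx (he ▸ hy)

/-- The parent of a member of a laminar family is unique. -/
theorem union_subset_of_ssubset {F : Finset (Finset α)} (hF : ∀ A ∈ F, ∀ B ∈ F, Compatible A B)
    {A C B : Finset α} (hA : A ∈ F) (hAne : A.Nonempty) (hC : IsBlock F C) (hd : Disjoint A C)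
    (hAC : A ∪ C ∈ F) (hB : B ∈ F) (hAB : A ⊂ B) : A ∪ C ⊆ B := by
  obtain ⟨a, ha⟩ := hAne
  obtain ⟨x, hxB, hxA⟩ := Finset.exists_of_ssubset hAB
  rcases (hF B hB _ hAC).of_mem (hAB.1 ha) (Finset.mem_union_left _ ha) with h | h
  · have hxC : x ∈ C := (Finset.mem_union.1 (h hxB)).resolve_left hxA
    exact subset_of_mem_children (hF B hB) (Or.inl hA) hC hd ha hxC (hAB.1 ha) hxB
  · exact h

theorem union_eq_union_of_mem {F : Finset (Finset α)} (hF : ∀ A ∈ F, ∀ B ∈ F, Compatible A B)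
    {A C D : Finset α} (hA : A ∈ F) (hAne : A.Nonempty) (hC : IsBlock F C) (hd : Disjoint A C)
    (hCne : C.Nonempty) (hAC : A ∪ C ∈ F) (hD : IsBlock F D) (hd' : Disjoint A D)
    (hDne : D.Nonempty) (hAD : A ∪ D ∈ F) : A ∪ C = A ∪ D := by
  have hss : ∀ C : Finset α, Disjoint A C → C.Nonempty → A ⊂ A ∪ C := by
    rintro C hd ⟨x, hx⟩
    refine Finset.ssubset_iff_subset_ne.2 ⟨Finset.subset_union_left, fun h => ?_⟩
    exact Finset.disjoint_right.1 hd hx (h ▸ Finset.mem_union_right _ hx)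
  exact Finset.Subset.antisymm
    (union_subset_of_ssubset hF hA hAne hC hd hAC hAD (hss D hd' hDne))
    (union_subset_of_ssubset hF hA hAne hD hd' hAD hAC (hss C hd hCne))

variable [Fintype α]

/-- The total weight of the sets containing both `a` and `b`. -/
def meetWeight (w : Finset α → ℝ) (a b : α) : ℝ := ∑ A with a ∈ A ∧ b ∈ A, w A

theorem meetWeight_comm (w : Finset α → ℝ) (a b : α) : meetWeight w a b = meetWeight w b a := by
  simp only [meetWeight, and_comm]

theorem meetWeight_le {σ : Finset (Finset α)} {w : Finset α → ℝ} (hw : IsWeightOn σ w)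
    {a b a' b' : α} (h : ∀ A ∈ σ, a ∈ A → b ∈ A → a' ∈ A ∧ b' ∈ A) :
    meetWeight w a b ≤ meetWeight w a' b' := by
  simp only [meetWeight, Finset.sum_filter]
  refine Finset.sum_le_sum fun A _ => ?_
  by_cases hA : A ∈ σ
  · split_ifs with h1 h2
    · exact le_rfl
    · exact absurd (h A hA h1.1 h1.2) h2
    · exact hw.1 A
    · exact le_rfl
  · simp [hw.2 A hA]

/-- This is an ultrametric inequality. If some `B` of the family contains `i` and `k` but not `j`,
then a member containing `k` and `j` must contain `B`, hence `i`. -/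
theorem min_meetWeight_le {σ : Finset (Finset α)} (hσ : ∀ A ∈ σ, ∀ B ∈ σ, Compatible A B)
    {w : Finset α → ℝ} (hw : IsWeightOn σ w) (i k j : α) :
    min (meetWeight w i k) (meetWeight w k j) ≤ meetWeight w i j := by
  by_cases h : ∀ A ∈ σ, i ∈ A → k ∈ A → j ∈ A
  · exact (min_le_left _ _).trans (meetWeight_le hw fun A hA hi hk => ⟨hi, h A hA hi hk⟩)
  · push Not at h
    obtain ⟨B, hB, hiB, hkB, hjB⟩ := h
    refine (min_le_right _ _).trans (meetWeight_le hw fun A hA hk hj => ⟨?_, hj⟩)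
    rcases (hσ A hA B hB).of_mem hk hkB with h | h
    · exact absurd (h hj) hjB
    · exact h hiB

/-- If the weights `w` and `w'` satisfy the inequality of meet weights for the pairs of a linkage
adapted to `w`, then they satisfy it for all pairs. -/
theorem IsLinkage.meetWeight_add_le {F σ' : Finset (Finset α)} {e : Finset α → α × α}
    (he : IsLinkage F e) (hF : ∀ A ∈ F, ∀ B ∈ F, Compatible A B) {w w' : Finset α → ℝ}
    (hw : IsWeightOn F w) (hσ' : ∀ A ∈ σ', ∀ B ∈ σ', Compatible A B) (hw' : IsWeightOn σ' w')
    {c : ℝ} (h : ∀ B ∈ F, meetWeight w (e B).1 (e B).2 + c ≤ meetWeight w' (e B).1 (e B).2) :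
    ∀ B ∈ F, ∀ i ∈ B, ∀ j ∈ B, i ≠ j → meetWeight w i j + c ≤ meetWeight w' i j := by
  intro B
  induction hm : B.card using Nat.strong_induction_on generalizing B with
  | _ m ih =>
  intro hB
  obtain ⟨C₁, C₂, hd, hBC, h₁, h₂, hx, hy⟩ := he B hB
  have hlt₁ : C₁.card < m := by
    rw [← hm, hBC, Finset.card_union_of_disjoint hd]
    have := Finset.card_pos.2 ⟨_, hy⟩
    omega
  have hlt₂ : C₂.card < m := by
    rw [← hm, hBC, Finset.card_union_of_disjoint hd]
    have := Finset.card_pos.2 ⟨_, hx⟩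
    omega
  have hmem : ∀ C : Finset α, IsBlock F C → C.card < m → ∀ i ∈ C, ∀ j ∈ C, i ≠ j →
      meetWeight w i j + c ≤ meetWeight w' i j := by
    rintro C (hC | ⟨x, rfl⟩) hlt i hi j hj hij
    · exact ih _ hlt C rfl hC i hi j hj hij
    · exact absurd ((Finset.mem_singleton.1 hi).trans (Finset.mem_singleton.1 hj).symm) hij
  -- Members of `F` containing `i` and `j` contain `B`, so among pairs inside `B` the meet weight
  -- for `w` is smallest at `i`, `j`. The ultrametric inequality for `w'` is applied along the chain
  -- from `i` over the two linked elements to `j`.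
  have hcross : ∀ i ∈ C₁, ∀ j ∈ C₂, meetWeight w i j + c ≤ meetWeight w' i j := by
    intro i hi j hj
    have hsup : ∀ A ∈ F, i ∈ A → j ∈ A → B ⊆ A := fun A hA hiA hjA => by
      rw [hBC]
      exact subset_of_mem_children (hF A hA) h₁ h₂ hd hi hj hiA hjA
    have hxB : (e B).1 ∈ B := hBC.superset (Finset.mem_union_left _ hx)
    have hyB : (e B).2 ∈ B := hBC.superset (Finset.mem_union_right _ hy)
    have s1 : meetWeight w i j + c ≤ meetWeight w' (e B).1 (e B).2 := by
      refine le_trans ?_ (h B hB)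
      gcongr
      exact meetWeight_le hw fun A hA hiA hjA => ⟨hsup A hA hiA hjA hxB, hsup A hA hiA hjA hyB⟩
    have s2 : meetWeight w i j + c ≤ meetWeight w' i (e B).2 := by
      by_cases hix : i = (e B).1
      · rw [hix] at s1 ⊢; exact s1
      · refine le_trans (le_min ?_ s1) (min_meetWeight_le hσ' hw' i (e B).1 (e B).2)
        refine le_trans ?_ (hmem C₁ h₁ hlt₁ i hi _ hx hix)
        gcongr
        exact meetWeight_le hw fun A hA hiA hjA => ⟨hiA, hsup A hA hiA hjA hxB⟩
    by_cases hjy : (e B).2 = j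
    · rw [hjy] at s2; exact s2
    · refine le_trans (le_min s2 ?_) (min_meetWeight_le hσ' hw' i (e B).2 j)
      refine le_trans ?_ (hmem C₂ h₂ hlt₂ _ hy j hj hjy)
      gcongr
      exact meetWeight_le hw fun A hA hiA hjA => ⟨hsup A hA hiA hjA hyB, hjA⟩
  intro i hi j hj hij
  rw [hBC, Finset.mem_union] at hi hj
  rcases hi with hi | hi <;> rcases hj with hj | hj
  · exact hmem C₁ h₁ hlt₁ i hi j hj hij
  · exact hcross i hi j hj
  · rw [meetWeight_comm w, meetWeight_comm w']
    exact hcross j hj i hi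
  · exact hmem C₂ h₂ hlt₂ i hi j hj hij

end Linkage

/-! ## The vectors of double ratios of the splits -/

section Split

variable {n : ℕ}

/-- The indicator function of a finite set. -/
def indic (A : Finset (Fin n)) (i : Fin n) : ℤ := if i ∈ A then 1 else 0

/-- The double ratios of the tree with a single bounded edge, of length one, that separates `A`
from its complement. -/
def splitVec (A : Finset (Fin n)) (q : DoublePair n) : ℤ :=
  (indic A (q.1 0) - indic A (q.1 1)) * (indic A (q.1 2) - indic A (q.1 3))

theorem DoublePair.ne (q : DoublePair n) : q.1 0 ≠ q.1 1 ∧ q.1 0 ≠ q.1 2 ∧ q.1 0 ≠ q.1 3 ∧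
    q.1 1 ≠ q.1 2 ∧ q.1 1 ≠ q.1 3 ∧ q.1 2 ≠ q.1 3 := by
  obtain ⟨h1, h2, h3, h4, h5⟩ := q.2
  exact ⟨h1.ne, h3.ne, (h3.trans h2).ne, h4, h5, h2.ne⟩

theorem indic_union {A B : Finset (Fin n)} (h : Disjoint A B) (i : Fin n) :
    indic (A ∪ B) i = indic A i + indic B i := by
  simp only [indic, Finset.mem_union]
  by_cases hA : i ∈ A
  · simp [hA, Finset.disjoint_left.1 h hA]
  · simp [hA]

/-- The four markings are distinct, so the indicator of a single one makes one of the two factors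
vanish: leaf edges do not contribute. -/
theorem splitVec_singleton (x : Fin n) (q : DoublePair n) : splitVec {x} q = 0 := by
  obtain ⟨h1, h2, h3, h4, h5, h6⟩ := q.ne
  simp only [splitVec, indic, Finset.mem_singleton]
  by_cases h0 : q.1 0 = x
  · subst h0
    simp [h2.symm, h3.symm]
  · by_cases h0' : q.1 1 = x
    · subst h0'
      simp [h4.symm, h5.symm]
    · simp [h0, h0']

/-- Passing to the complement changes the sign of both factors, which reduces the claim to the
singleton of `r`. -/
theorem splitVec_erase (r : Fin n) (q : DoublePair n) : splitVec (Finset.univ.erase r) q = 0 := by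
  have h := splitVec_singleton r q
  have hc : ∀ i, indic (Finset.univ.erase r) i = 1 - indic {r} i := by
    intro i
    simp only [indic, Finset.mem_erase, Finset.mem_univ, and_true, Finset.mem_singleton]
    split_ifs <;> simp_all
  simp only [splitVec, hc] at h ⊢
  linear_combination h

/-- Each double pair is listed in one order only; reordering inside a pair changes the sign and
exchanging the pairs changes nothing. -/
theorem exists_doublePair_of_distinct (i j k l : Fin n) (hij : i ≠ j) (hik : i ≠ k) (hil : i ≠ l)
    (hjk : j ≠ k) (hjl : j ≠ l) (hkl : k ≠ l) : ∃ q : DoublePair n,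
      (∀ A, splitVec A q = (indic A i - indic A j) * (indic A k - indic A l)) ∨
      ∀ A, splitVec A q = -((indic A i - indic A j) * (indic A k - indic A l)) := by
  have swap : ∀ i j k l : Fin n, i < j → k < l → i ≠ k → i ≠ l → j ≠ k → j ≠ l →
      ∃ q : DoublePair n, ∀ A,
        splitVec A q = (indic A i - indic A j) * (indic A k - indic A l) := by
    intro i j k l h1 h2 h3 h4 h5 h6
    rcases lt_or_gt_of_ne h3 with h | h
    · exact ⟨⟨![i, j, k, l], h1, h2, h, h5, h6⟩, fun A => rfl⟩
    · exact ⟨⟨![k, l, i, j], h2, h1, h, h4.symm, h6.symm⟩, fun A => mul_comm _ _⟩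
  rcases lt_or_gt_of_ne hij with h1 | h1 <;> rcases lt_or_gt_of_ne hkl with h2 | h2
  · obtain ⟨q, hq⟩ := swap i j k l h1 h2 hik hil hjk hjl
    exact ⟨q, Or.inl hq⟩
  · obtain ⟨q, hq⟩ := swap i j l k h1 h2 hil hik hjl hjk
    exact ⟨q, Or.inr fun A => by rw [hq]; ring⟩
  · obtain ⟨q, hq⟩ := swap j i k l h1 h2 hjk hjl hik hil
    exact ⟨q, Or.inr fun A => by rw [hq]; ring⟩
  · obtain ⟨q, hq⟩ := swap j i l k h1 h2 hjl hjk hil hik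
    exact ⟨q, Or.inl fun A => by rw [hq]; ring⟩

theorem exists_functional_of_distinct (i j k l : Fin n) (hij : i ≠ j) (hik : i ≠ k) (hil : i ≠ l)
    (hjk : j ≠ k) (hjl : j ≠ l) (hkl : k ≠ l) : ∃ f : DoublePair n → ℤ, ∀ A,
      ∑ q, f q * splitVec A q = (indic A i - indic A j) * (indic A k - indic A l) := by
  obtain ⟨q, hq | hq⟩ := exists_doublePair_of_distinct i j k l hij hik hil hjk hjl hkl
  · refine ⟨Pi.single q 1, fun A => ?_⟩
    rw [← hq A, Finset.sum_eq_single q] <;> simp +contextual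
  · refine ⟨Pi.single q (-1), fun A => ?_⟩
    rw [← neg_eq_iff_eq_neg.2 (hq A), Finset.sum_eq_single q] <;> simp +contextual

/-- For a set not containing `r`, the double ratio of (a c) and (b r) is the difference of the
products at ab and cb. Two such differences, through the intermediate pair bc, give the difference
for ab and cd. -/
theorem exists_pair_functional (r a b c d : Fin n) (hab : a ≠ b) (hcd : c ≠ d) (ha : a ≠ r)
    (hb : b ≠ r) (hc : c ≠ r) (hd : d ≠ r) : ∃ f : DoublePair n → ℤ, ∀ A, r ∉ A →
      ∑ q, f q * splitVec A q = indic A a * indic A b - indic A c * indic A d := by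
  have base : ∀ a b c : Fin n, a ≠ b → c ≠ b → a ≠ r → b ≠ r → c ≠ r →
      ∃ f : DoublePair n → ℤ, ∀ A, r ∉ A →
        ∑ q, f q * splitVec A q = indic A a * indic A b - indic A c * indic A b := by
    intro a b c hab hcb ha hb hc
    by_cases hac : a = c
    · exact ⟨0, fun A _ => by simp [hac]⟩
    · obtain ⟨f, hf⟩ := exists_functional_of_distinct a c b r hac hab ha hcb hc hb
      refine ⟨f, fun A hA => ?_⟩
      rw [hf, show indic A r = 0 from if_neg hA]
      ring
  by_cases hcb : c = b
  · subst hcb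
    obtain ⟨f, hf⟩ := base a c d hab hcd.symm ha hc hd
    exact ⟨f, fun A hA => by rw [hf A hA]; ring⟩
  · obtain ⟨f, hf⟩ := base a b c hab hcb ha hb hc
    obtain ⟨g, hg⟩ := base b c d (Ne.symm hcb) hcd.symm hb hc hd
    refine ⟨f + g, fun A hA => ?_⟩
    simp only [Pi.add_apply, add_mul, Finset.sum_add_distrib, hf A hA, hg A hA]
    ring

theorem intFunctional_splitVec {r : Fin n} {σ : Finset (Finset (Fin n))} (hσ : IsLaminar r σ)
    {w : Finset (Fin n) → ℝ} (hw : IsWeightOn σ w) {f : DoublePair n → ℤ} {a b c d : Fin n}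
    (hf : ∀ A, r ∉ A → ∑ q, f q * splitVec A q = indic A a * indic A b - indic A c * indic A d) :
    intFunctional f (weightMap splitVec w) = meetWeight w a b - meetWeight w c d := by
  rw [intFunctional_weightMap, meetWeight, meetWeight, Finset.sum_filter, Finset.sum_filter,
    ← Finset.sum_sub_distrib]
  refine Finset.sum_congr rfl fun A _ => ?_
  by_cases hA : A ∈ σ
  · rw [hf A (hσ.1 A hA).1]
    simp only [indic]
    by_cases h1 : a ∈ A <;> by_cases h2 : b ∈ A <;> by_cases h3 : c ∈ A <;> by_cases h4 : d ∈ A <;>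
      simp [h1, h2, h3, h4]
  · simp [hw.2 A hA]

/-- The difference of the meet weights at ik and jk is the weight separating i, k from j minus the
weight separating j, k from i. In a laminar family at most one of these is nonzero, so the positive
part of the difference is the separating sum needed for `laminar_weight_ext`. -/
theorem weight_eq_of_meetWeight (hn : 3 ≤ n) {r : Fin n} {σ σ' : Finset (Finset (Fin n))}
    (hσ : IsLaminar r σ) (hσ' : IsLaminar r σ') {w w' : Finset (Fin n) → ℝ}
    (hw : IsWeightOn σ w) (hw' : IsWeightOn σ' w')
    (h : ∀ i k j : Fin n, i ≠ k → i ≠ j → k ≠ j → i ≠ r → k ≠ r → j ≠ r →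
      meetWeight w i k - meetWeight w j k = meetWeight w' i k - meetWeight w' j k) : w = w' := by
  have hsep : ∀ (σ : Finset (Finset (Fin n))) (w : Finset (Fin n) → ℝ), IsLaminar r σ →
      IsWeightOn σ w → ∀ i k j : Fin n,
      ∑ B with i ∈ B ∧ k ∈ B ∧ j ∉ B ∧ r ∉ B, ENNReal.ofReal (w B) =
        ENNReal.ofReal (meetWeight w i k - meetWeight w j k) := by
    intro σ w hσ hw i k j
    rw [← ENNReal.ofReal_sum_of_nonneg fun B _ => hw.1 B]
    have hdiff : meetWeight w i k - meetWeight w j k =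
        ∑ B with i ∈ B ∧ k ∈ B ∧ j ∉ B ∧ r ∉ B, w B -
        ∑ B with j ∈ B ∧ k ∈ B ∧ i ∉ B ∧ r ∉ B, w B := by
      simp only [meetWeight, Finset.sum_filter]
      rw [← Finset.sum_sub_distrib, ← Finset.sum_sub_distrib]
      refine Finset.sum_congr rfl fun A _ => ?_
      by_cases hA : A ∈ σ
      · have hr := (hσ.1 A hA).1
        by_cases h1 : i ∈ A <;> by_cases h2 : k ∈ A <;> by_cases h3 : j ∈ A <;>
          simp [h1, h2, h3, hr]
      · simp [hw.2 A hA]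
    have hnn : ∀ i k j : Fin n, 0 ≤ ∑ B with i ∈ B ∧ k ∈ B ∧ j ∉ B ∧ r ∉ B, w B := fun i k j =>
      Finset.sum_nonneg fun B _ => hw.1 B
    by_cases hex : ∃ B ∈ σ, i ∈ B ∧ k ∈ B ∧ j ∉ B
    · obtain ⟨B, hB, hi, hk, hj⟩ := hex
      have hz : ∑ B with j ∈ B ∧ k ∈ B ∧ i ∉ B ∧ r ∉ B, w B = 0 := by
        refine Finset.sum_eq_zero fun C hC => hw.2 C fun hCσ => ?_
        obtain ⟨-, hjC, hkC, hiC, -⟩ := Finset.mem_filter.1 hC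
        exact (hσ.2 C hCσ B hB).not_crossing hkC hk hjC hj hi hiC
      rw [hdiff, hz, sub_zero]
    · have hz : ∑ B with i ∈ B ∧ k ∈ B ∧ j ∉ B ∧ r ∉ B, w B = 0 := by
        refine Finset.sum_eq_zero fun C hC => hw.2 C fun hCσ => hex ?_
        obtain ⟨-, hi, hk, hj, -⟩ := Finset.mem_filter.1 hC
        exact ⟨C, hCσ, hi, hk, hj⟩
      rw [hdiff, hz, zero_sub, ENNReal.ofReal_zero, ENNReal.ofReal_of_nonpos]
      exact neg_nonpos.2 (hnn j k i)
  have key := laminar_weight_ext hn hσ hσ' (fun A => ENNReal.ofReal (w A))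
    (fun A => ENNReal.ofReal (w' A)) (fun A hA => by simp [hw.2 A hA])
    (fun A hA => by simp [hw'.2 A hA]) fun i k j h1 h2 h3 h4 h5 h6 => by
      rw [hsep σ w hσ hw, hsep σ' w' hσ' hw', h i k j h1 h2 h3 h4 h5 h6]
  ext1 A
  exact (ENNReal.ofReal_eq_ofReal_iff (hw.1 A) (hw'.1 A)).1 (congrFun key A)

end Split

/-! ## The star of a codimension one cone -/

section Star

variable {α : Type} [DecidableEq α] {F : Finset (Finset α)} {A C₁ C₂ C₃ : Finset α}

/-- A cluster `A = C₁ ∪ C₂` of a binary hierarchy `F` with its two children and its sibling `C₃`.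
The three blocks `C₁, C₂, C₃` become the children of a common parent when `A` is removed. -/
structure IsFlag (F : Finset (Finset α)) (A C₁ C₂ C₃ : Finset α) : Prop where
  comp : ∀ B ∈ F, ∀ B' ∈ F, Compatible B B'
  mem : A ∈ F
  eq : A = C₁ ∪ C₂
  ne₁ : C₁.Nonempty
  ne₂ : C₂.Nonempty
  ne₃ : C₃.Nonempty
  disj : Disjoint C₁ C₂
  disj' : Disjoint A C₃
  block₁ : IsBlock F C₁
  block₂ : IsBlock F C₂
  block₃ : IsBlock F C₃
  parent : A ∪ C₃ ∈ F

namespace IsFlag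

theorem nonempty (h : IsFlag F A C₁ C₂ C₃) : A.Nonempty := by
  rw [h.eq]; exact h.ne₁.mono Finset.subset_union_left

theorem disj₁₃ (h : IsFlag F A C₁ C₂ C₃) : Disjoint C₁ C₃ :=
  Finset.disjoint_of_subset_left (h.eq.superset.trans' Finset.subset_union_left) h.disj'

theorem disj₂₃ (h : IsFlag F A C₁ C₂ C₃) : Disjoint C₂ C₃ :=
  Finset.disjoint_of_subset_left (h.eq.superset.trans' Finset.subset_union_right) h.disj'

theorem sub₁ (h : IsFlag F A C₁ C₂ C₃) : C₁ ⊆ A := by rw [h.eq]; exact Finset.subset_union_left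

theorem sub₂ (h : IsFlag F A C₁ C₂ C₃) : C₂ ⊆ A := by rw [h.eq]; exact Finset.subset_union_right

theorem ssubset_parent (h : IsFlag F A C₁ C₂ C₃) : A ⊂ A ∪ C₃ := by
  obtain ⟨x, hx⟩ := h.ne₃
  refine Finset.ssubset_iff_subset_ne.2 ⟨Finset.subset_union_left, fun e => ?_⟩
  exact Finset.disjoint_right.1 h.disj' hx (e ▸ Finset.mem_union_right _ hx)

theorem ne_A₁ (h : IsFlag F A C₁ C₂ C₃) : C₁ ≠ A := by
  rintro rfl
  obtain ⟨x, hx⟩ := h.ne₂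
  exact Finset.disjoint_right.1 h.disj hx (h.sub₂ hx)

theorem ne_A₂ (h : IsFlag F A C₁ C₂ C₃) : C₂ ≠ A := by
  rintro rfl
  obtain ⟨x, hx⟩ := h.ne₁
  exact Finset.disjoint_left.1 h.disj hx (h.sub₁ hx)

theorem ne_A₃ (h : IsFlag F A C₁ C₂ C₃) : C₃ ≠ A := by
  rintro rfl
  obtain ⟨x, hx⟩ := h.ne₃
  exact Finset.disjoint_left.1 h.disj' hx hx

/-- No member other than `A` depends on how the three blocks are grouped; this is why `A` may be
exchanged for another union of two of them. -/
theorem cases_of_mem (h : IsFlag F A C₁ C₂ C₃) {B : Finset α} (hB : B ∈ F) (hne : B ≠ A) :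
    B ⊆ C₁ ∨ B ⊆ C₂ ∨ B ⊆ C₃ ∨ A ∪ C₃ ⊆ B ∨ Disjoint B (A ∪ C₃) := by
  have hBc := h.comp B hB
  rcases hBc A h.mem with hA | hA | hA
  · rcases hBc _ h.parent with hP | hP | hP
    · exact Or.inr (Or.inr (Or.inr (Or.inr hP)))
    · refine Or.inr (Or.inr (Or.inl fun x hx => ?_))
      exact (Finset.mem_union.1 (hP hx)).resolve_left (Finset.disjoint_left.1 hA hx)
    · exact Or.inr (Or.inr (Or.inr (Or.inl hP)))
  · have hA' := hA
    rw [h.eq] at hA'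
    rcases h.block₁.compatible hBc with h1 | h1 | h1
    · refine Or.inr (Or.inl fun x hx => ?_)
      exact (Finset.mem_union.1 (hA' hx)).resolve_left (Finset.disjoint_left.1 h1 hx)
    · exact Or.inl h1
    · rcases h.block₂.compatible hBc with h2 | h2 | h2
      · refine Or.inl fun x hx => ?_
        exact (Finset.mem_union.1 (hA' hx)).resolve_right (Finset.disjoint_left.1 h2 hx)
      · exact Or.inr (Or.inl h2)
      · refine absurd (Finset.Subset.antisymm hA ?_) hne
        rw [h.eq]
        exact Finset.union_subset h1 h2
  · exact Or.inr (Or.inr (Or.inr (Or.inl (union_subset_of_ssubset h.comp h.mem h.nonempty h.block₃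
      h.disj' h.parent hB (Finset.ssubset_iff_subset_ne.2 ⟨hA, Ne.symm hne⟩)))))

/-- A union of some of the three blocks is compatible with the other members of the family. -/
theorem compatible_of_blocks (h : IsFlag F A C₁ C₂ C₃) {B U : Finset α} (hB : B ∈ F) (hne : B ≠ A)
    (hU : U ⊆ A ∪ C₃) (h₁ : C₁ ⊆ U ∨ Disjoint C₁ U) (h₂ : C₂ ⊆ U ∨ Disjoint C₂ U)
    (h₃ : C₃ ⊆ U ∨ Disjoint C₃ U) : Compatible B U := by
  have key : ∀ C, B ⊆ C → (C ⊆ U ∨ Disjoint C U) → Compatible B U := by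
    rintro C hBC (hC | hC)
    · exact Or.inr (Or.inl (hBC.trans hC))
    · exact Or.inl (Finset.disjoint_of_subset_left hBC hC)
  rcases h.cases_of_mem hB hne with h' | h' | h' | h' | h'
  · exact key _ h' h₁
  · exact key _ h' h₂
  · exact key _ h' h₃
  · exact Or.inr (Or.inr (hU.trans h'))
  · exact Or.inl (Finset.disjoint_of_subset_right hU h')

/-- A set compatible with the family without `A`, but not with `A`, is one of the other two unions
of two of the three blocks. -/
theorem eq_or_eq_of_not_compatible (h : IsFlag F A C₁ C₂ C₃) {B : Finset α}
    (hB : ∀ B' ∈ F, B' ≠ A → Compatible B B') (hBA : ¬ Compatible B A) :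
    B = C₂ ∪ C₃ ∨ B = C₁ ∪ C₃ := by
  obtain ⟨⟨x, hxB, hxA⟩, ⟨y, hyB, hyA⟩, ⟨z, hzA, hzB⟩⟩ := not_compatible_iff.1 hBA
  have hblock : ∀ C, IsBlock F C → C ≠ A → Compatible B C := by
    rintro C (hC | ⟨x, rfl⟩) hne
    · exact hB C hC hne
    · exact compatible_singleton B x
  have hP : B ⊆ A ∪ C₃ := by
    refine ((hB _ h.parent h.ssubset_parent.ne').of_mem hxB
      (Finset.mem_union_left _ hxA)).resolve_right fun h' => ?_
    exact hzB (h' (Finset.mem_union_left _ hzA))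
  have hy3 : y ∈ C₃ := (Finset.mem_union.1 (hP hyB)).resolve_left hyA
  have h3 : C₃ ⊆ B := by
    refine ((hblock C₃ h.block₃ h.ne_A₃).of_mem hyB hy3).resolve_left fun h' => ?_
    exact Finset.disjoint_left.1 h.disj' hxA (h' hxB)
  have hsub : ∀ C, IsBlock F C → C ⊆ A → C ≠ A → ∀ u ∈ C, u ∈ B → C ⊆ B := by
    intro C hC hCA hne u huC huB
    refine ((hblock C hC hne).of_mem huB huC).resolve_left fun h' => ?_
    exact hyA (hCA (h' hyB))
  have s1 := hsub C₁ h.block₁ h.sub₁ h.ne_A₁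
  have s2 := hsub C₂ h.block₂ h.sub₂ h.ne_A₂
  have hz := hzA
  rw [h.eq, Finset.mem_union] at hz
  have hx := hxA
  rw [h.eq, Finset.mem_union] at hx
  have hBcases : ∀ u ∈ B, u ∈ C₁ ∨ u ∈ C₂ ∨ u ∈ C₃ := by
    intro u hu
    have := hP hu
    rw [h.eq, Finset.mem_union, Finset.mem_union, or_assoc] at this
    exact this
  rcases hx with hx | hx
  · right
    refine Finset.Subset.antisymm (fun u hu => ?_) (Finset.union_subset (s1 x hx hxB) h3)
    rcases hBcases u hu with h' | h' | h'
    · exact Finset.mem_union_left _ h'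
    · refine absurd ?_ hzB
      rcases hz with hz | hz
      · exact s1 x hx hxB hz
      · exact s2 u h' hu hz
    · exact Finset.mem_union_right _ h'
  · left
    refine Finset.Subset.antisymm (fun u hu => ?_) (Finset.union_subset (s2 x hx hxB) h3)
    rcases hBcases u hu with h' | h' | h'
    · refine absurd ?_ hzB
      rcases hz with hz | hz
      · exact s1 u h' hu hz
      · exact s2 x hx hxB hz
    · exact Finset.mem_union_left _ h'
    · exact Finset.mem_union_right _ h'

end IsFlag

theorem BinaryHierarchy.exists_isFlag {D : Finset α} (h : BinaryHierarchy D F) (hA : A ∈ F)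
    (hne : A ≠ D) : ∃ C₁ C₂ C₃, IsFlag F A C₁ C₂ C₃ := by
  obtain ⟨C₁, C₂, a1, a2, a3, a4, a5, a6⟩ := h.exists_children A hA
  obtain ⟨C₃, b1, b2, b3, b4⟩ := h.exists_sibling A hA hne
  exact ⟨C₁, C₂, C₃, h.compatible, hA, a4, a1, a2, b1, a3, b2, a5, a6, b4, b3⟩

end Star

/-! ## The fan of trees -/

section Moduli

variable {n : ℕ}

/-- `splitVec` is quadratic in the indicator function, and every quadratic form satisfies Q(x+y) +
Q(y+z) + Q(x+z) = Q(x) + Q(y) + Q(z) + Q(x+y+z). -/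
theorem splitVec_relation {C₁ C₂ C₃ : Finset (Fin n)} (h12 : Disjoint C₁ C₂) (h13 : Disjoint C₁ C₃)
    (h23 : Disjoint C₂ C₃) (q : DoublePair n) :
    splitVec (C₁ ∪ C₂) q + splitVec (C₂ ∪ C₃) q + splitVec (C₁ ∪ C₃) q =
      splitVec C₁ q + splitVec C₂ q + splitVec C₃ q + splitVec (C₁ ∪ C₂ ∪ C₃) q := by
  have h123 : Disjoint (C₁ ∪ C₂) C₃ := Finset.disjoint_union_left.2 ⟨h13, h23⟩
  simp only [splitVec, indic_union h123, indic_union h12, indic_union h13, indic_union h23]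
  ring

/-- The functionals dual to the splits of a binary hierarchy, given by a linkage and by the
parents of the clusters. -/
theorem isDualOn_of_isLinkage {r : Fin n} {F : Finset (Finset (Fin n))}
    (hF : BinaryHierarchy (Finset.univ.erase r) F) {e : Finset (Fin n) → Fin n × Fin n}
    (he : IsLinkage F e) {par : Finset (Fin n) → Finset (Fin n)}
    (hpar : ∀ B ∈ F, B ≠ Finset.univ.erase r → ∃ C, C.Nonempty ∧ Disjoint B C ∧ B ∪ C ∈ F ∧
      IsBlock F C ∧ par B = B ∪ C) {l : Finset (Fin n) → DoublePair n → ℤ}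
    (hl : ∀ B ∈ F, B ≠ Finset.univ.erase r → ∀ A, r ∉ A → ∑ q, l B q * splitVec A q =
      indic A (e B).1 * indic A (e B).2 - indic A (e (par B)).1 * indic A (e (par B)).2) :
    IsDualOn splitVec l (F.erase (Finset.univ.erase r)) := by
  intro B hB B' hB'
  obtain ⟨hBne, hB⟩ := Finset.mem_erase.1 hB
  obtain ⟨hBne', hB'⟩ := Finset.mem_erase.1 hB'
  obtain ⟨C, hC, hd, hBC, hblock, hp⟩ := hpar B hB hBne
  rw [hl B hB hBne B' (hF.isCluster hB' hBne').1]
  have hind : ∀ D ∈ F, indic B' (e D).1 * indic B' (e D).2 = if D ⊆ B' then 1 else 0 := by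
    intro D hD
    have := he.subset_iff hD (hF.compatible B' hB')
    simp only [indic]
    by_cases h : D ⊆ B'
    · obtain ⟨h1, h2⟩ := this.2 h
      simp [h1, h2, h]
    · rw [if_neg h]
      rw [← this, not_and_or] at h
      rcases h with h | h <;> simp [h]
  rw [hind B hB, hind (par B) (hp ▸ hBC)]
  -- The value is [B ⊆ B'] − [par B ⊆ B']. A member strictly containing `B` contains its parent, so
  -- the two terms differ only for B' = B.
  by_cases hBB : B = B'
  · subst hBB
    rw [if_pos subset_rfl, if_pos rfl, if_neg, sub_zero]
    rw [hp]
    intro h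
    obtain ⟨x, hx⟩ := hC
    exact Finset.disjoint_right.1 hd hx (h (Finset.mem_union_right _ hx))
  · rw [if_neg hBB]
    by_cases hsub : B ⊆ B'
    · rw [if_pos hsub, if_pos, sub_self]
      rw [hp]
      refine union_subset_of_ssubset hF.compatible hB ?_ hblock hd hBC hB'
        (Finset.ssubset_iff_subset_ne.2 ⟨hsub, hBB⟩)
      exact Finset.card_pos.1 (by have := hF.two_le_card B hB; omega)
    · rw [if_neg hsub, if_neg, sub_zero]
      rw [hp]
      exact fun h => hsub (Finset.subset_union_left.trans h)

/-- A linkage and the parents determine functionals on the space of double ratios. -/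
theorem exists_linkage_functionals {r : Fin n} {F : Finset (Finset (Fin n))}
    (hF : BinaryHierarchy (Finset.univ.erase r) F) {e : Finset (Fin n) → Fin n × Fin n}
    (he : IsLinkage F e) : ∃ (par : Finset (Fin n) → Finset (Fin n))
      (l : Finset (Fin n) → DoublePair n → ℤ),
      (∀ B ∈ F, B ≠ Finset.univ.erase r → ∃ C, C.Nonempty ∧ Disjoint B C ∧ B ∪ C ∈ F ∧
      IsBlock F C ∧ par B = B ∪ C) ∧
      (∀ B ∈ F, B ≠ Finset.univ.erase r → ∀ A, r ∉ A → ∑ q, l B q * splitVec A q =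
      indic A (e B).1 * indic A (e B).2 - indic A (e (par B)).1 * indic A (e (par B)).2) := by
  have hpar : ∀ B, ∃ P, B ∈ F → B ≠ Finset.univ.erase r → ∃ C, C.Nonempty ∧ Disjoint B C ∧
      B ∪ C ∈ F ∧ IsBlock F C ∧ P = B ∪ C := by
    intro B
    by_cases hB : B ∈ F ∧ B ≠ Finset.univ.erase r
    · obtain ⟨C, h1, h2, h3, h4⟩ := hF.exists_sibling B hB.1 hB.2
      exact ⟨B ∪ C, fun _ _ => ⟨C, h1, h2, h3, h4, rfl⟩⟩
    · exact ⟨∅, fun h1 h2 => absurd ⟨h1, h2⟩ hB⟩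
  choose par hpar using hpar
  have hr : ∀ B ∈ F, r ∉ B := fun B hB h => Finset.notMem_erase r _ (hF.subset B hB h)
  have hl : ∀ B, ∃ f : DoublePair n → ℤ, B ∈ F → B ≠ Finset.univ.erase r → ∀ A, r ∉ A →
      ∑ q, f q * splitVec A q =
      indic A (e B).1 * indic A (e B).2 - indic A (e (par B)).1 * indic A (e (par B)).2 := by
    intro B
    by_cases hB : B ∈ F ∧ B ≠ Finset.univ.erase r
    · obtain ⟨C, -, -, h3, -, h5⟩ := hpar B hB.1 hB.2
      have hP : par B ∈ F := h5 ▸ h3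
      obtain ⟨a1, a2, a3⟩ := he.mem hB.1
      obtain ⟨b1, b2, b3⟩ := he.mem hP
      obtain ⟨f, hf⟩ := exists_pair_functional r (e B).1 (e B).2 (e (par B)).1 (e (par B)).2 a3 b3
        (fun h => hr B hB.1 (h ▸ a1)) (fun h => hr B hB.1 (h ▸ a2))
        (fun h => hr _ hP (h ▸ b1)) (fun h => hr _ hP (h ▸ b2))
      exact ⟨f, fun _ _ => hf⟩
    · exact ⟨0, fun h1 h2 => absurd ⟨h1, h2⟩ hB⟩
  choose l hl using hl
  exact ⟨par, l, hpar, hl⟩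

end Moduli

/-! ### Exchanging a cluster for another union of two blocks -/

section Exchange

variable {α : Type} [DecidableEq α] {F : Finset (Finset α)} {A C₁ C₂ C₃ : Finset α}

/-- Linkages of a binary hierarchy and of the one obtained by exchanging `C₁ ∪ C₂` for `C₂ ∪ C₃`
that use the same pairs of elements. -/
theorem IsFlag.exists_linkages (h : IsFlag F A C₁ C₂ C₃) {e₀ : Finset α → α × α}
    (he₀ : IsLinkage F e₀) : ∃ e e', IsLinkage F e ∧ IsLinkage (insert (C₂ ∪ C₃) (F.erase A)) e' ∧
      (∀ B ∈ insert (C₂ ∪ C₃) (F.erase A), ∃ D ∈ F, e' B = e D) ∧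
      (e A).1 ∈ C₁ ∧ (e A).2 ∈ C₂ ∧ e (A ∪ C₃) = ((e A).2, (e (A ∪ C₃)).2) ∧
      (e (A ∪ C₃)).2 ∈ C₃ := by
  obtain ⟨c₁, hc₁⟩ := h.ne₁
  obtain ⟨c₂, hc₂⟩ := h.ne₂
  obtain ⟨c₃, hc₃⟩ := h.ne₃
  have hPA : A ∪ C₃ ≠ A := h.ssubset_parent.ne'
  have hPA' : A ∪ C₃ ≠ C₂ ∪ C₃ := by
    intro e
    have : c₁ ∈ C₂ ∪ C₃ := e ▸ Finset.mem_union_left _ (h.sub₁ hc₁)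
    rcases Finset.mem_union.1 this with h' | h'
    · exact Finset.disjoint_left.1 h.disj hc₁ h'
    · exact Finset.disjoint_left.1 h.disj₁₃ hc₁ h'
  -- The pairs c₁c₂ and c₂c₃ serve both families: in `F` they link `A` and its parent, in the
  -- exchanged family they link the parent and `C₂ ∪ C₃`.
  set e := Function.update (Function.update e₀ (A ∪ C₃) (c₂, c₃)) A (c₁, c₂) with he
  set e' := Function.update (Function.update e₀ (A ∪ C₃) (c₁, c₂)) (C₂ ∪ C₃) (c₂, c₃) with he'
  have heA : e A = (c₁, c₂) := Function.update_self ..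
  have heP : e (A ∪ C₃) = (c₂, c₃) := by
    rw [he, Function.update_of_ne hPA, Function.update_self]
  have heB : ∀ B, B ≠ A → B ≠ A ∪ C₃ → e B = e₀ B := fun B h1 h2 => by
    rw [he, Function.update_of_ne h1, Function.update_of_ne h2]
  have heA' : e' (C₂ ∪ C₃) = (c₂, c₃) := Function.update_self ..
  have heP' : e' (A ∪ C₃) = (c₁, c₂) := by
    rw [he', Function.update_of_ne hPA', Function.update_self]
  have heB' : ∀ B, B ≠ C₂ ∪ C₃ → B ≠ A ∪ C₃ → e' B = e₀ B := fun B h1 h2 => by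
    rw [he', Function.update_of_ne h1, Function.update_of_ne h2]
  have hblock : ∀ C, IsBlock F C → C ≠ A → IsBlock (insert (C₂ ∪ C₃) (F.erase A)) C := by
    rintro C (hC | hC) hne
    · exact Or.inl (Finset.mem_insert_of_mem (Finset.mem_erase.2 ⟨hne, hC⟩))
    · exact Or.inr hC
  refine ⟨e, e', ?_, ?_, ?_, by rw [heA]; exact hc₁, by rw [heA]; exact hc₂, by rw [heA, heP],
    by rw [heP]; exact hc₃⟩
  · intro B hB
    by_cases hBA : B = A
    · subst hBA
      rw [heA]
      exact ⟨C₁, C₂, h.disj, h.eq, h.block₁, h.block₂, hc₁, hc₂⟩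
    · by_cases hBP : B = A ∪ C₃
      · subst hBP
        rw [heP]
        exact ⟨A, C₃, h.disj', rfl, Or.inl h.mem, h.block₃, h.sub₂ hc₂, hc₃⟩
      · rw [heB B hBA hBP]
        exact he₀ B hB
  · intro B hB
    by_cases hBA : B = C₂ ∪ C₃
    · subst hBA
      rw [heA']
      exact ⟨C₂, C₃, h.disj₂₃, rfl, hblock _ h.block₂ h.ne_A₂, hblock _ h.block₃ h.ne_A₃, hc₂, hc₃⟩
    · obtain ⟨hne, hBF⟩ := Finset.mem_erase.1 ((Finset.mem_insert.1 hB).resolve_left hBA)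
      by_cases hBP : B = A ∪ C₃
      · subst hBP
        rw [heP']
        exact ⟨C₁, C₂ ∪ C₃, Finset.disjoint_union_right.2 ⟨h.disj, h.disj₁₃⟩,
          by rw [h.eq, Finset.union_assoc], hblock _ h.block₁ h.ne_A₁,
          Or.inl (Finset.mem_insert_self _ _), hc₁, Finset.mem_union_left _ hc₂⟩
      · rw [heB' B hBA hBP]
        obtain ⟨D₁, D₂, hd, hBD, h₁, h₂, hx, hy⟩ := he₀ B hBF
        -- By uniqueness of the parent, `A` is a child of `A ∪ C₃` only, so the children of other
        -- members survive the removal of `A` as blocks.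
        have hpar : ∀ D D' : Finset α, IsBlock F D' → Disjoint D D' → D'.Nonempty →
            B = D ∪ D' → D ≠ A := by
          rintro D D' hD' hdD hne' hBD rfl
          refine hBP (hBD.trans ?_)
          exact union_eq_union_of_mem h.comp h.mem h.nonempty hD' hdD hne' (hBD ▸ hBF) h.block₃
            h.disj' h.ne₃ h.parent
        exact ⟨D₁, D₂, hd, hBD, hblock _ h₁ (hpar D₁ D₂ h₂ hd ⟨_, hy⟩ hBD),
          hblock _ h₂ (hpar D₂ D₁ h₁ hd.symm ⟨_, hx⟩ (hBD.trans (Finset.union_comm _ _))), hx, hy⟩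
  · intro B hB
    by_cases hBA : B = C₂ ∪ C₃
    · exact ⟨_, h.parent, by rw [hBA, heA', heP]⟩
    · obtain ⟨hne, hBF⟩ := Finset.mem_erase.1 ((Finset.mem_insert.1 hB).resolve_left hBA)
      by_cases hBP : B = A ∪ C₃
      · exact ⟨_, h.mem, by rw [hBP, heP', heA]⟩
      · exact ⟨B, hBF, by rw [heB' B hBA hBP, heB B hne hBP]⟩

/-- The family obtained by exchanging `C₁ ∪ C₂` for another union of blocks is laminar. -/
theorem IsFlag.compatible_exchange (h : IsFlag F A C₁ C₂ C₃) {U : Finset α}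
    (hU : U ⊆ A ∪ C₃) (h₁ : C₁ ⊆ U ∨ Disjoint C₁ U) (h₂ : C₂ ⊆ U ∨ Disjoint C₂ U)
    (h₃ : C₃ ⊆ U ∨ Disjoint C₃ U) :
    ∀ B ∈ insert U (F.erase A), ∀ B' ∈ insert U (F.erase A), Compatible B B' := by
  have key : ∀ B ∈ F.erase A, Compatible B U := fun B hB =>
    h.compatible_of_blocks (Finset.mem_of_mem_erase hB) (Finset.ne_of_mem_erase hB) hU h₁ h₂ h₃
  intro B hB B' hB'
  rcases Finset.mem_insert.1 hB with e | h₄ <;> rcases Finset.mem_insert.1 hB' with e' | h₅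
  · exact e ▸ e' ▸ Compatible.refl _
  · exact e ▸ (key _ h₅).symm
  · exact e' ▸ key _ h₄
  · exact h.comp _ (Finset.mem_of_mem_erase h₄) _ (Finset.mem_of_mem_erase h₅)

end Exchange

/-! ### The fan of laminar families is smooth -/

section ModuliFan

variable {n : ℕ}

/-- A functional that is maximal at `w` among the weights whose meet weights, normalized at the
pair `a`, `b`, are at least those of `w`. -/
theorem exists_spread_functional (hn : 3 ≤ n) {r a b : Fin n} (hab : a ≠ b) (ha : a ≠ r)
    (hb : b ≠ r) : ∃ h : DoublePair n → ℤ, ∀ σ σ', IsLaminar r σ → IsLaminar r σ' → ∀ w w',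
      IsWeightOn σ w → IsWeightOn σ' w' → (∀ i j, i ≠ j → i ≠ r → j ≠ r →
        meetWeight w i j + (meetWeight w' a b - meetWeight w a b) ≤ meetWeight w' i j) →
      intFunctional h (weightMap splitVec w') ≤ intFunctional h (weightMap splitVec w) ∧
      (intFunctional h (weightMap splitVec w') = intFunctional h (weightMap splitVec w) →
        w' = w) := by
  have hex : ∀ p : Fin n × Fin n, ∃ f : DoublePair n → ℤ,
      if p.1 ≠ p.2 ∧ p.1 ≠ r ∧ p.2 ≠ r then ∀ A, r ∉ A → ∑ q, f q * splitVec A q =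
        indic A p.1 * indic A p.2 - indic A a * indic A b else f = 0 := by
    intro p
    split_ifs with h
    · exact exists_pair_functional r p.1 p.2 a b h.1 hab h.2.1 h.2.2 ha hb
    · exact ⟨0, rfl⟩
  choose f hf using hex
  have hsum : ∀ x, intFunctional (-∑ p, f p) x = -∑ p, intFunctional (f p) x := by
    intro x
    simp only [intFunctional_apply, Pi.neg_apply, Finset.sum_apply]
    rw [Finset.sum_comm, ← Finset.sum_neg_distrib]
    refine Finset.sum_congr rfl fun i _ => ?_
    push_cast
    rw [neg_mul, Finset.sum_mul]
  -- The functional is minus the sum, over pairs of distinct markings other than `r`, of the meet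
  -- weights normalized at `a`, `b`; the remaining pairs contribute 0.
  refine ⟨-∑ p, f p, fun σ σ' hσ hσ' w w' hw hw' hle => ?_⟩
  have hval : ∀ p : Fin n × Fin n, p.1 ≠ p.2 ∧ p.1 ≠ r ∧ p.2 ≠ r → ∀ σ w, IsLaminar r σ →
      IsWeightOn σ w → intFunctional (f p) (weightMap splitVec w) =
        meetWeight w p.1 p.2 - meetWeight w a b := by
    intro p hp σ w hσ hw
    refine intFunctional_splitVec hσ hw ?_
    have := hf p
    rwa [if_pos hp] at this
  have hterm : ∀ p, intFunctional (f p) (weightMap splitVec w) ≤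
      intFunctional (f p) (weightMap splitVec w') := by
    intro p
    by_cases hp : p.1 ≠ p.2 ∧ p.1 ≠ r ∧ p.2 ≠ r
    · rw [hval p hp σ w hσ hw, hval p hp σ' w' hσ' hw']
      linarith [hle p.1 p.2 hp.1 hp.2.1 hp.2.2]
    · have := hf p
      rw [if_neg hp] at this
      simp [this, intFunctional_apply]
  rw [hsum, hsum]
  refine ⟨neg_le_neg (Finset.sum_le_sum fun p _ => hterm p), fun heq => ?_⟩
  -- Equality of the sums forces equality term by term, and differences of meet weights determine
  -- the weight.
  have hall := (Finset.sum_eq_sum_iff_of_le fun p _ => hterm p).1 (neg_injective heq).symm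
  refine weight_eq_of_meetWeight hn hσ' hσ hw' hw fun i k j hik hij hkj hi hk hj => ?_
  have h1 := hall (i, k) (Finset.mem_univ _)
  have h2 := hall (j, k) (Finset.mem_univ _)
  rw [hval _ ⟨hik, hi, hk⟩ σ w hσ hw, hval _ ⟨hik, hi, hk⟩ σ' w' hσ' hw'] at h1
  rw [hval _ ⟨hkj.symm, hj, hk⟩ σ w hσ hw, hval _ ⟨hkj.symm, hj, hk⟩ σ' w' hσ' hw'] at h2
  dsimp only at h1 h2
  linarith

/-- If the functionals of a linkage agree on two weights, then the meet weights of the pairs of the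
linkage differ by a constant. -/
theorem meetWeight_linkage_sub {r : Fin n} {F : Finset (Finset (Fin n))}
    {e : Finset (Fin n) → Fin n × Fin n}
    {par : Finset (Fin n) → Finset (Fin n)} {l : Finset (Fin n) → DoublePair n → ℤ}
    (hpar : ∀ B ∈ F, B ≠ Finset.univ.erase r → ∃ C, C.Nonempty ∧ Disjoint B C ∧ B ∪ C ∈ F ∧
      IsBlock F C ∧ par B = B ∪ C)
    (hl : ∀ B ∈ F, B ≠ Finset.univ.erase r → ∀ A, r ∉ A → ∑ q, l B q * splitVec A q =
      indic A (e B).1 * indic A (e B).2 - indic A (e (par B)).1 * indic A (e (par B)).2)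
    {σ σ' : Finset (Finset (Fin n))} (hσ : IsLaminar r σ) (hσ' : IsLaminar r σ')
    {w w' : Finset (Fin n) → ℝ} (hw : IsWeightOn σ w) (hw' : IsWeightOn σ' w')
    (h : ∀ B ∈ F, B ≠ Finset.univ.erase r → intFunctional (l B) (weightMap splitVec w') =
      intFunctional (l B) (weightMap splitVec w)) {a b : Fin n}
    (hab : e (Finset.univ.erase r) = (a, b)) : ∀ B ∈ F,
      meetWeight w (e B).1 (e B).2 + (meetWeight w' a b - meetWeight w a b) =
        meetWeight w' (e B).1 (e B).2 := by
  intro B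
  -- Induction from the top set downwards: l_B compares the linked pair of `B` with that of its
  -- larger parent.
  induction hm : n - B.card using Nat.strong_induction_on generalizing B with
  | _ m ih =>
  intro hB
  by_cases hBX : B = Finset.univ.erase r
  · rw [hBX, hab]
    ring
  · obtain ⟨C, hC, hd, hBC, -, hp⟩ := hpar B hB hBX
    have hcard : (par B).card ≤ n := (Finset.card_le_univ _).trans_eq (Fintype.card_fin n)
    have hlt : B.card < (par B).card := by
      rw [hp, Finset.card_union_of_disjoint hd]
      have := Finset.card_pos.2 hC
      omega
    have h1 := ih (n - (par B).card) (by omega) (par B) rfl (hp ▸ hBC)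
    have h2 := h B hB hBX
    rw [intFunctional_splitVec hσ' hw' (hl B hB hBX), intFunctional_splitVec hσ hw (hl B hB hBX)]
      at h2
    linarith

/-- In the relation of the three generators, blocks outside `τ` are singletons or the top set and
have zero vector. So every block contributes an integer multiple of generators of `τ`. -/
theorem splitVec_block {r : Fin n} {τ : Finset (Finset (Fin n))}
    {C : Finset (Fin n)} (hC : C ∈ τ ∨ C = Finset.univ.erase r ∨ ∃ x, C = {x}) (q : DoublePair n) :
    splitVec C q = ∑ B ∈ τ, (if B = C then 1 else 0) * splitVec B q := by
  by_cases h : C ∈ τ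
  · simp [ite_mul, Finset.sum_ite_eq', h]
  · have h0 : splitVec C q = 0 := by
      rcases hC.resolve_left h with rfl | ⟨x, rfl⟩
      · exact splitVec_erase r q
      · exact splitVec_singleton x q
    rw [h0]
    refine (Finset.sum_eq_zero fun B hB => ?_).symm
    rw [if_neg (by rintro rfl; exact h hB), zero_mul]

theorem IsFlag.isLaminar_exchange {r : Fin n} {τ : Finset (Finset (Fin n))}
    {A C₁ C₂ C₃ U : Finset (Fin n)} (hτ : IsLaminar r τ) (hA : A ∉ τ)
    (h : IsFlag (insert (Finset.univ.erase r) (insert A τ)) A C₁ C₂ C₃)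
    (hr : ∀ B ∈ insert (Finset.univ.erase r) (insert A τ), r ∉ B)
    (hU : U ⊂ A ∪ C₃) (hUc : 2 ≤ U.card) (h₁ : C₁ ⊆ U ∨ Disjoint C₁ U)
    (h₂ : C₂ ⊆ U ∨ Disjoint C₂ U) (h₃ : C₃ ⊆ U ∨ Disjoint C₃ U) : IsLaminar r (insert U τ) := by
  have hsub : insert U τ ⊆ insert U ((insert (Finset.univ.erase r) (insert A τ)).erase A) := by
    refine Finset.insert_subset_insert _ fun B hB => Finset.mem_erase.2 ⟨fun e => hA (e ▸ hB), ?_⟩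
    exact Finset.mem_insert_of_mem (Finset.mem_insert_of_mem hB)
  refine ⟨fun B hB => ?_, fun B hB B' hB' =>
    h.compatible_exchange hU.1 h₁ h₂ h₃ B (hsub hB) B' (hsub hB')⟩
  rcases Finset.mem_insert.1 hB with rfl | hB
  · refine ⟨fun hrU => hr _ h.parent (hU.1 hrU), hUc, ?_⟩
    rintro rfl
    refine hU.2 fun x hx => Finset.mem_erase.2 ⟨?_, Finset.mem_univ x⟩
    rintro rfl
    exact hr _ h.parent hx
  · exact hτ.1 B hB

/-- The vectors of double ratios of the splits form a smooth fan over the complex of laminar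
families. -/
theorem isSmoothFan_splitVec (hn : 3 ≤ n) (r : Fin n) :
    IsSmoothFan (n - 3) {σ | IsLaminar r σ} (splitVec (n := n)) where
  down σ hσ τ hτ := IsLaminar.mono hσ hτ
  pure σ hσ := by
    obtain ⟨σ', h1, h2, h3⟩ := IsLaminar.exists_extension hn hσ
    exact ⟨σ', h1, h2, h3⟩
  dual σ hσ hc := by
    have hF := IsLaminar.binaryHierarchy hn hσ hc
    obtain ⟨e, he⟩ := hF.exists_isLinkage
    obtain ⟨par, l, hpar, hl⟩ := exists_linkage_functionals hF he
    have := isDualOn_of_isLinkage hF he hpar hl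
    rw [Finset.erase_insert fun h => (hσ.1 _ h).2.2 rfl] at this
    exact ⟨l, this⟩
  inj σ hσ σ' hσ' w w' hw hw' heq := by
    refine weight_eq_of_meetWeight hn hσ hσ' hw hw' fun i k j hik hij hkj hi hk hj => ?_
    obtain ⟨f, hf⟩ := exists_pair_functional r i k j k hik hkj.symm hi hk hj hk
    rw [← intFunctional_splitVec hσ hw hf, ← intFunctional_splitVec hσ' hw' hf, heq]
  star τ hτ hcard A hA hAτ := by
    rw [Set.mem_ofPred_eq] at hτ hAτ
    set X := (Finset.univ : Finset (Fin n)).erase r with hX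
    have hc : (insert A τ).card = n - 3 := by rw [Finset.card_insert_of_notMem hA, hcard]
    have hXτ : X ∉ insert A τ := fun h => (hAτ.1 _ h).2.2 rfl
    set F := insert X (insert A τ) with hFdef
    have hF : BinaryHierarchy X F := hAτ.binaryHierarchy hn hc
    have hAF : A ∈ F := Finset.mem_insert_of_mem (Finset.mem_insert_self _ _)
    have hAX : A ≠ X := (hAτ.1 A (Finset.mem_insert_self _ _)).2.2
    have hr : ∀ B ∈ F, r ∉ B := fun B hB h => Finset.notMem_erase r _ (hF.subset B hB h)
    obtain ⟨C₁, C₂, C₃, hflag⟩ := hF.exists_isFlag hAF hAX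
    obtain ⟨e₀, he₀⟩ := hF.exists_isLinkage
    obtain ⟨e, e', he, he', hee', h1, h2, h3, h4⟩ := hflag.exists_linkages he₀
    obtain ⟨par, l, hpar, hl⟩ := exists_linkage_functionals hF he
    obtain ⟨x1, x2, x3⟩ := he.mem (hF.root_mem hn)
    obtain ⟨h, hh⟩ := exists_spread_functional hn x3 (r := r)
      (fun e => Finset.notMem_erase r _ (e ▸ x1)) (fun e => Finset.notMem_erase r _ (e ▸ x2))
    set c₁ := (e A).1
    set c₂ := (e A).2
    set c₃ := (e (A ∪ C₃)).2
    have d12 := hflag.disj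
    have d13 := hflag.disj₁₃
    have d23 := hflag.disj₂₃
    have n12 : c₁ ∉ C₂ := Finset.disjoint_left.1 d12 h1
    have n13 : c₁ ∉ C₃ := Finset.disjoint_left.1 d13 h1
    have n21 : c₂ ∉ C₁ := Finset.disjoint_right.1 d12 h2
    have n23 : c₂ ∉ C₃ := Finset.disjoint_left.1 d23 h2
    have n31 : c₃ ∉ C₁ := Finset.disjoint_right.1 d13 h4
    have n32 : c₃ ∉ C₂ := Finset.disjoint_right.1 d23 h4
    have m1A : c₁ ∈ A := hflag.sub₁ h1
    have m2A : c₂ ∈ A := hflag.sub₂ h2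
    have m3A : c₃ ∉ A := Finset.disjoint_right.1 hflag.disj' h4
    have m1A' : c₁ ∉ C₂ ∪ C₃ := by simp [n12, n13]
    have m2A' : c₂ ∈ C₂ ∪ C₃ := Finset.mem_union_left _ h2
    have m3A' : c₃ ∈ C₂ ∪ C₃ := Finset.mem_union_right _ h4
    have m1A'' : c₁ ∈ C₁ ∪ C₃ := Finset.mem_union_left _ h1
    have m2A'' : c₂ ∉ C₁ ∪ C₃ := by simp [n21, n23]
    have m3A'' : c₃ ∈ C₁ ∪ C₃ := Finset.mem_union_right _ h4
    have hsub' : C₂ ∪ C₃ ⊂ A ∪ C₃ := by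
      refine (Finset.ssubset_iff_of_subset (Finset.union_subset_union_left hflag.sub₂)).2
        ⟨c₁, Finset.mem_union_left _ m1A, m1A'⟩
    have hsub'' : C₁ ∪ C₃ ⊂ A ∪ C₃ := by
      refine (Finset.ssubset_iff_of_subset (Finset.union_subset_union_left hflag.sub₁)).2
        ⟨c₂, Finset.mem_union_left _ m2A, m2A''⟩
    have hτA : ∀ B ∈ τ, Compatible B A := fun B hB =>
      hAτ.2 B (Finset.mem_insert_of_mem hB) A (Finset.mem_insert_self _ _)
    have hA'τ : C₂ ∪ C₃ ∉ τ := fun hm => (hτA _ hm).not_crossing m2A' m2A m3A' m3A m1A m1A'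
    have hA''τ : C₁ ∪ C₃ ∉ τ := fun hm => (hτA _ hm).not_crossing m1A'' m1A m3A'' m3A m2A m2A''
    have hlam' : IsLaminar r (insert (C₂ ∪ C₃) τ) := by
      refine hflag.isLaminar_exchange hτ hA hr hsub' ?_
        (Or.inr (Finset.disjoint_union_right.2 ⟨d12, d13⟩)) (Or.inl Finset.subset_union_left)
        (Or.inl Finset.subset_union_right)
      exact Finset.one_lt_card.2 ⟨c₂, m2A', c₃, m3A', fun e => n23 (e ▸ h4)⟩
    have hlam'' : IsLaminar r (insert (C₁ ∪ C₃) τ) := by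
      refine hflag.isLaminar_exchange hτ hA hr hsub'' ?_ (Or.inl Finset.subset_union_left)
        (Or.inr (Finset.disjoint_union_right.2 ⟨d12.symm, d23⟩))
        (Or.inl Finset.subset_union_right)
      exact Finset.one_lt_card.2 ⟨c₁, m1A'', c₃, m3A'', fun e => n13 (e ▸ h4)⟩
    have hblock : ∀ C, IsBlock F C → C ≠ A → C ∈ τ ∨ C = X ∨ ∃ x, C = {x} := by
      rintro C (hC | hC) hne
      · rcases Finset.mem_insert.1 hC with rfl | hC
        · exact Or.inr (Or.inl rfl)
        · exact Or.inl ((Finset.mem_insert.1 hC).resolve_left hne)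
      · exact Or.inr (Or.inr hC)
    -- The coefficients count how often a member of `τ` occurs among the three blocks and their
    -- union, the right-hand side of `splitVec_relation`.
    refine ⟨C₂ ∪ C₃, C₁ ∪ C₃, fun B => (if B = C₁ then 1 else 0) + (if B = C₂ then 1 else 0) +
      (if B = C₃ then 1 else 0) + (if B = A ∪ C₃ then 1 else 0), l, h, hA'τ, hA''τ,
      fun e => m1A' (e ▸ m1A), fun e => m2A'' (e ▸ m2A), fun e => m1A' (e ▸ m1A''), hlam', hlam'',
      ?_, ?_, ?_, ?_, ?_⟩
    · intro B hB hBτ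
      rw [Set.mem_ofPred_eq] at hBτ
      -- A further cluster compatible with `A` would give a laminar family of more than `n - 3`
      -- members; one crossing `A` must be another union of two blocks.
      by_cases hBA : Compatible B A
      · by_contra hne
        push Not at hne
        have hBiA : B ∉ insert A τ := fun h => (Finset.mem_insert.1 h).elim hne.1 hB
        have hlam : IsLaminar r (insert B (insert A τ)) := by
          refine ⟨fun D hD => ?_, fun D hD D' hD' => ?_⟩
          · rcases Finset.mem_insert.1 hD with rfl | hD
            · exact hBτ.1 _ (Finset.mem_insert_self _ _)
            · exact hAτ.1 D hD
          · have hBc : ∀ D ∈ insert A τ, Compatible B D := by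
              intro D hD
              rcases Finset.mem_insert.1 hD with rfl | hD
              · exact hBA
              · exact hBτ.2 _ (Finset.mem_insert_self _ _) _ (Finset.mem_insert_of_mem hD)
            rcases Finset.mem_insert.1 hD with e | h₅ <;>
              rcases Finset.mem_insert.1 hD' with e' | h₆
            · exact e ▸ e' ▸ Compatible.refl _
            · exact e ▸ hBc _ h₆
            · exact e' ▸ (hBc _ h₅).symm
            · exact hAτ.2 _ h₅ _ h₆
        obtain ⟨σ', -, hs, hcs⟩ := hlam.exists_extension hn
        have := Finset.card_le_card hs
        rw [Finset.card_insert_of_notMem hBiA] at this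
        omega
      · refine Or.inr (hflag.eq_or_eq_of_not_compatible (fun B' hB' hne => ?_) hBA)
        rcases Finset.mem_insert.1 hB' with rfl | hB'
        · exact Or.inr (Or.inl (hBτ.1 _ (Finset.mem_insert_self _ _)).subset)
        · exact hBτ.2 _ (Finset.mem_insert_self _ _) _
            (Finset.mem_insert_of_mem ((Finset.mem_insert.1 hB').resolve_left hne))
    · intro q
      have hrel := splitVec_relation d12 d13 d23 q
      rw [← hflag.eq] at hrel
      rw [hrel, splitVec_block (hblock _ hflag.block₁ hflag.ne_A₁),
        splitVec_block (hblock _ hflag.block₂ hflag.ne_A₂),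
        splitVec_block (hblock _ hflag.block₃ hflag.ne_A₃),
        splitVec_block (hblock _ (Or.inl hflag.parent) hflag.ssubset_parent.ne')]
      simp only [add_mul, Finset.sum_add_distrib]
    · have := isDualOn_of_isLinkage hF he hpar hl
      rwa [Finset.erase_insert hXτ] at this
    -- The linked pair of `A` is c₁c₂, with c₁ outside `C₂ ∪ C₃`, and that of its parent is c₂c₃,
    -- inside it; the value is 0 − 1.
    · rw [hl A hAF hAX _ fun h => hr _ hflag.parent (hsub'.1 h)]
      obtain ⟨C, g1, g2, g3, g4, g5⟩ := hpar A hAF hAX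
      rw [g5, union_eq_union_of_mem hflag.comp hAF hflag.nonempty g4 g2 g1 g3 hflag.block₃
        hflag.disj' hflag.ne₃ hflag.parent, h3]
      simp only [indic]
      rw [if_neg m1A', if_pos m2A', if_pos m3A']
      norm_num
    · intro w hw σ' hσ' w' hw' hlw
      obtain ⟨σ, hσ, hwσ⟩ : ∃ σ, IsLaminar r σ ∧ IsWeightOn σ w :=
        hw.elim (fun hw => ⟨_, hAτ, hw⟩) fun hw => ⟨_, hlam', hw⟩
      have hmeet := meetWeight_linkage_sub hpar hl hσ hσ' hwσ hw'
        (fun B hB hne => hlw B ((Finset.mem_insert.1 hB).resolve_left hne)) (Prod.mk.eta).symm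
      refine hh σ σ' hσ hσ' w w' hwσ hw' fun i j hij hi hj => ?_
      have hiX : i ∈ X := Finset.mem_erase.2 ⟨hi, Finset.mem_univ _⟩
      have hjX : j ∈ X := Finset.mem_erase.2 ⟨hj, Finset.mem_univ _⟩
      rcases hw with hw | hw
      · exact he.meetWeight_add_le hF.compatible (hw.mono (Finset.subset_insert _ _)) hσ'.2 hw'
          (fun B hB => (hmeet B hB).le) X (hF.root_mem hn) i hiX j hjX hij
      -- For a weight on the neighbouring cone the adapted linkage is `e'`. Its pairs all occur in
      -- `e`, so `hmeet` still provides the hypothesis.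
      · have hcomp := hflag.compatible_exchange hsub'.1
          (Or.inr (Finset.disjoint_union_right.2 ⟨d12, d13⟩)) (Or.inl Finset.subset_union_left)
          (Or.inl Finset.subset_union_right)
        refine he'.meetWeight_add_le hcomp (hw.mono ?_) hσ'.2 hw' (fun B hB => ?_) X
          (Finset.mem_insert_of_mem (Finset.mem_erase.2 ⟨hAX.symm, hF.root_mem hn⟩)) i hiX j hjX hij
        · refine Finset.insert_subset_insert _ fun B hB =>
            Finset.mem_erase.2 ⟨fun e => hA (e ▸ hB), ?_⟩
          exact Finset.mem_insert_of_mem (Finset.mem_insert_of_mem hB)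
        · obtain ⟨D, hD, heD⟩ := hee' B hB
          rw [heD]
          exact (hmeet D hD).le

end ModuliFan

/-! ## Rooted trees -/

section Rooting

/-- The tree `G` with root `ρ`, where `π` is the parent map and `dep` is a depth function. -/
structure IsRooting {V : Type} (G : SimpleGraph V) (ρ : V) (π : V → V) (dep : V → ℕ) : Prop where
  root : π ρ = ρ
  adj_iff : ∀ u v, G.Adj u v ↔ (π u = v ∧ u ≠ ρ) ∨ (π v = u ∧ v ≠ ρ)
  dep_lt : ∀ v, v ≠ ρ → dep (π v) < dep v

variable {V : Type} {G : SimpleGraph V}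

/-- The parent of `v` is the penultimate vertex of the path from the root to `v`, and the depth is
the length of this path. -/
theorem SimpleGraph.IsTree.exists_isRooting (hG : G.IsTree) (ρ : V) :
    ∃ π dep, IsRooting G ρ π dep := by
  choose p hp using fun v => (hG.existsUnique_path ρ v).exists
  have hnil : p ρ = .nil := (hG.existsUnique_path ρ ρ).unique (hp ρ) .nil
  have hnn : ∀ v, v ≠ ρ → ¬ (p v).Nil := fun v hv h => hv h.eq.symm
  have hpen : ∀ u v, G.Adj v u → u ∈ (p v).support → (p v).penultimate = u ∧ v ≠ ρ := by
    intro u v hadj hu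
    refine ⟨(hG.isAcyclic.eq_penultimate_of_adj_end (hp v) hadj hu).symm, ?_⟩
    rintro rfl
    rw [hnil] at hu
    simp only [SimpleGraph.Walk.support_nil, List.mem_singleton] at hu
    exact hadj.ne hu.symm
  refine ⟨fun v => (p v).penultimate, fun v => (p v).length, ?_, fun u v => ⟨fun h => ?_, ?_⟩, ?_⟩
  · rw [hnil]
    rfl
  · by_cases hv : v ∈ (p u).support
    · exact Or.inl (hpen v u h hv)
    · refine Or.inr (hpen u v h.symm ?_)
      exact hG.isAcyclic.mem_support_of_ne_mem_support_of_adj_of_isPath (hp v) (hp u) h.symm hv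
  · rintro (⟨h, hne⟩ | ⟨h, hne⟩)
    · rw [← h]
      exact (SimpleGraph.Walk.adj_penultimate (hnn u hne)).symm
    · rw [← h]
      exact SimpleGraph.Walk.adj_penultimate (hnn v hne)
  · intro v hv
    have h := hG.isAcyclic.path_concat (hp (p v).penultimate) (hp v)
      (SimpleGraph.Walk.adj_penultimate (hnn v hv)) ((p v).getVert_mem_support _)
    have := congrArg SimpleGraph.Walk.length h
    rw [SimpleGraph.Walk.length_concat] at this
    show (p (p v).penultimate).length < (p v).length
    omega

/-- `u` is `v` or one of the ancestors of `v`. -/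
def IsAncestor (π : V → V) (u v : V) : Prop := ∃ m : ℕ, π^[m] v = u

theorem IsAncestor.refl (π : V → V) (v : V) : IsAncestor π v v := ⟨0, rfl⟩

theorem IsAncestor.trans {π : V → V} {u v w : V} (h : IsAncestor π u v) (h' : IsAncestor π v w) :
    IsAncestor π u w := by
  obtain ⟨a, rfl⟩ := h
  obtain ⟨b, rfl⟩ := h'
  exact ⟨a + b, Function.iterate_add_apply π a b w⟩

theorem IsAncestor.parent (π : V → V) (v : V) : IsAncestor π (π v) v := ⟨1, rfl⟩

theorem IsAncestor.total {π : V → V} {u v w : V} (h : IsAncestor π u w) (h' : IsAncestor π v w) :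
    IsAncestor π u v ∨ IsAncestor π v u := by
  obtain ⟨a, rfl⟩ := h
  obtain ⟨b, rfl⟩ := h'
  rcases le_total a b with hab | hab
  · refine Or.inr ⟨b - a, ?_⟩
    rw [← Function.iterate_add_apply, Nat.sub_add_cancel hab]
  · refine Or.inl ⟨a - b, ?_⟩
    rw [← Function.iterate_add_apply, Nat.sub_add_cancel hab]

theorem isAncestor_iff {π : V → V} {u v : V} :
    IsAncestor π u v ↔ v = u ∨ IsAncestor π u (π v) := by
  constructor
  · rintro ⟨m, hm⟩
    cases m with
    | zero => exact Or.inl hm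
    | succ m => exact Or.inr ⟨m, hm⟩
  · rintro (rfl | ⟨m, hm⟩)
    · exact IsAncestor.refl _ _
    · exact ⟨m + 1, hm⟩

namespace IsRooting

variable {ρ : V} {π : V → V} {dep : V → ℕ}

theorem eq_or_dep_lt (H : IsRooting G ρ π dep) {u v : V} (h : IsAncestor π u v) :
    u = v ∨ dep u < dep v := by
  obtain ⟨m, rfl⟩ := h
  induction m generalizing v with
  | zero => exact Or.inl rfl
  | succ m ih =>
    rw [Function.iterate_succ_apply]
    by_cases hv : v = ρ
    · have := ih (v := ρ)
      rw [hv, H.root]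
      exact this
    · have h1 := H.dep_lt v hv
      rcases ih (v := π v) with h | h
      · rw [h]
        exact Or.inr h1
      · exact Or.inr (h.trans h1)

theorem antisymm (H : IsRooting G ρ π dep) {u v : V} (h : IsAncestor π u v)
    (h' : IsAncestor π v u) : u = v := by
  rcases H.eq_or_dep_lt h with h1 | h1
  · exact h1
  · rcases H.eq_or_dep_lt h' with h2 | h2
    · exact h2.symm
    · omega

theorem adj_parent (H : IsRooting G ρ π dep) {v : V} (hv : v ≠ ρ) : G.Adj (π v) v :=
  (H.adj_iff _ _).2 (Or.inr ⟨rfl, hv⟩)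

theorem isAncestor_root (H : IsRooting G ρ π dep) (v : V) : IsAncestor π ρ v := by
  induction hm : dep v using Nat.strong_induction_on generalizing v with
  | _ m ih =>
  by_cases hv : v = ρ
  · rw [hv]; exact IsAncestor.refl _ _
  · exact (ih _ (hm ▸ H.dep_lt v hv) _ rfl).trans (IsAncestor.parent π v)

/-- Following parents connects every vertex to the root, and sending a vertex to the edge above it
maps the vertices other than the root onto the edges, so there are few enough edges. -/
theorem isTree [Finite V] (H : IsRooting G ρ π dep) : G.IsTree := by
  have := Fintype.ofFinite V
  classical
  have hconn : G.Connected := by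
    have hr : ∀ v, G.Reachable ρ v := by
      intro v
      induction hm : dep v using Nat.strong_induction_on generalizing v with
      | _ m ih =>
      by_cases hv : v = ρ
      · rw [hv]
      · exact (ih _ (hm ▸ H.dep_lt v hv) _ rfl).trans (H.adj_parent hv).reachable
    have : Nonempty V := ⟨ρ⟩
    exact ⟨fun u v => (hr u).symm.trans (hr v)⟩
  refine SimpleGraph.isTree_iff_connected_and_card.2 ⟨hconn, le_antisymm ?_
    hconn.card_vert_le_card_edgeSet_add_one⟩
  have hsurj : Function.Surjective
      (fun v : {v : V // v ≠ ρ} => (⟨s(π v.1, v.1), G.mem_edgeSet.2 (H.adj_parent v.2)⟩ : G.edgeSet)) := by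
    rintro ⟨e, he⟩
    induction e using Sym2.ind with
    | _ u v =>
    rcases (H.adj_iff u v).1 he with ⟨h, hne⟩ | ⟨h, hne⟩
    · exact ⟨⟨u, hne⟩, Subtype.ext (h ▸ Sym2.eq_swap)⟩
    · exact ⟨⟨v, hne⟩, Subtype.ext (h ▸ rfl)⟩
  have h1 : Nat.card G.edgeSet ≤ _ := Nat.card_le_card_of_surjective _ hsurj
  have h2 : Nat.card {v : V // v ≠ ρ} < Nat.card V := by
    rw [Nat.card_eq_fintype_card, Nat.card_eq_fintype_card]
    exact Fintype.card_subtype_lt (x := ρ) (by simp)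
  omega

/-- Being a descendant of `v` changes only along the edge from `v` to its parent. -/
theorem isAncestor_adj (H : IsRooting G ρ π dep) {v x y : V} (h : G.Adj x y)
    (hx : ¬ IsAncestor π v x) (hy : IsAncestor π v y) : x = π v ∧ y = v := by
  rcases (H.adj_iff x y).1 h with ⟨rfl, hne⟩ | ⟨rfl, hne⟩
  · exact absurd (hy.trans (IsAncestor.parent π x)) hx
  · rcases isAncestor_iff.1 hy with rfl | h'
    · exact ⟨rfl, rfl⟩
    · exact absurd h' hx

theorem not_isAncestor_parent (H : IsRooting G ρ π dep) {v : V} (hv : v ≠ ρ) :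
    ¬ IsAncestor π v (π v) := fun h => by
  rcases H.eq_or_dep_lt h with h | h
  · have := H.dep_lt v hv
    rw [← h] at this
    omega
  · have := H.dep_lt v hv
    omega

end IsRooting

/-- A trail crosses a dart `(a, b)` if a property that changes only along the edge `ab` fails at
its beginning and holds at its end. -/
theorem SimpleGraph.Walk.IsTrail.mem_darts_iff {f : V → Prop} {d : G.Dart} (hfst : ¬ f d.fst)
    (hsnd : f d.snd) (hf : ∀ x y, G.Adj x y → ¬ f x → f y → x = d.fst ∧ y = d.snd) {x y : V}
    {p : G.Walk x y} (hp : p.IsTrail) : d ∈ p.darts ↔ ¬ f x ∧ f y := by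
  -- The property cannot change along a walk avoiding the edge of `d`. A trail uses this edge at
  -- most once, so the rest of it does not undo the change.
  have hconst : ∀ {x y : V} (p : G.Walk x y), d.edge ∉ p.edges → (f x ↔ f y) := by
    intro x y p
    induction p with
    | nil => exact fun _ => Iff.rfl
    | @cons u v w h p ih =>
      intro hd
      simp only [SimpleGraph.Walk.edges_cons, List.mem_cons, not_or] at hd
      rw [← ih hd.2]
      by_contra hne
      rw [not_iff] at hne
      by_cases hu : f u
      · obtain ⟨h1, h2⟩ := hf v u h.symm (fun hv => hne.2 hv hu) hu
        exact hd.1 (by rw [SimpleGraph.Dart.edge, h1, h2]; exact Sym2.eq_swap)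
      · obtain ⟨h1, h2⟩ := hf u v h hu (hne.1 hu)
        exact hd.1 (by rw [SimpleGraph.Dart.edge, h1, h2])
  constructor
  · intro hd
    induction p with
    | nil => simp at hd
    | @cons u v w h p ih =>
      obtain ⟨hp', he⟩ := (SimpleGraph.Walk.isTrail_cons h p).1 hp
      rcases List.mem_cons.1 hd with rfl | hd
      · exact ⟨hfst, (hconst p he).1 hsnd⟩
      · obtain ⟨h1, h2⟩ := ih hp' hd
        refine ⟨fun hu => ?_, h2⟩
        obtain ⟨h3, h4⟩ := hf v u h.symm h1 hu
        refine he ?_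
        have : s(u, v) = d.edge := by rw [SimpleGraph.Dart.edge, h3, h4]; exact Sym2.eq_swap
        rw [this]
        exact List.mem_map_of_mem hd
  · rintro ⟨hx, hy⟩
    obtain ⟨d', hd', h1, h2⟩ := p.exists_boundary_dart {z | ¬ f z} hx (fun h => h hy)
    obtain ⟨h3, h4⟩ := hf d'.fst d'.snd d'.adj h1 (not_not.1 h2)
    have : d' = d := SimpleGraph.Dart.ext _ _ (Prod.ext h3 h4)
    exact this ▸ hd'

end Rooting

/-! ## The clusters of a rooted marked tree -/

section LeafCluster

variable {n : ℕ}

/-- `A` separates `i, k` from `j, l`. -/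
def Splits (A : Finset (Fin n)) (i j k l : Fin n) : Prop :=
  (i ∈ A ∧ j ∉ A ∧ k ∈ A ∧ l ∉ A) ∨ (i ∉ A ∧ j ∈ A ∧ k ∉ A ∧ l ∈ A)

open Classical in
/-- The markings of the leaves that are descendants of `v`. -/
noncomputable def MarkedTree.leafCluster (Γ : MarkedTree n) (π : Fin Γ.size → Fin Γ.size)
    (v : Fin Γ.size) : Finset (Fin n) :=
  {i | IsAncestor π v (Γ.leaf i)}

open Classical in
/-- The length of the edge from `u` to `v`. -/
noncomputable def TreeCells.edgeLength (S : TreeCells n) (u v : Fin S.1.size) : ℝ≥0∞ :=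
  if h : S.1.graph.Adj u v then S.2.1 ⟨s(u, v), h⟩ else 0

theorem TreeCells.edgeLength_of_adj (S : TreeCells n) {u v : Fin S.1.size}
    (h : S.1.graph.Adj u v) : S.edgeLength u v = S.2.1 ⟨s(u, v), h⟩ := dif_pos h

theorem MarkedTree.mem_leafCluster (Γ : MarkedTree n) {π : Fin Γ.size → Fin Γ.size}
    {v : Fin Γ.size} {i : Fin n} : i ∈ Γ.leafCluster π v ↔ IsAncestor π v (Γ.leaf i) := by
  simp [MarkedTree.leafCluster]

namespace IsRooting

variable {Γ : MarkedTree n} {r : Fin n} {π : Fin Γ.size → Fin Γ.size} {dep : Fin Γ.size → ℕ}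

theorem leafCluster_mono {u v : Fin Γ.size} (h : IsAncestor π u v) :
    Γ.leafCluster π v ⊆ Γ.leafCluster π u := fun _ hi =>
  Γ.mem_leafCluster.2 (h.trans (Γ.mem_leafCluster.1 hi))

theorem leafCluster_compatible (u v : Fin Γ.size) :
    Compatible (Γ.leafCluster π u) (Γ.leafCluster π v) := by
  by_cases h : Disjoint (Γ.leafCluster π u) (Γ.leafCluster π v)
  · exact Or.inl h
  · obtain ⟨i, hu, hv⟩ := Finset.not_disjoint_iff.1 h
    rcases (Γ.mem_leafCluster.1 hu).total (Γ.mem_leafCluster.1 hv) with h | h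
    · exact Or.inr (Or.inr (leafCluster_mono h))
    · exact Or.inr (Or.inl (leafCluster_mono h))

variable (H : IsRooting Γ.graph (Γ.leaf r) π dep)
include H

theorem root_mem_leafCluster {v : Fin Γ.size} : r ∈ Γ.leafCluster π v ↔ v = Γ.leaf r := by
  rw [Γ.mem_leafCluster]
  constructor
  · intro h
    exact H.antisymm h (H.isAncestor_root v)
  · rintro rfl
    exact IsAncestor.refl _ _

/-- Being a descendant of `v` changes only along the edge above `v`, so the endpoints of a path
decide whether it crosses this edge and in which direction. -/
theorem mem_darts_path_down {v : Fin Γ.size} (hv : v ≠ Γ.leaf r) {d : Γ.graph.Dart}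
    (h1 : d.fst = π v) (h2 : d.snd = v) (i j : Fin n) :
    d ∈ (Γ.path i j).darts ↔ i ∉ Γ.leafCluster π v ∧ j ∈ Γ.leafCluster π v := by
  rw [Γ.mem_leafCluster, Γ.mem_leafCluster]
  refine SimpleGraph.Walk.IsTrail.mem_darts_iff (f := fun x => IsAncestor π v x) ?_ ?_ ?_
    (Γ.path_isPath i j).isTrail
  · rw [h1]; exact H.not_isAncestor_parent hv
  · rw [h2]; exact IsAncestor.refl _ _
  · intro x y h hx hy
    rw [h1, h2]
    exact H.isAncestor_adj h hx hy

theorem mem_darts_path_up {v : Fin Γ.size} (hv : v ≠ Γ.leaf r) {d : Γ.graph.Dart}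
    (h1 : d.fst = v) (h2 : d.snd = π v) (i j : Fin n) :
    d ∈ (Γ.path i j).darts ↔ i ∈ Γ.leafCluster π v ∧ j ∉ Γ.leafCluster π v := by
  rw [Γ.mem_leafCluster, Γ.mem_leafCluster]
  have := SimpleGraph.Walk.IsTrail.mem_darts_iff (f := fun x => ¬ IsAncestor π v x) (d := d) ?_ ?_
    ?_ (Γ.path_isPath i j).isTrail
  · rw [this, not_not]
  · rw [h1, not_not]; exact IsAncestor.refl _ _
  · rw [h2]; exact H.not_isAncestor_parent hv
  · intro x y h hx hy
    rw [h1, h2]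
    exact (H.isAncestor_adj h.symm hy (not_not.1 hx)).symm

/-- A leaf other than the root has its own parent as only neighbour; a child would be a second one,
of larger depth. -/
theorem parent_ne_leaf {i : Fin n} (hi : i ≠ r) {v : Fin Γ.size} (hv : v ≠ Γ.leaf r) :
    π v ≠ Γ.leaf i := by
  intro he
  have hir : Γ.leaf i ≠ Γ.leaf r := fun e => hi (Γ.leaf_injective e)
  obtain ⟨a, ha⟩ := Set.ncard_eq_one.1 (Γ.valence_leaf i)
  have h1 : v ∈ Γ.graph.neighborSet (Γ.leaf i) := by
    rw [← he]; exact H.adj_parent hv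
  have h2 : π (Γ.leaf i) ∈ Γ.graph.neighborSet (Γ.leaf i) := (H.adj_parent hir).symm
  rw [ha, Set.mem_singleton_iff] at h1 h2
  have h3 := H.dep_lt v hv
  have h4 := H.dep_lt _ hir
  rw [he] at h3
  rw [h2, ← h1] at h4
  omega

theorem eq_of_parent_eq_root {u v : Fin Γ.size} (hu : u ≠ Γ.leaf r) (hv : v ≠ Γ.leaf r)
    (hπu : π u = Γ.leaf r) (hπv : π v = Γ.leaf r) : u = v := by
  obtain ⟨a, ha⟩ := Set.ncard_eq_one.1 (Γ.valence_leaf r)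
  have h1 : u ∈ Γ.graph.neighborSet (Γ.leaf r) := hπu ▸ H.adj_parent hu
  have h2 : v ∈ Γ.graph.neighborSet (Γ.leaf r) := hπv ▸ H.adj_parent hv
  rw [ha, Set.mem_singleton_iff] at h1 h2
  rw [h1, h2]

theorem exists_child {u v : Fin Γ.size} (h : IsAncestor π u v) (hne : v ≠ u) :
    ∃ w, w ≠ Γ.leaf r ∧ π w = u ∧ IsAncestor π w v := by
  obtain ⟨m, hm⟩ := h
  induction m generalizing u with
  | zero => exact absurd hm hne
  | succ m ih =>
    rw [Function.iterate_succ_apply'] at hm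
    by_cases hr : π^[m] v = Γ.leaf r
    · rw [hr, H.root] at hm
      rw [← hm] at hne ⊢
      exact ih hne hr
    · exact ⟨_, hr, hm, m, rfl⟩

theorem leafCluster_leaf {i : Fin n} (hi : i ≠ r) : Γ.leafCluster π (Γ.leaf i) = {i} := by
  ext j
  rw [Γ.mem_leafCluster, Finset.mem_singleton]
  constructor
  · intro h
    by_contra hne
    obtain ⟨w, hw, he, -⟩ := H.exists_child h (fun e => hne (Γ.leaf_injective e))
    exact H.parent_ne_leaf hi hw he
  · rintro rfl
    exact IsAncestor.refl _ _

theorem leafCluster_root : Γ.leafCluster π (Γ.leaf r) = Finset.univ := by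
  ext j
  simp only [Γ.mem_leafCluster, Finset.mem_univ, iff_true]
  exact H.isAncestor_root _

theorem exists_two_children {u : Fin Γ.size} (hu : u ∉ Set.range Γ.leaf) :
    ∃ a b, a ≠ b ∧ a ≠ Γ.leaf r ∧ b ≠ Γ.leaf r ∧ π a = u ∧ π b = u := by
  have hchild : ∀ a ∈ Γ.graph.neighborSet u, a ≠ π u → a ≠ Γ.leaf r ∧ π a = u := by
    intro a ha hne
    rcases (H.adj_iff u a).1 ha with ⟨h, -⟩ | ⟨h, h'⟩
    · exact absurd h.symm hne
    · exact ⟨h', h⟩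
  obtain ⟨a, b, c, ha, hb, hc, hab, hac, hbc⟩ :=
    (Set.two_lt_ncard_iff (Set.toFinite _)).1 (Γ.valence_inner u hu)
  by_cases h1 : a = π u
  · have hb' : b ≠ π u := fun e => hab (h1.trans e.symm)
    have hc' : c ≠ π u := fun e => hac (h1.trans e.symm)
    exact ⟨b, c, hbc, (hchild b hb hb').1, (hchild c hc hc').1, (hchild b hb hb').2,
      (hchild c hc hc').2⟩
  · by_cases h2 : b = π u
    · have hc' : c ≠ π u := fun e => hbc (h2.trans e.symm)
      exact ⟨a, c, hac, (hchild a ha h1).1, (hchild c hc hc').1, (hchild a ha h1).2,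
        (hchild c hc hc').2⟩
    · exact ⟨a, b, hab, (hchild a ha h1).1, (hchild b hb h2).1, (hchild a ha h1).2,
        (hchild b hb h2).2⟩

theorem leafCluster_nonempty (v : Fin Γ.size) : (Γ.leafCluster π v).Nonempty := by
  -- Induction towards the leaves: on a finite set the relation of having larger depth is well
  -- founded.
  have hwf : WellFounded fun a b : Fin Γ.size => dep b < dep a :=
    @Finite.wellFounded_of_trans_of_irrefl _ _ (fun a b : Fin Γ.size => dep b < dep a)
      ⟨fun _ _ _ h h' => h'.trans h⟩ ⟨fun _ h => lt_irrefl _ h⟩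
  induction v using hwf.induction with
  | _ v ih =>
  by_cases hv : v ∈ Set.range Γ.leaf
  · obtain ⟨i, rfl⟩ := hv
    exact ⟨i, Γ.mem_leafCluster.2 (IsAncestor.refl _ _)⟩
  · obtain ⟨a, -, -, ha, -, hπ, -⟩ := H.exists_two_children hv
    obtain ⟨i, hi⟩ := ih a (hπ ▸ H.dep_lt a ha)
    exact ⟨i, leafCluster_mono (hπ ▸ IsAncestor.parent π a) hi⟩

/-- Distinct vertices with a common descendant are comparable. The upper one, if it is not a leaf,
has at least two children because of its valence, so some leaf lies below it but not below the lower
one. -/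
theorem leafCluster_injective : Function.Injective (Γ.leafCluster π) := by
  have key : ∀ u v, IsAncestor π u v → Γ.leafCluster π u = Γ.leafCluster π v → u = v := by
    intro u v huv he
    by_contra hne
    obtain ⟨a, ha, hπa, hav⟩ := H.exists_child huv (Ne.symm hne)
    have hsub : Γ.leafCluster π u ⊆ Γ.leafCluster π a := he ▸ leafCluster_mono hav
    by_cases hu : u ∈ Set.range Γ.leaf
    · obtain ⟨i, rfl⟩ := hu
      by_cases hi : i = r
      · subst hi
        exact ha (H.root_mem_leafCluster.1 (hsub (H.root_mem_leafCluster.2 rfl)))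
      · exact H.parent_ne_leaf hi ha hπa
    · have hex : ∃ b, b ≠ a ∧ b ≠ Γ.leaf r ∧ π b = u := by
        obtain ⟨b, c, hbc, hb, hc, hπb, hπc⟩ := H.exists_two_children hu
        by_cases hba : b = a
        · exact ⟨c, fun e => hbc (hba.trans e.symm), hc, hπc⟩
        · exact ⟨b, hba, hb, hπb⟩
      obtain ⟨b, hba, hb, hπb⟩ := hex
      obtain ⟨j, hj⟩ := H.leafCluster_nonempty b
      have hja := hsub (leafCluster_mono (hπb ▸ IsAncestor.parent π b) hj)
      have hda := H.dep_lt a ha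
      have hdb := H.dep_lt b hb
      have hanc : ∀ x y, x ≠ y → π x = u → π y = u → x ≠ Γ.leaf r → ¬ IsAncestor π x y := by
        intro x y hxy hx hy hxr h
        rcases isAncestor_iff.1 h with h | h
        · exact hxy h.symm
        · rw [hy, ← hx] at h
          exact H.not_isAncestor_parent hxr h
      rcases (Γ.mem_leafCluster.1 hj).total (Γ.mem_leafCluster.1 hja) with h | h
      · exact hanc b a hba hπb hπa hb h
      · exact hanc a b hba.symm hπa hπb ha h
  intro u v he
  obtain ⟨i, hi⟩ := H.leafCluster_nonempty u
  have hiv := he ▸ hi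
  rcases (Γ.mem_leafCluster.1 hi).total (Γ.mem_leafCluster.1 hiv) with h | h
  · exact key u v h he
  · exact (key v u h he.symm).symm

theorem isAncestor_iff_leafCluster {u v : Fin Γ.size} :
    IsAncestor π u v ↔ Γ.leafCluster π v ⊆ Γ.leafCluster π u := by
  refine ⟨leafCluster_mono, fun h => ?_⟩
  obtain ⟨i, hi⟩ := H.leafCluster_nonempty v
  rcases (Γ.mem_leafCluster.1 hi).total (Γ.mem_leafCluster.1 (h hi)) with h' | h'
  · rw [H.leafCluster_injective (Finset.Subset.antisymm h (leafCluster_mono h'))]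
    exact IsAncestor.refl _ _
  · exact h'

theorem leafCluster_of_parent_root {v : Fin Γ.size} (hv : v ≠ Γ.leaf r) (hπ : π v = Γ.leaf r) :
    Γ.leafCluster π v = Finset.univ.erase r := by
  ext j
  rw [Γ.mem_leafCluster, Finset.mem_erase]
  constructor
  · intro h
    refine ⟨?_, Finset.mem_univ j⟩
    rintro rfl
    exact hv (H.root_mem_leafCluster.1 (Γ.mem_leafCluster.2 h))
  · rintro ⟨hj, -⟩
    obtain ⟨w, hw, hπw, h⟩ := H.exists_child (H.isAncestor_root (Γ.leaf j))
      fun e => hj (Γ.leaf_injective e)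
    rwa [H.eq_of_parent_eq_root hv hw hπ hπw]

/-- The clusters in the strict sense belong to the bounded edges, those with no leaf at either end;
the next lemma treats the leaf edges. -/
theorem isCluster_leafCluster {v : Fin Γ.size} (hv : v ≠ Γ.leaf r) (h : ∀ i, Γ.leaf i ≠ v)
    (h' : π v ≠ Γ.leaf r) : IsCluster r (Γ.leafCluster π v) := by
  have hr : r ∉ Γ.leafCluster π v := fun hr => hv (H.root_mem_leafCluster.1 hr)
  refine ⟨hr, ?_, fun he => ?_⟩
  · by_contra hlt
    have h1 := Finset.card_pos.2 (H.leafCluster_nonempty v)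
    obtain ⟨i, hi⟩ := Finset.card_eq_one.1 (show (Γ.leafCluster π v).card = 1 by omega)
    have hir : i ≠ r := by
      rintro rfl
      exact hr (hi ▸ Finset.mem_singleton_self _)
    rw [← H.leafCluster_leaf hir] at hi
    exact h i (H.leafCluster_injective hi).symm
  · have hsub : Γ.leafCluster π (π v) ⊆ Γ.leafCluster π v := by
      rw [he]
      intro j hj
      refine Finset.mem_erase.2 ⟨?_, Finset.mem_univ j⟩
      rintro rfl
      exact h' (H.root_mem_leafCluster.1 hj)
    exact H.not_isAncestor_parent hv (H.isAncestor_iff_leafCluster.2 hsub)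

theorem not_isCluster_leafCluster {v : Fin Γ.size} (hv : v ≠ Γ.leaf r) {i : Fin n}
    (h : Γ.leaf i = v ∨ Γ.leaf i = π v) : ¬ IsCluster r (Γ.leafCluster π v) := by
  rintro ⟨h1, h2, h3⟩
  rcases h with rfl | h
  · rw [H.leafCluster_leaf fun e => hv (e ▸ rfl)] at h2
    simp at h2
  · by_cases hi : i = r
    · subst hi
      exact h3 (H.leafCluster_of_parent_root hv h.symm)
    · exact H.parent_ne_leaf hi hv h.symm

end IsRooting

namespace TreeCells

variable {S : TreeCells n} {r : Fin n} {π : Fin S.1.size → Fin S.1.size} {dep : Fin S.1.size → ℕ}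

-- A non-root vertex stands for the edge above it. Both paths run along this edge in the same
-- direction exactly when its cluster splits the markings accordingly, and whether `j` lies below
-- selects one of the two darts.
open Classical in
theorem overlap_eq_sum (H : IsRooting S.1.graph (S.1.leaf r) π dep) (i j k l : Fin n) :
    S.overlap i j k l = ∑ v with v ≠ S.1.leaf r ∧ Splits (S.1.leafCluster π v) i j k l,
      S.edgeLength (π v) v := by
  unfold overlap
  symm
  refine Finset.sum_bij (fun v hv => if j ∈ S.1.leafCluster π v then
    ⟨(π v, v), H.adj_parent (Finset.mem_filter.1 hv).2.1⟩ else
    ⟨(v, π v), (H.adj_parent (Finset.mem_filter.1 hv).2.1).symm⟩) ?_ ?_ ?_ ?_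
  · intro v hv
    obtain ⟨-, hne, h⟩ := Finset.mem_filter.1 hv
    refine Finset.mem_filter.2 ⟨Finset.mem_univ _, ?_⟩
    by_cases hj : j ∈ S.1.leafCluster π v
    · rw [if_pos hj, H.mem_darts_path_down hne rfl rfl, H.mem_darts_path_down hne rfl rfl]
      rcases h with h | h
      · exact absurd hj h.2.1
      · exact ⟨⟨h.1, hj⟩, h.2.2⟩
    · rw [if_neg hj, H.mem_darts_path_up hne rfl rfl, H.mem_darts_path_up hne rfl rfl]
      rcases h with h | h
      · exact ⟨⟨h.1, hj⟩, h.2.2⟩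
      · exact absurd h.2.1 hj
  · intro v hv v' hv' he
    have h1 := H.dep_lt v (Finset.mem_filter.1 hv).2.1
    have h2 := H.dep_lt v' (Finset.mem_filter.1 hv').2.1
    have he' := congrArg SimpleGraph.Dart.toProd he
    split_ifs at he' with a b b <;> simp only [Prod.mk.injEq] at he'
    · exact he'.2
    · rw [he'.1] at h1
      rw [← he'.2] at h2
      omega
    · rw [he'.2] at h1
      rw [← he'.1] at h2
      omega
    · exact he'.1
  · intro d hd
    obtain ⟨-, h1, h2⟩ := Finset.mem_filter.1 hd
    rcases (H.adj_iff d.fst d.snd).1 d.adj with ⟨h, hne⟩ | ⟨h, hne⟩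
    · rw [H.mem_darts_path_up hne rfl h.symm] at h1 h2
      refine ⟨d.fst, Finset.mem_filter.2 ⟨Finset.mem_univ _, hne, Or.inl ⟨h1.1, h1.2, h2⟩⟩, ?_⟩
      rw [if_neg h1.2]
      exact SimpleGraph.Dart.ext _ _ (Prod.ext rfl h)
    · rw [H.mem_darts_path_down hne h.symm rfl] at h1 h2
      refine ⟨d.snd, Finset.mem_filter.2 ⟨Finset.mem_univ _, hne, Or.inr ⟨h1.1, h1.2, h2⟩⟩, ?_⟩
      rw [if_pos h1.2]
      exact SimpleGraph.Dart.ext _ _ (Prod.ext h rfl)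
  · intro v hv
    have hadj := H.adj_parent (Finset.mem_filter.1 hv).2.1
    rw [edgeLength_of_adj _ hadj]
    refine congrArg S.2.1 (Subtype.ext ?_)
    dsimp only
    split_ifs with hj
    · rfl
    · exact Sym2.eq_swap

open Classical in
/-- The total length of the bounded edges separating `A` from the other markings. -/
noncomputable def clusterWeight (S : TreeCells n) (r : Fin n) (π : Fin S.1.size → Fin S.1.size)
    (A : Finset (Fin n)) : ℝ≥0∞ :=
  if IsCluster r A then ∑ v with v ≠ S.1.leaf r ∧ S.1.leafCluster π v = A,
    S.edgeLength (π v) v else 0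

theorem isLaminar_clusterWeight [DecidablePred fun A => S.clusterWeight r π A ≠ 0] :
    IsLaminar r ({A | S.clusterWeight r π A ≠ 0} : Finset (Finset (Fin n))) := by
  have hex : ∀ A, S.clusterWeight r π A ≠ 0 → IsCluster r A ∧ ∃ v, S.1.leafCluster π v = A := by
    intro A hA
    unfold clusterWeight at hA
    split_ifs at hA with h
    · obtain ⟨v, hv, -⟩ := Finset.exists_ne_zero_of_sum_ne_zero hA
      exact ⟨h, v, (Finset.mem_filter.1 hv).2.2⟩
    · exact absurd rfl hA
  refine ⟨fun A hA => (hex A (Finset.mem_filter.1 hA).2).1, fun A hA B hB => ?_⟩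
  obtain ⟨-, u, rfl⟩ := hex A (Finset.mem_filter.1 hA).2
  obtain ⟨-, v, rfl⟩ := hex B (Finset.mem_filter.1 hB).2
  exact IsRooting.leafCluster_compatible u v

theorem clusterWeight_leafCluster (H : IsRooting S.1.graph (S.1.leaf r) π dep)
    {v : Fin S.1.size} (hv : v ≠ S.1.leaf r) (hc : IsCluster r (S.1.leafCluster π v)) :
    S.clusterWeight r π (S.1.leafCluster π v) = S.edgeLength (π v) v := by
  classical
  rw [clusterWeight, if_pos hc, Finset.sum_eq_single_of_mem v]
  · exact Finset.mem_filter.2 ⟨Finset.mem_univ _, hv, rfl⟩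
  · intro u hu hne
    exact absurd (H.leafCluster_injective (Finset.mem_filter.1 hu).2.2) hne

theorem edgeLength_of_not_isCluster (H : IsRooting S.1.graph (S.1.leaf r) π dep)
    {v : Fin S.1.size} (hv : v ≠ S.1.leaf r) (hc : ¬ IsCluster r (S.1.leafCluster π v)) :
    S.edgeLength (π v) v = ⊤ := by
  rw [edgeLength_of_adj _ (H.adj_parent hv)]
  by_cases h : ∃ i, S.1.leaf i = v ∨ S.1.leaf i = π v
  · obtain ⟨i, hi⟩ := h
    refine S.2.2 _ i ?_
    rcases hi with hi | hi
    · exact Sym2.mem_iff.2 (Or.inr hi)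
    · exact Sym2.mem_iff.2 (Or.inl hi)
  · push Not at h
    exact absurd (H.isCluster_leafCluster hv (fun i => (h i).1) (Ne.symm (h r).2)) hc

-- Edges are grouped by cluster. As `i ≠ k` and `j ≠ l`, a splitting set has two markings on either
-- side, so the infinite leaf edges never enter.
open Classical in
theorem overlap_eq_sum_clusterWeight (H : IsRooting S.1.graph (S.1.leaf r) π dep)
    {i j k l : Fin n} (hik : i ≠ k) (hjl : j ≠ l) : S.overlap i j k l =
      ∑ A with Splits A i j k l, S.clusterWeight r π A := by
  rw [overlap_eq_sum H, ← Finset.sum_fiberwise _ (S.1.leafCluster π), Finset.sum_filter]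
  refine Finset.sum_congr rfl fun A _ => ?_
  split_ifs with hA
  · rw [clusterWeight, Finset.filter_filter]
    have hfilter : ∀ v, ((v ≠ S.1.leaf r ∧ Splits (S.1.leafCluster π v) i j k l) ∧
        S.1.leafCluster π v = A) ↔ v ≠ S.1.leaf r ∧ S.1.leafCluster π v = A := by
      intro v
      constructor
      · rintro ⟨⟨h1, -⟩, h2⟩
        exact ⟨h1, h2⟩
      · rintro ⟨h1, rfl⟩
        exact ⟨⟨h1, hA⟩, rfl⟩
    simp only [hfilter]
    split_ifs with hc
    · rfl
    · refine Finset.sum_eq_zero fun v hv => ?_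
      obtain ⟨-, h1, rfl⟩ := Finset.mem_filter.1 hv
      refine absurd ⟨fun hr => h1 (H.root_mem_leafCluster.1 hr), ?_, fun he => ?_⟩ hc
      · rcases hA with hA | hA
        · exact Finset.one_lt_card.2 ⟨i, hA.1, k, hA.2.2.1, hik⟩
        · exact Finset.one_lt_card.2 ⟨j, hA.2.1, l, hA.2.2.2, hjl⟩
      · have hX : ∀ x, x ∉ S.1.leafCluster π v → x = r := by
          intro x hx
          by_contra hne
          exact hx (he ▸ Finset.mem_erase.2 ⟨hne, Finset.mem_univ x⟩)
        rcases hA with hA | hA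
        · exact hjl ((hX j hA.2.1).trans (hX l hA.2.2.2).symm)
        · exact hik ((hX i hA.1).trans (hX k hA.2.2.1).symm)
  · refine Finset.sum_eq_zero fun v hv => ?_
    obtain ⟨hv', rfl⟩ := Finset.mem_filter.1 hv
    exact absurd (Finset.mem_filter.1 hv').2.2 hA

end TreeCells

end LeafCluster

/-! ## Contraction onto the tree of a weighted laminar family -/

section Contraction

variable {n : ℕ}

theorem TreeCells.edgeLength_comm (S : TreeCells n) (u v : Fin S.1.size) :
    S.edgeLength u v = S.edgeLength v u := by
  by_cases h : S.1.graph.Adj u v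
  · rw [edgeLength_of_adj S h, edgeLength_of_adj S h.symm]
    exact congrArg S.2.1 (Subtype.ext Sym2.eq_swap)
  · rw [edgeLength, edgeLength, dif_neg h, dif_neg fun h' => h h'.symm]

namespace IsRooting

variable {r : Fin n}

theorem parent_subset_of_ssubset {Γ : MarkedTree n} {π : Fin Γ.size → Fin Γ.size}
    {dep : Fin Γ.size → ℕ} (H : IsRooting Γ.graph (Γ.leaf r) π dep) {u v : Fin Γ.size}
    (h : Γ.leafCluster π v ⊂ Γ.leafCluster π u) :
    Γ.leafCluster π (π v) ⊆ Γ.leafCluster π u := by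
  rcases isAncestor_iff.1 (H.isAncestor_iff_leafCluster.2 h.1) with he | he
  · exact absurd (he ▸ h) (ssubset_irrefl _)
  · exact leafCluster_mono he

theorem ssubset_parent {Γ : MarkedTree n} {π : Fin Γ.size → Fin Γ.size}
    {dep : Fin Γ.size → ℕ} (H : IsRooting Γ.graph (Γ.leaf r) π dep) {v : Fin Γ.size}
    (hv : v ≠ Γ.leaf r) : Γ.leafCluster π v ⊂ Γ.leafCluster π (π v) :=
  ⟨leafCluster_mono (IsAncestor.parent π v), fun h =>
    H.not_isAncestor_parent hv (H.isAncestor_iff_leafCluster.2 h)⟩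

variable {Γ Γ' : MarkedTree n} {π : Fin Γ.size → Fin Γ.size} {π' : Fin Γ'.size → Fin Γ'.size}
  {dep : Fin Γ.size → ℕ} {dep' : Fin Γ'.size → ℕ}

/-- The descendant sets that are not clusters are the full set, the singletons and the complement of
`r`; these occur in every tree. -/
theorem exists_leafCluster_eq (H : IsRooting Γ.graph (Γ.leaf r) π dep)
    (H' : IsRooting Γ'.graph (Γ'.leaf r) π' dep') (v : Fin Γ.size)
    (hc : ¬ IsCluster r (Γ.leafCluster π v)) :
    ∃ u, Γ'.leafCluster π' u = Γ.leafCluster π v := by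
  by_cases hv : v = Γ.leaf r
  · exact ⟨Γ'.leaf r, by rw [hv, H.leafCluster_root, H'.leafCluster_root]⟩
  by_cases hi : ∃ i, Γ.leaf i = v
  · obtain ⟨i, rfl⟩ := hi
    have hir : i ≠ r := fun e => hv (e ▸ rfl)
    exact ⟨Γ'.leaf i, by rw [H.leafCluster_leaf hir, H'.leafCluster_leaf hir]⟩
  · push Not at hi
    have hπ : π v = Γ.leaf r := by
      by_contra h
      exact hc (H.isCluster_leafCluster hv hi h)
    obtain ⟨j, hj⟩ := H.leafCluster_nonempty v
    have hjr : j ≠ r := by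
      rintro rfl
      exact hv (H.root_mem_leafCluster.1 hj)
    obtain ⟨w, hw, hπw, -⟩ := H'.exists_child (H'.isAncestor_root (Γ'.leaf j))
      fun e => hjr (Γ'.leaf_injective e)
    exact ⟨w, by rw [H.leafCluster_of_parent_root hv hπ, H'.leafCluster_of_parent_root hw hπw]⟩

/-- The sets in question share a leaf and hence form a chain, whose least element is found by
cardinality. -/
theorem exists_least_leafCluster (H : IsRooting Γ.graph (Γ.leaf r) π dep)
    (H' : IsRooting Γ'.graph (Γ'.leaf r) π' dep') (u : Fin Γ.size) :
    ∃ v, Γ.leafCluster π u ⊆ Γ'.leafCluster π' v ∧ ∀ v', Γ.leafCluster π u ⊆ Γ'.leafCluster π' v' →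
      Γ'.leafCluster π' v ⊆ Γ'.leafCluster π' v' := by
  classical
  obtain ⟨v, hv, hmin⟩ := Finset.exists_min_image
    (Finset.univ.filter fun v => Γ.leafCluster π u ⊆ Γ'.leafCluster π' v)
    (fun v => (Γ'.leafCluster π' v).card)
    ⟨Γ'.leaf r, Finset.mem_filter.2 ⟨Finset.mem_univ _, by
      rw [H'.leafCluster_root]; exact Finset.subset_univ _⟩⟩
  have hv := (Finset.mem_filter.1 hv).2
  refine ⟨v, hv, fun v' hv' => ?_⟩
  obtain ⟨i, hi⟩ := H.leafCluster_nonempty u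
  rcases (leafCluster_compatible v v').of_mem (hv hi) (hv' hi) with h | h
  · exact h
  · exact (Finset.eq_of_subset_of_card_le h
      (hmin v' (Finset.mem_filter.2 ⟨Finset.mem_univ _, hv'⟩))).superset

end IsRooting

/-- Trees with the same cluster weights contract onto the one without edges of length zero. -/
theorem exists_isContraction {S T : TreeCells n} {r : Fin n} {π : Fin S.1.size → Fin S.1.size}
    {dep : Fin S.1.size → ℕ} (H : IsRooting S.1.graph (S.1.leaf r) π dep)
    {π' : Fin T.1.size → Fin T.1.size} {dep' : Fin T.1.size → ℕ}
    (H' : IsRooting T.1.graph (T.1.leaf r) π' dep')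
    (hw : S.clusterWeight r π = T.clusterWeight r π')
    (hT : ∀ v, IsCluster r (T.1.leafCluster π' v) →
      T.clusterWeight r π' (T.1.leafCluster π' v) ≠ 0) : ∃ φ, IsContraction S T φ := by
  -- Every cluster of `T` has nonzero weight, hence occurs in `S`; the other descendant sets occur
  -- in all trees.
  have hrange : ∀ v, ∃ u, S.1.leafCluster π u = T.1.leafCluster π' v := by
    intro v
    by_cases hc : IsCluster r (T.1.leafCluster π' v)
    · have h := hT v hc
      rw [← hw, TreeCells.clusterWeight, if_pos hc] at h
      obtain ⟨u, hu, -⟩ := Finset.exists_ne_zero_of_sum_ne_zero h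
      exact ⟨u, (Finset.mem_filter.1 hu).2.2⟩
    · exact H'.exists_leafCluster_eq H v hc
  -- The contraction sends a vertex of `S` to the vertex of `T` with the least descendant set
  -- containing its own.
  choose φ hφ hmin using H.exists_least_leafCluster H'
  have heq : ∀ u v, T.1.leafCluster π' v = S.1.leafCluster π u → φ u = v := fun u v h =>
    H'.leafCluster_injective (Finset.Subset.antisymm (hmin u v h.superset) (h.subset.trans (hφ u)))
  have hleaf : ∀ i, φ (S.1.leaf i) = T.1.leaf i := by
    intro i
    refine heq _ _ ?_
    by_cases hi : i = r
    · rw [hi, H.leafCluster_root, H'.leafCluster_root]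
    · rw [H.leafCluster_leaf hi, H'.leafCluster_leaf hi]
  have hedge : ∀ u, u ≠ S.1.leaf r → (φ (π u) = φ u ∧ S.edgeLength (π u) u = 0) ∨
      (T.1.leafCluster π' (φ u) = S.1.leafCluster π u ∧ φ u ≠ T.1.leaf r ∧ φ (π u) = π' (φ u) ∧
        T.edgeLength (π' (φ u)) (φ u) = S.edgeLength (π u) u) := by
    intro u hu
    by_cases hex : ∃ v, T.1.leafCluster π' v = S.1.leafCluster π u
    · obtain ⟨v, hv⟩ := hex
      have hφu := heq u v hv
      rw [hφu]
      have hvr : v ≠ T.1.leaf r := by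
        rintro rfl
        rw [H'.leafCluster_root, ← H.leafCluster_root] at hv
        exact hu (H.leafCluster_injective hv).symm
      refine Or.inr ⟨hv, hvr, ?_, ?_⟩
      · refine H'.leafCluster_injective (Finset.Subset.antisymm (hmin _ _ ?_) ?_)
        · obtain ⟨b, hb⟩ := hrange (π' v)
          rw [← hb]
          refine H.parent_subset_of_ssubset ?_
          rw [hb, ← hv]
          exact H'.ssubset_parent hvr
        · refine H'.parent_subset_of_ssubset ?_
          rw [hv]
          exact (H.ssubset_parent hu).trans_subset (hφ _)
      · by_cases hc : IsCluster r (S.1.leafCluster π u)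
        · rw [← TreeCells.clusterWeight_leafCluster H hu hc, hw, ← hv,
            TreeCells.clusterWeight_leafCluster H' hvr (hv ▸ hc)]
        · rw [TreeCells.edgeLength_of_not_isCluster H hu hc,
            TreeCells.edgeLength_of_not_isCluster H' hvr (hv ▸ hc)]
    -- A cluster of `S` that is absent from `T` has weight zero, so the edge has length zero and is
    -- collapsed.
    · have hc : IsCluster r (S.1.leafCluster π u) := by
        by_contra hc
        exact hex (H.exists_leafCluster_eq H' u hc)
      refine Or.inl ⟨?_, ?_⟩
      · refine H'.leafCluster_injective (Finset.Subset.antisymm (hmin _ _ ?_)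
          (hmin _ _ ((H.ssubset_parent hu).1.trans (hφ _))))
        obtain ⟨b, hb⟩ := hrange (φ u)
        rw [← hb]
        refine H.parent_subset_of_ssubset (Finset.ssubset_iff_subset_ne.2 ⟨?_, fun he => ?_⟩)
        · rw [hb]; exact hφ u
        · exact hex ⟨φ u, hb.symm.trans he.symm⟩
      · rw [← TreeCells.clusterWeight_leafCluster H hu hc, hw, TreeCells.clusterWeight, if_pos hc]
        refine Finset.sum_eq_zero fun v hv => ?_
        exact absurd ⟨v, (Finset.mem_filter.1 hv).2.2⟩ hex
  have hcollapse : ∀ u, u ≠ S.1.leaf r → φ u ≠ φ (π u) →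
      T.1.leafCluster π' (φ u) = S.1.leafCluster π u ∧ φ u ≠ T.1.leaf r ∧
        φ (π u) = π' (φ u) := by
    intro u hu hne
    rcases hedge u hu with h | h
    · exact absurd h.1.symm hne
    · exact ⟨h.1, h.2.1, h.2.2.1⟩
  have hinj : ∀ u v, u ≠ S.1.leaf r → v ≠ S.1.leaf r → φ u ≠ φ (π u) → φ v ≠ φ (π v) →
      φ u = φ v → u = v := by
    intro u v hu hv hu' hv' he
    have h1 := (hcollapse u hu hu').1
    have h2 := (hcollapse v hv hv').1
    rw [he, h2] at h1
    exact (H.leafCluster_injective h1).symm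
  -- Two edges cannot be identified with opposite orientations, because parents have strictly
  -- smaller depth in `T`.
  have hanti : ∀ u v, u ≠ S.1.leaf r → v ≠ S.1.leaf r → φ u ≠ φ (π u) → φ v ≠ φ (π v) →
      φ (π u) = φ v → φ u ≠ φ (π v) := by
    intro u v hu hv hu' hv' he he'
    obtain ⟨-, h1, h2⟩ := hcollapse u hu hu'
    obtain ⟨-, h3, h4⟩ := hcollapse v hv hv'
    have h5 := H'.dep_lt _ h1
    have h6 := H'.dep_lt _ h3
    rw [← h2, he] at h5
    rw [← h4, ← he'] at h6
    omega
  refine ⟨φ, fun v => ?_, hleaf, fun u v hadj => ?_, fun u v u' v' h h' hne hu hv => ?_⟩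
  · obtain ⟨u, hu⟩ := hrange v
    exact ⟨u, heq u v hu.symm⟩
  · rw [← S.edgeLength_of_adj hadj]
    rcases (H.adj_iff u v).1 hadj with ⟨rfl, hne⟩ | ⟨rfl, hne⟩
    · rcases hedge u hne with ⟨h1, h2⟩ | ⟨-, h1, h2, h3⟩
      · exact Or.inl ⟨h1.symm, by rw [S.edgeLength_comm, h2]⟩
      · have hadj' : T.1.graph.Adj (φ u) (φ (π u)) := h2 ▸ (H'.adj_parent h1).symm
        refine Or.inr ⟨hadj', ?_⟩
        rw [← T.edgeLength_of_adj hadj', h2, T.edgeLength_comm, h3, S.edgeLength_comm]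
    · rcases hedge v hne with ⟨h1, h2⟩ | ⟨-, h1, h2, h3⟩
      · exact Or.inl ⟨h1, h2⟩
      · have hadj' : T.1.graph.Adj (φ (π v)) (φ v) := h2 ▸ H'.adj_parent h1
        refine Or.inr ⟨hadj', ?_⟩
        rw [← T.edgeLength_of_adj hadj', h2, h3]
  · have hne' : φ u' ≠ φ v' := fun e => hne (hu.trans (e.trans hv.symm))
    rcases (H.adj_iff u v).1 h with ⟨rfl, h1⟩ | ⟨rfl, h1⟩ <;>
      rcases (H.adj_iff u' v').1 h' with ⟨rfl, h2⟩ | ⟨rfl, h2⟩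
    · have := hinj u u' h1 h2 hne hne' hu
      exact ⟨this, congrArg π this⟩
    · exact absurd hu (hanti u v' h1 h2 hne hne'.symm hv)
    · exact absurd hv (hanti v u' h1 h2 hne.symm hne' hu)
    · have := hinj v v' h1 h2 hne.symm hne'.symm hv
      exact ⟨congrArg π this, this⟩

/-- A weight on the clusters of a tree is the weight of a choice of lengths. -/
theorem exists_lengths {Γ : MarkedTree n} {r : Fin n} {π : Fin Γ.size → Fin Γ.size}
    {dep : Fin Γ.size → ℕ} (H : IsRooting Γ.graph (Γ.leaf r) π dep) {w : Finset (Fin n) → ℝ≥0∞}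
    (hw : ∀ A, w A ≠ 0 → IsCluster r A ∧ ∃ v, Γ.leafCluster π v = A) :
    ∃ ℓ : Γ.Lengths, TreeCells.clusterWeight ⟨Γ, ℓ⟩ r π = w := by
  classical
  -- Each edge has exactly one lower end, so the sum has a single term; leaf edges receive the value
  -- ∞.
  let L : Sym2 (Fin Γ.size) → ℝ≥0∞ := fun e => ∑ v with v ≠ Γ.leaf r ∧ s(π v, v) = e,
    if IsCluster r (Γ.leafCluster π v) then w (Γ.leafCluster π v) else ⊤
  have hL : ∀ v, v ≠ Γ.leaf r → L s(π v, v) =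
      if IsCluster r (Γ.leafCluster π v) then w (Γ.leafCluster π v) else ⊤ := by
    intro v hv
    refine Finset.sum_eq_single_of_mem v (Finset.mem_filter.2 ⟨Finset.mem_univ _, hv, rfl⟩)
      fun u hu hne => ?_
    obtain ⟨-, hu, he⟩ := Finset.mem_filter.1 hu
    rcases Sym2.eq_iff.1 he with ⟨-, h⟩ | ⟨h1, h2⟩
    · exact absurd h hne
    · have h3 := H.dep_lt u hu
      have h4 := H.dep_lt v hv
      rw [h1] at h3
      rw [← h2] at h4
      omega
  have htop : ∀ (e : Γ.graph.edgeSet) (i : Fin n), Γ.leaf i ∈ e.1 → L e.1 = ⊤ := by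
    rintro ⟨e, he⟩ i hi
    have hv : ∃ v, v ≠ Γ.leaf r ∧ e = s(π v, v) := by
      induction e using Sym2.ind with
      | _ u v =>
      rcases (H.adj_iff u v).1 he with ⟨rfl, hne⟩ | ⟨rfl, hne⟩
      · exact ⟨u, hne, Sym2.eq_swap⟩
      · exact ⟨v, hne, rfl⟩
    obtain ⟨v, hv, rfl⟩ := hv
    dsimp only
    rw [hL v hv, if_neg]
    exact H.not_isCluster_leafCluster hv (Sym2.mem_iff.1 hi).symm
  refine ⟨⟨fun e => L e.1, htop⟩, ?_⟩
  ext1 A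
  by_cases hc : IsCluster r A
  · by_cases hex : ∃ v, Γ.leafCluster π v = A
    · obtain ⟨v, rfl⟩ := hex
      have hv : v ≠ Γ.leaf r := by
        rintro rfl
        exact hc.1 (H.root_mem_leafCluster.2 rfl)
      have h1 := TreeCells.clusterWeight_leafCluster (S := ⟨Γ, ⟨fun e => L e.1, htop⟩⟩) H hv hc
      rw [h1, TreeCells.edgeLength_of_adj _ (H.adj_parent hv)]
      exact (hL v hv).trans (if_pos hc)
    · rw [TreeCells.clusterWeight, if_pos hc, Finset.sum_eq_zero]
      · by_contra h
        exact hex (hw A (Ne.symm h)).2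
      · intro v hv
        exact absurd ⟨v, (Finset.mem_filter.1 hv).2.2⟩ hex
  · rw [TreeCells.clusterWeight, if_neg hc]
    by_contra h
    exact hc (hw A (Ne.symm h)).1

end Contraction

/-! ## The tree of a laminar family -/

section TreeOf

variable {n : ℕ}

/-- The tree whose vertices are a laminar family containing the singletons. -/
theorem exists_markedTree_of_family (hn : 3 ≤ n) {r : Fin n} {V : Finset (Finset (Fin n))}
    (huniv : Finset.univ ∈ V) (hX : Finset.univ.erase r ∈ V) (hsing : ∀ i, i ≠ r → {i} ∈ V)
    (hne : ∀ A ∈ V, A.Nonempty) (hroot : ∀ A ∈ V, r ∈ A → A = Finset.univ)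
    (hcomp : ∀ A ∈ V, ∀ B ∈ V, Compatible A B) :
    ∃ (Γ : MarkedTree n) (π : Fin Γ.size → Fin Γ.size) (dep : Fin Γ.size → ℕ),
      IsRooting Γ.graph (Γ.leaf r) π dep ∧ ∀ A, A ∈ V ↔ ∃ v, Γ.leafCluster π v = A := by
  classical
  let c : Fin V.card → Finset (Fin n) := fun v => V.equivFin.symm v
  have hcV : ∀ v, c v ∈ V := fun v => (V.equivFin.symm v).2
  have hcinj : Function.Injective c := fun u v h => V.equivFin.symm.injective (Subtype.ext h)
  have hcsurj : ∀ A ∈ V, ∃ v, c v = A := fun A hA => ⟨V.equivFin ⟨A, hA⟩, by simp [c]⟩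
  obtain ⟨ρ, hρ⟩ := hcsurj _ huniv
  have hcn : ∀ v, (c v).card ≤ n := fun v =>
    (Finset.card_le_univ _).trans_eq (Fintype.card_fin n)
  have hρ' : ∀ v, v ≠ ρ → c v ≠ Finset.univ := fun v hv h => hv (hcinj (h.trans hρ.symm))
  have hrv : ∀ v, v ≠ ρ → r ∉ c v := fun v hv h => hρ' v hv (hroot _ (hcV v) h)
  -- The parent is the least member strictly containing a given one; such members share an element
  -- and form a chain. The root is its own parent.
  have hpar : ∀ v, ∃ u, (v = ρ → u = ρ) ∧ (v ≠ ρ → c v ⊂ c u ∧ ∀ b, c v ⊂ c b → c u ⊆ c b) := by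
    intro v
    by_cases hv : v = ρ
    · exact ⟨ρ, fun _ => rfl, fun h => absurd hv h⟩
    obtain ⟨u, hu, hmin⟩ := Finset.exists_min_image (Finset.univ.filter fun u => c v ⊂ c u)
      (fun u => (c u).card) ⟨ρ, Finset.mem_filter.2 ⟨Finset.mem_univ _, by
        rw [hρ]; exact Finset.ssubset_univ_iff.2 (hρ' v hv)⟩⟩
    have hu := (Finset.mem_filter.1 hu).2
    refine ⟨u, fun h => absurd h hv, fun _ => ⟨hu, fun b hb => ?_⟩⟩
    obtain ⟨x, hx⟩ := hne _ (hcV v)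
    rcases (hcomp _ (hcV u) _ (hcV b)).of_mem (hu.1 hx) (hb.1 hx) with h | h
    · exact h
    · exact (Finset.eq_of_subset_of_card_le h
        (hmin b (Finset.mem_filter.2 ⟨Finset.mem_univ _, hb⟩))).superset
  choose π hπρ hπ using hpar
  have hcard : ∀ v, v ≠ ρ → (c v).card < (c (π v)).card := fun v hv =>
    Finset.card_lt_card (hπ v hv).1
  let G : SimpleGraph (Fin V.card) :=
    { Adj := fun u v => (π u = v ∧ u ≠ ρ) ∨ (π v = u ∧ v ≠ ρ)
      symm := ⟨fun u v h => h.symm⟩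
      loopless := ⟨fun v h => by
        have h : π v = v ∧ v ≠ ρ := h.elim id id
        have := hcard v h.2
        rw [h.1] at this
        exact lt_irrefl _ this⟩ }
  have hdep : ∀ v, v ≠ ρ → n - (c (π v)).card < n - (c v).card := by
    intro v hv
    have := hcard v hv
    have := hcn (π v)
    omega
  have H : IsRooting G ρ π fun v => n - (c v).card := ⟨hπρ ρ rfl, fun u v => Iff.rfl, hdep⟩
  have hanc : ∀ u v, IsAncestor π u v ↔ c v ⊆ c u := by
    intro u v
    constructor
    · rintro ⟨m, rfl⟩
      induction m with
      | zero => exact subset_rfl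
      | succ m ih =>
        rw [Function.iterate_succ_apply']
        refine ih.trans ?_
        by_cases h : π^[m] v = ρ
        · rw [h, H.root]
        · exact (hπ _ h).1.1
    · intro h
      induction hm : n - (c v).card using Nat.strong_induction_on generalizing v with
      | _ m ih =>
      rcases h.eq_or_ssubset with he | hlt
      · exact (hcinj he) ▸ IsAncestor.refl _ _
      · have hv : v ≠ ρ := by
          rintro rfl
          rw [hρ] at hlt
          exact hlt.2 (Finset.subset_univ _)
        exact isAncestor_iff.2 (Or.inr (ih _ (hm ▸ hdep v hv) _ ((hπ v hv).2 u hlt) rfl))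
  -- The child containing `x` is a largest member with `x` strictly inside `c v`; the singleton of
  -- `x` shows that there is one.
  have hchild : ∀ v x, x ≠ r → x ∈ c v → 2 ≤ (c v).card → ∃ a, a ≠ ρ ∧ π a = v ∧ x ∈ c a := by
    intro v x hxr hx h2
    obtain ⟨b, hb⟩ := hcsurj _ (hsing x hxr)
    have hbv : c b ⊂ c v := by
      rw [hb]
      refine Finset.ssubset_iff_subset_ne.2 ⟨Finset.singleton_subset_iff.2 hx, fun he => ?_⟩
      rw [← he] at h2
      simp at h2
    obtain ⟨a, ha, hmax⟩ := Finset.exists_max_image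
      (Finset.univ.filter fun a => c a ⊂ c v ∧ x ∈ c a) (fun a => (c a).card)
      ⟨b, Finset.mem_filter.2 ⟨Finset.mem_univ _, hbv, by rw [hb]; exact Finset.mem_singleton_self _⟩⟩
    obtain ⟨-, hav, hxa⟩ := Finset.mem_filter.1 ha
    have haρ : a ≠ ρ := by
      rintro rfl
      rw [hρ] at hav
      exact hav.2 (Finset.subset_univ _)
    refine ⟨a, haρ, ?_, hxa⟩
    by_contra hav'
    have hlt : c (π a) ⊂ c v :=
      Finset.ssubset_iff_subset_ne.2 ⟨(hπ a haρ).2 v hav, fun e => hav' (hcinj e)⟩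
    have := hmax (π a) (Finset.mem_filter.2 ⟨Finset.mem_univ _, hlt, (hπ a haρ).1.1 hxa⟩)
    exact absurd (hcard a haρ) (not_lt.2 this)
  have hleaf : ∀ i, ∃ v, (i = r → v = ρ) ∧ (i ≠ r → c v = {i}) := by
    intro i
    by_cases hi : i = r
    · exact ⟨ρ, fun _ => rfl, fun h => absurd hi h⟩
    · obtain ⟨v, hv⟩ := hcsurj _ (hsing i hi)
      exact ⟨v, fun h => absurd h hi, fun _ => hv⟩
  choose leaf hleafr hleaf using hleaf
  have hleafρ : ∀ i, i ≠ r → leaf i ≠ ρ := by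
    intro i hi he
    have := hleaf i hi
    rw [he, hρ] at this
    have := congrArg Finset.card this
    simp at this
    omega
  have hXu : ∀ v, v ≠ ρ → c v ⊆ Finset.univ.erase r := fun v hv x hx =>
    Finset.mem_erase.2 ⟨fun e => hrv v hv (e ▸ hx), Finset.mem_univ x⟩
  have hlc : ∀ v i, IsAncestor π v (leaf i) ↔ i ∈ c v := by
    intro v i
    rw [hanc]
    by_cases hi : i = r
    · rw [hleafr i hi, hρ, hi, Finset.univ_subset_iff]
      exact ⟨fun h => h ▸ Finset.mem_univ _, hroot _ (hcV v)⟩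
    · rw [hleaf i hi, Finset.singleton_subset_iff]
  have hinj : Function.Injective leaf := by
    intro i j hij
    by_cases hi : i = r
    · by_cases hj : j = r
      · rw [hi, hj]
      · exact absurd (hij.symm.trans (hleafr i hi)) (hleafρ j hj)
    · by_cases hj : j = r
      · exact absurd (hij.trans (hleafr j hj)) (hleafρ i hi)
      · have := hleaf i hi
        rw [hij, hleaf j hj, Finset.singleton_inj] at this
        exact this.symm
  have hval : ∀ i, (G.neighborSet (leaf i)).ncard = 1 := by
    intro i
    rw [Set.ncard_eq_one]
    by_cases hi : i = r
    -- The only neighbour of the root is the complement of `r`, which contains every other proper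
    -- member.
    · obtain ⟨x, hx⟩ := hcsurj _ hX
      have hxρ : x ≠ ρ := by
        rintro rfl
        rw [hρ] at hx
        exact Finset.notMem_erase r _ (hx ▸ Finset.mem_univ r)
      refine ⟨x, Set.ext fun v => ?_⟩
      rw [hleafr i hi, Set.mem_singleton_iff]
      constructor
      · rintro (⟨-, h⟩ | ⟨h, hv⟩)
        · exact absurd rfl h
        · by_contra hvx
          have hlt : c v ⊂ c x := by
            refine Finset.ssubset_iff_subset_ne.2 ⟨?_, fun e => hvx (hcinj e)⟩
            rw [hx]
            exact hXu v hv
          have := (hπ v hv).2 x hlt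
          rw [h, hρ] at this
          exact hrv x hxρ (this (Finset.mem_univ r))
      · rintro rfl
        refine Or.inr ⟨?_, hxρ⟩
        by_contra hne'
        have h1 := (hπ v hxρ).1
        rw [hx] at h1
        exact h1.2 (hXu _ hne')
    · refine ⟨π (leaf i), Set.ext fun v => ?_⟩
      rw [Set.mem_singleton_iff]
      constructor
      · rintro (⟨h, -⟩ | ⟨h, hv⟩)
        · exact h.symm
        · have h1 := (hπ v hv).1
          rw [h, hleaf i hi, Finset.ssubset_singleton_iff] at h1
          exact absurd h1 (hne _ (hcV v)).ne_empty
      · rintro rfl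
        exact Or.inl ⟨rfl, hleafρ i hi⟩
  -- Three neighbours are the parent, a child through some `x`, and a second child through an
  -- element `y` that the first one misses.
  have hval' : ∀ v, v ∉ Set.range leaf → 3 ≤ (G.neighborSet v).ncard := by
    intro v hv
    have hvρ : v ≠ ρ := by
      rintro rfl
      exact hv ⟨r, hleafr r rfl⟩
    obtain ⟨x, hx⟩ := hne _ (hcV v)
    have hxr : x ≠ r := by
      rintro rfl
      exact hrv v hvρ hx
    have h2 : 2 ≤ (c v).card := by
      by_contra hlt
      have h1 := Finset.card_pos.2 ⟨x, hx⟩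
      obtain ⟨i, hi⟩ := Finset.card_eq_one.1 (show (c v).card = 1 by omega)
      have hix : x = i := Finset.mem_singleton.1 (hi ▸ hx)
      exact hv ⟨x, hcinj ((hleaf x hxr).trans (hix ▸ hi.symm))⟩
    obtain ⟨a, ha, hπa, hxa⟩ := hchild v x hxr hx h2
    have hav := (hπ a ha).1
    rw [hπa] at hav
    obtain ⟨y, hy, hya⟩ := Finset.exists_of_ssubset hav
    have hyr : y ≠ r := by
      rintro rfl
      exact hrv v hvρ hy
    obtain ⟨b, hb, hπb, hyb⟩ := hchild v y hyr hy h2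
    have hab : a ≠ b := by
      rintro rfl
      exact hya hyb
    have hpv : ∀ a, a ≠ ρ → π a = v → π v ≠ a := by
      rintro a ha hπa rfl
      have h1 := hcard _ ha
      have h2 := hcard v hvρ
      rw [hπa] at h1
      omega
    exact (Set.two_lt_ncard_iff (Set.toFinite _)).2 ⟨π v, a, b, Or.inl ⟨rfl, hvρ⟩,
      Or.inr ⟨hπa, ha⟩, Or.inr ⟨hπb, hb⟩, hpv a ha hπa, hpv b hb hπb, hab⟩
  let Γ : MarkedTree n := ⟨V.card, G, H.isTree, leaf, hinj, hval, hval'⟩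
  have hΓ : ∀ v, Γ.leafCluster π v = c v := by
    intro v
    ext i
    rw [Γ.mem_leafCluster]
    exact hlc v i
  refine ⟨Γ, π, fun v => n - (c v).card, ?_, fun A => ⟨fun hA => ?_, ?_⟩⟩
  · have : Γ.leaf r = ρ := hleafr r rfl
    rw [this]
    exact H
  · obtain ⟨v, hv⟩ := hcsurj A hA
    exact ⟨v, (hΓ v).trans hv⟩
  · rintro ⟨v, rfl⟩
    rw [hΓ]
    exact hcV v

/-- Every laminar family is the family of clusters of a tree. -/
theorem IsLaminar.exists_markedTree (hn : 3 ≤ n) {r : Fin n} {σ : Finset (Finset (Fin n))}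
    (hσ : IsLaminar r σ) :
    ∃ (Γ : MarkedTree n) (π : Fin Γ.size → Fin Γ.size) (dep : Fin Γ.size → ℕ),
      IsRooting Γ.graph (Γ.leaf r) π dep ∧ (∀ A ∈ σ, ∃ v, Γ.leafCluster π v = A) ∧
      ∀ v, IsCluster r (Γ.leafCluster π v) → Γ.leafCluster π v ∈ σ := by
  classical
  set X := (Finset.univ : Finset (Fin n)).erase r
  have hXc : X.card = n - 1 := by
    rw [Finset.card_erase_of_mem (Finset.mem_univ r), Finset.card_univ, Fintype.card_fin]
  -- The clusters are completed by the sets of the leaves and of the neighbour of the root, which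
  -- every tree has.
  set V : Finset (Finset (Fin n)) :=
    insert Finset.univ (insert X (σ ∪ X.image fun i => {i})) with hV
  have hmem : ∀ A, A ∈ V ↔ A = Finset.univ ∨ A = X ∨ A ∈ σ ∨ ∃ i, i ≠ r ∧ A = {i} := by
    intro A
    simp [hV, X, eq_comm]
  have hsub : ∀ A ∈ V, A = Finset.univ ∨ A ⊆ X := by
    intro A hA
    rcases (hmem A).1 hA with h | rfl | h | ⟨i, hi, rfl⟩
    · exact Or.inl h
    · exact Or.inr subset_rfl
    · exact Or.inr (hσ.1 A h).subset
    · exact Or.inr (Finset.singleton_subset_iff.2 (Finset.mem_erase.2 ⟨hi, Finset.mem_univ i⟩))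
  obtain ⟨Γ, π, dep, H, hΓ⟩ := exists_markedTree_of_family (r := r) (V := V) hn
    ((hmem _).2 (Or.inl rfl)) ((hmem _).2 (Or.inr (Or.inl rfl)))
    (fun i hi => (hmem _).2 (Or.inr (Or.inr (Or.inr ⟨i, hi, rfl⟩))))
    (fun A hA => by
      rcases (hmem A).1 hA with rfl | rfl | h | ⟨i, -, rfl⟩
      · exact ⟨r, Finset.mem_univ r⟩
      · exact Finset.card_pos.1 (by omega)
      · exact Finset.card_pos.1 (by have := (hσ.1 A h).2.1; omega)
      · exact Finset.singleton_nonempty i)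
    (fun A hA hr => (hsub A hA).resolve_right fun h => Finset.notMem_erase r _ (h hr))
    (fun A hA B hB => by
      rcases hsub A hA with rfl | hAX
      · exact Or.inr (Or.inr (Finset.subset_univ _))
      rcases hsub B hB with rfl | hBX
      · exact Or.inr (Or.inl (Finset.subset_univ _))
      rcases (hmem A).1 hA with rfl | rfl | hAσ | ⟨i, -, rfl⟩
      · exact Or.inr (Or.inr (Finset.subset_univ _))
      · exact Or.inr (Or.inr hBX)
      · rcases (hmem B).1 hB with rfl | rfl | hBσ | ⟨j, -, rfl⟩
        · exact Or.inr (Or.inl (Finset.subset_univ _))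
        · exact Or.inr (Or.inl hAX)
        · exact hσ.2 A hAσ B hBσ
        · exact compatible_singleton A j
      · exact (compatible_singleton B i).symm)
  refine ⟨Γ, π, dep, H, fun A hA => (hΓ A).1 ((hmem A).2 (Or.inr (Or.inr (Or.inl hA)))),
    fun v hv => ?_⟩
  rcases (hmem _).1 ((hΓ _).2 ⟨v, rfl⟩) with h | h | h | ⟨i, -, h⟩
  · exact absurd (h ▸ Finset.mem_univ r) hv.1
  · exact absurd h hv.2.2
  · exact h
  · have := hv.2.1
    rw [h] at this
    simp at this

end TreeOf

/-! ## Double ratios of weighted laminar families -/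

section WeightRatio

variable {n : ℕ}

/-- The weights, possibly infinite, of the bounded edges of a tree. -/
def IsTreeWeight (r : Fin n) (w : Finset (Fin n) → ℝ≥0∞) : Prop :=
  ∃ σ, IsLaminar r σ ∧ ∀ A ∉ σ, w A = 0

/-- The double ratio of a tree in terms of its weights. -/
noncomputable def weightRatio (w : Finset (Fin n) → ℝ≥0∞) (q : DoublePair n) : EReal :=
  ((∑ A with splitVec A q = 1, w A : ℝ≥0∞) : EReal) -
    ((∑ A with splitVec A q = -1, w A : ℝ≥0∞) : EReal)

theorem splits_iff {A : Finset (Fin n)} {i j k l : Fin n} :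
    Splits A i j k l ↔ (indic A i - indic A j) * (indic A k - indic A l) = 1 := by
  simp only [Splits, indic]
  by_cases h1 : i ∈ A <;> by_cases h2 : j ∈ A <;> by_cases h3 : k ∈ A <;> by_cases h4 : l ∈ A <;>
    simp [h1, h2, h3, h4]

theorem splits_swap_iff {A : Finset (Fin n)} {i j k l : Fin n} :
    Splits A i j l k ↔ (indic A i - indic A j) * (indic A k - indic A l) = -1 := by
  rw [splits_iff, ← neg_inj, ← mul_neg, neg_sub]

/-- The two splits ik|jl and il|jk cross each other. Hence a tree contributes to each double ratio
with one sign only, and the difference defining it is never ∞ − ∞. -/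
theorem Splits.not_splits_swap {A B : Finset (Fin n)} {i j k l : Fin n} (h : Compatible A B)
    (hA : Splits A i j k l) : ¬ Splits B i j l k := by
  rintro (⟨b1, b2, b3, b4⟩ | ⟨b1, b2, b3, b4⟩) <;> rcases hA with ⟨a1, a2, a3, a4⟩ | ⟨a1, a2, a3, a4⟩
  · exact h.not_crossing a1 b1 a3 b4 b3 a4
  · exact h.not_crossing a4 b3 a2 b2 b1 a1
  · exact h.not_crossing a3 b4 a1 b1 b2 a2
  · exact h.not_crossing a2 b2 a4 b3 b4 a3

theorem IsTreeWeight.sum_eq_zero_or {r : Fin n} {w : Finset (Fin n) → ℝ≥0∞} (hw : IsTreeWeight r w)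
    (q : DoublePair n) : ∑ A with splitVec A q = 1, w A = 0 ∨ ∑ A with splitVec A q = -1, w A = 0 := by
  obtain ⟨σ, hσ, h0⟩ := hw
  by_cases h : ∃ A ∈ σ, splitVec A q = 1
  · obtain ⟨A, hA, hAq⟩ := h
    refine Or.inr (Finset.sum_eq_zero fun B hB => h0 B fun hBσ => ?_)
    exact (splits_iff.2 hAq).not_splits_swap (hσ.2 A hA B hBσ)
      (splits_swap_iff.2 (Finset.mem_filter.1 hB).2)
  · refine Or.inl (Finset.sum_eq_zero fun B hB => h0 B fun hBσ => ?_)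
    exact h ⟨B, hBσ, (Finset.mem_filter.1 hB).2⟩

/-- When at most one of the two parts is nonzero, the difference remembers both, as its positive and
its negative part. -/
theorem EReal.coe_ennreal_sub_inj {a b a' b' : ℝ≥0∞} (h : a = 0 ∨ b = 0) (h' : a' = 0 ∨ b' = 0)
    (he : (a : EReal) - b = a' - b') : a = a' ∧ b = b' := by
  have key : ∀ a b : ℝ≥0∞, (a : EReal) = -b → a = 0 ∧ b = 0 := by
    intro a b hab
    have h1 : (0 : EReal) ≤ a := EReal.coe_ennreal_nonneg a
    have h2 : (0 : EReal) ≤ b := EReal.coe_ennreal_nonneg b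
    have h3 : -(b : EReal) ≤ 0 := by rw [EReal.neg_le, neg_zero]; exact h2
    have h4 : (a : EReal) = 0 := le_antisymm (hab ▸ h3) h1
    refine ⟨EReal.coe_ennreal_eq_zero.1 h4, ?_⟩
    rw [h4] at hab
    exact EReal.coe_ennreal_eq_zero.1 (EReal.neg_eq_zero_iff.1 hab.symm)
  rcases h with rfl | rfl <;> rcases h' with rfl | rfl <;>
    simp only [EReal.coe_ennreal_zero, sub_zero, zero_sub] at he
  · exact ⟨rfl, EReal.coe_ennreal_injective (neg_injective he)⟩
  · obtain ⟨h1, h2⟩ := key _ _ he.symm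
    exact ⟨h1.symm, h2⟩
  · obtain ⟨h1, h2⟩ := key _ _ he
    exact ⟨h1, h2.symm⟩
  · exact ⟨EReal.coe_ennreal_injective he, rfl⟩

/-- The double ratio of (i j) and (k r) has as one of its parts the separating sum required by
`laminar_weight_ext`; the listing order of the double pair decides which part. -/
theorem weightRatio_injective (hn : 3 ≤ n) {r : Fin n} {w w' : Finset (Fin n) → ℝ≥0∞}
    (hw : IsTreeWeight r w) (hw' : IsTreeWeight r w') (h : weightRatio w = weightRatio w') :
    w = w' := by
  have hsum : ∀ q : DoublePair n, ∑ A with splitVec A q = 1, w A = ∑ A with splitVec A q = 1, w' A ∧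
      ∑ A with splitVec A q = -1, w A = ∑ A with splitVec A q = -1, w' A := fun q =>
    EReal.coe_ennreal_sub_inj (hw.sum_eq_zero_or q) (hw'.sum_eq_zero_or q) (congrFun h q)
  have hsplit : ∀ (σ : Finset (Finset (Fin n))) (w : Finset (Fin n) → ℝ≥0∞), IsLaminar r σ →
      (∀ A ∉ σ, w A = 0) → ∀ i k j : Fin n, ∑ B with i ∈ B ∧ k ∈ B ∧ j ∉ B ∧ r ∉ B, w B =
        ∑ B with (indic B i - indic B j) * (indic B k - indic B r) = 1, w B := by
    intro σ w hσ h0 i k j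
    simp only [Finset.sum_filter]
    refine Finset.sum_congr rfl fun B _ => ?_
    by_cases hB : B ∈ σ
    · have hr := (hσ.1 B hB).1
      simp only [indic]
      by_cases h1 : i ∈ B <;> by_cases h2 : k ∈ B <;> by_cases h3 : j ∈ B <;>
        simp [h1, h2, h3, hr]
    · simp [h0 B hB]
  obtain ⟨σ, hσ, h0⟩ := hw
  obtain ⟨σ', hσ', h0'⟩ := hw'
  refine laminar_weight_ext hn hσ hσ' w w' h0 h0' fun i k j hik hij hkj hi hk hj => ?_
  rw [hsplit σ w hσ h0, hsplit σ' w' hσ' h0']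
  obtain ⟨q, hq | hq⟩ := exists_doublePair_of_distinct i j k r hij hik hi hkj.symm hj hk
  · have := (hsum q).1
    simpa only [hq] using this
  · have := (hsum q).2
    simpa only [hq, neg_inj] using this

theorem weightRatio_ofReal {σ : Finset (Finset (Fin n))}
    {w : Finset (Fin n) → ℝ} (hw : IsWeightOn σ w) (q : DoublePair n) :
    weightRatio (fun A => ENNReal.ofReal (w A)) q = ((weightMap splitVec w q : ℝ) : EReal) := by
  rw [weightRatio, ← ENNReal.ofReal_sum_of_nonneg fun A _ => hw.1 A,
    ← ENNReal.ofReal_sum_of_nonneg fun A _ => hw.1 A, EReal.coe_ennreal_ofReal,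
    EReal.coe_ennreal_ofReal, max_eq_left (Finset.sum_nonneg fun A _ => hw.1 A),
    max_eq_left (Finset.sum_nonneg fun A _ => hw.1 A), ← EReal.coe_sub, weightMap_apply,
    Finset.sum_filter, Finset.sum_filter, ← Finset.sum_sub_distrib]
  congr 1
  refine Finset.sum_congr rfl fun A _ => ?_
  simp only [splitVec, indic]
  by_cases h1 : q.1 0 ∈ A <;> by_cases h2 : q.1 1 ∈ A <;> by_cases h3 : q.1 2 ∈ A <;>
    by_cases h4 : q.1 3 ∈ A <;> simp [h1, h2, h3, h4]

theorem TreeCells.doubleRatio_eq_weightRatio {S : TreeCells n} {r : Fin n}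
    {π : Fin S.1.size → Fin S.1.size} {dep : Fin S.1.size → ℕ}
    (H : IsRooting S.1.graph (S.1.leaf r) π dep) (q : DoublePair n) :
    S.doubleRatio (q.1 0) (q.1 1) (q.1 2) (q.1 3) = weightRatio (S.clusterWeight r π) q := by
  classical
  obtain ⟨h1, h2, h3, h4, h5, h6⟩ := q.ne
  rw [TreeCells.doubleRatio, weightRatio, overlap_eq_sum_clusterWeight H h2 h5,
    overlap_eq_sum_clusterWeight H h3 h4]
  congr 2
  · exact Finset.sum_congr (Finset.filter_congr fun A _ => splits_iff) fun _ _ => rfl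
  · exact Finset.sum_congr (Finset.filter_congr fun A _ => splits_swap_iff) fun _ _ => rfl

theorem TreeCells.isTreeWeight_clusterWeight (S : TreeCells n) (r : Fin n)
    (π : Fin S.1.size → Fin S.1.size) : IsTreeWeight r (S.clusterWeight r π) := by
  classical
  refine ⟨_, isLaminar_clusterWeight (S := S) (π := π), fun A hA => ?_⟩
  by_contra h
  exact hA (Finset.mem_filter.2 ⟨Finset.mem_univ _, h⟩)

/-- The family of the double ratios of a point of the moduli space. -/
noncomputable def ratios (y : ModuliBar n) (q : DoublePair n) : EReal :=
  doubleRatio (q.1 0) (q.1 1) (q.1 2) (q.1 3) y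

theorem exists_isTreeWeight (r : Fin n) (y : ModuliBar n) :
    ∃ w, IsTreeWeight r w ∧ ratios y = weightRatio w := by
  induction y using Quot.ind with
  | _ S =>
  obtain ⟨π, dep, H⟩ := S.1.isTree.exists_isRooting (S.1.leaf r)
  exact ⟨_, S.isTreeWeight_clusterWeight r π, funext fun q => TreeCells.doubleRatio_eq_weightRatio H q⟩

/-- Subtraction of extended reals is not continuous at ∞ − ∞, but on each closed cell one of the two
overlaps vanishes identically, for a reason depending only on the combinatorial type. -/
theorem continuous_ratios (q : DoublePair n) : Continuous fun y : ModuliBar n => ratios y q := by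
  classical
  refine continuous_quot_lift _ (continuous_sigma fun Γ => ?_)
  set i := q.1 0
  set j := q.1 1
  set k := q.1 2
  set l := q.1 3
  have hcont : ∀ i j k l, Continuous fun ℓ : Γ.Lengths =>
      ((TreeCells.overlap ⟨Γ, ℓ⟩ i j k l : ℝ≥0∞) : EReal) := by
    intro i j k l
    have h : Continuous fun ℓ : Γ.Lengths => TreeCells.overlap ⟨Γ, ℓ⟩ i j k l := by
      unfold TreeCells.overlap
      change Continuous fun ℓ : Γ.Lengths => ∑ d : Γ.graph.Dart with
        d ∈ (Γ.path i j).darts ∧ d ∈ (Γ.path k l).darts, ℓ.1 ⟨d.edge, d.edge_mem⟩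
      refine continuous_finsetSum _ fun d _ => ?_
      exact (continuous_apply (⟨d.edge, d.edge_mem⟩ : Γ.graph.edgeSet)).comp
        (continuous_subtype_val (p := fun l : Γ.graph.edgeSet → ℝ≥0∞ =>
          ∀ (e : Γ.graph.edgeSet) (i : Fin n), Γ.leaf i ∈ e.1 → l e = ⊤))
    exact continuous_coe_ennreal_ereal.comp h
  obtain ⟨π, dep, H⟩ := Γ.isTree.exists_isRooting (Γ.leaf i)
  have hzero : ∀ i j k l, (∀ v, ¬ Splits (Γ.leafCluster π v) i j k l) → ∀ ℓ : Γ.Lengths,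
      TreeCells.overlap ⟨Γ, ℓ⟩ i j k l = 0 := by
    intro i j k l h ℓ
    rw [TreeCells.overlap_eq_sum (S := ⟨Γ, ℓ⟩) H, Finset.sum_eq_zero]
    intro v hv
    exact absurd (Finset.mem_filter.1 hv).2.2 (h v)
  by_cases h : ∃ v, Splits (Γ.leafCluster π v) i j k l
  · obtain ⟨v, hv⟩ := h
    have h0 := hzero i j l k fun u =>
      hv.not_splits_swap (IsRooting.leafCluster_compatible v u)
    refine (hcont i j k l).congr fun ℓ => ?_
    simp only [TreeCells.doubleRatio, h0, EReal.coe_ennreal_zero, sub_zero]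
  · have h0 := hzero i j k l (not_exists.1 h)
    refine (continuous_neg.comp (hcont i j l k)).congr fun ℓ => ?_
    simp only [TreeCells.doubleRatio, h0, EReal.coe_ennreal_zero, zero_sub, Function.comp_apply]

/-- Finitely many trees whose cells cover the moduli space. -/
theorem exists_cells (hn : 3 ≤ n) (r : Fin n) :
    ∃ Γ : {σ : Finset (Finset (Fin n)) // IsLaminar r σ} → MarkedTree n,
      ∀ w, IsTreeWeight r w → ∃ σ, ∃ ℓ : (Γ σ).Lengths,
        ratios (Quot.mk _ ⟨Γ σ, ℓ⟩ : ModuliBar n) = weightRatio w ∧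
        ∀ (S : TreeCells n) π dep, IsRooting S.1.graph (S.1.leaf r) π dep →
          S.clusterWeight r π = w → (Quot.mk _ S : ModuliBar n) = Quot.mk _ ⟨Γ σ, ℓ⟩ := by
  classical
  choose Γ π dep H hΓ hΓ' using
    fun σ : {σ : Finset (Finset (Fin n)) // IsLaminar r σ} => σ.2.exists_markedTree hn
  refine ⟨Γ, fun w hw => ?_⟩
  obtain ⟨τ, hτ, h0⟩ := hw
  -- The cell is chosen by the exact support of `w`, so its tree has no bounded edge of length zero
  -- and all trees with weight `w` contract onto it.
  let σ : {σ : Finset (Finset (Fin n)) // IsLaminar r σ} :=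
    ⟨τ.filter fun A => w A ≠ 0, hτ.mono (Finset.filter_subset _ _)⟩
  have hσ : ∀ A, A ∈ σ.1 ↔ w A ≠ 0 := by
    intro A
    rw [Finset.mem_filter, and_iff_right_iff_imp]
    intro h
    by_contra hA
    exact h (h0 A hA)
  obtain ⟨ℓ, hℓ⟩ := exists_lengths (H σ) (w := w) fun A hA =>
    ⟨σ.2.1 A ((hσ A).2 hA), hΓ σ A ((hσ A).2 hA)⟩
  refine ⟨σ, ℓ, ?_, fun S π' dep' H' hS => ?_⟩
  · rw [← hℓ]
    exact funext fun q => TreeCells.doubleRatio_eq_weightRatio (S := ⟨Γ σ, ℓ⟩) (H σ) q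
  · refine Quot.sound (exists_isContraction (T := ⟨Γ σ, ℓ⟩) H' (H σ) (hS.trans hℓ.symm) ?_)
    intro v hv
    rw [hℓ]
    exact (hσ _).1 (hΓ' σ v hv)

theorem exists_ratios_eq (hn : 3 ≤ n) {r : Fin n} {w : Finset (Fin n) → ℝ≥0∞}
    (hw : IsTreeWeight r w) : ∃ y : ModuliBar n, ratios y = weightRatio w := by
  obtain ⟨Γ, hΓ⟩ := exists_cells hn r
  obtain ⟨σ, ℓ, h, -⟩ := hΓ w hw
  exact ⟨_, h⟩

/-- Equal double ratios give equal weights, and two trees with equal weights contract onto the same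
representative. -/
theorem ratios_injective (hn : 3 ≤ n) : Function.Injective (ratios (n := n)) := by
  let r : Fin n := ⟨0, by omega⟩
  obtain ⟨Γ, hΓ⟩ := exists_cells hn r
  intro y y' h
  induction y using Quot.ind with
  | _ S =>
  induction y' using Quot.ind with
  | _ S' =>
  obtain ⟨π, dep, H⟩ := S.1.isTree.exists_isRooting (S.1.leaf r)
  obtain ⟨π', dep', H'⟩ := S'.1.isTree.exists_isRooting (S'.1.leaf r)
  have hw := S.isTreeWeight_clusterWeight r π
  have hS : ratios (Quot.mk _ S : ModuliBar n) = weightRatio (S.clusterWeight r π) :=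
    funext fun q => TreeCells.doubleRatio_eq_weightRatio H q
  have hS' : ratios (Quot.mk _ S' : ModuliBar n) = weightRatio (S'.clusterWeight r π') :=
    funext fun q => TreeCells.doubleRatio_eq_weightRatio H' q
  have he := weightRatio_injective hn hw (S'.isTreeWeight_clusterWeight r π')
    (hS.symm.trans (h.trans hS'))
  obtain ⟨σ, ℓ, -, hcell⟩ := hΓ _ hw
  exact (hcell S π dep H rfl).trans (hcell S' π' dep' H' he.symm).symm

instance (Γ : MarkedTree n) : CompactSpace Γ.Lengths := by
  refine isCompact_iff_compactSpace.1 (IsClosed.isCompact ?_)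
  have h : {l : Γ.graph.edgeSet → ℝ≥0∞ | ∀ (e : Γ.graph.edgeSet) (i : Fin n), Γ.leaf i ∈ e.1 →
      l e = ⊤} = ⋂ e, ⋂ i, ⋂ (_ : Γ.leaf i ∈ e.1), {l | l e = ⊤} := by
    ext l
    simp only [Set.mem_ofPred_eq, Set.mem_iInter]
  change IsClosed {l : Γ.graph.edgeSet → ℝ≥0∞ | _}
  rw [h]
  refine isClosed_iInter fun e => isClosed_iInter fun i => isClosed_iInter fun _ => ?_
  exact isClosed_eq (continuous_apply e) continuous_const

/-- There are finitely many laminar families, and the images of their compact cells cover the space.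
-/
theorem compactSpace_moduliBar (hn : 3 ≤ n) : CompactSpace (ModuliBar n) := by
  let r : Fin n := ⟨0, by omega⟩
  obtain ⟨Γ, hΓ⟩ := exists_cells hn r
  refine ⟨?_⟩
  have hcov : (Set.univ : Set (ModuliBar n)) =
      ⋃ σ, Set.range fun ℓ : (Γ σ).Lengths => (Quot.mk _ ⟨Γ σ, ℓ⟩ : ModuliBar n) := by
    refine (Set.eq_univ_of_forall fun y => ?_).symm
    induction y using Quot.ind with
    | _ S =>
    obtain ⟨π, dep, H⟩ := S.1.isTree.exists_isRooting (S.1.leaf r)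
    obtain ⟨σ, ℓ, -, h⟩ := hΓ _ (S.isTreeWeight_clusterWeight r π)
    exact Set.mem_iUnion.2 ⟨σ, ℓ, (h S π dep H rfl).symm⟩
  rw [hcov]
  exact isCompact_iUnion fun σ => isCompact_range (continuous_quot_mk.comp continuous_sigmaMk)

end WeightRatio

/-! ## Change of signs of tropical coordinates -/

section FlipSign

variable {ι : Type}

open Classical in
/-- Reversal of the signs of those coordinates with the property `P` that are not `-∞`. -/
noncomputable def flipSign (P : ι → Prop) (z : ι → TropNum) (q : ι) : TropNum :=
  if h : P q ∧ (z q : EReal) ≠ ⊥ then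
    ⟨-(z q : EReal), fun e => h.2 (EReal.neg_eq_top_iff.1 e)⟩ else z q

/-- The open set on which `flipSign` is continuous. -/
def flipDomain (P : ι → Prop) : Set (ι → TropNum) := {z | ∀ q, P q → (z q : EReal) ≠ ⊥}

theorem flipSign_apply_of_mem {P : ι → Prop} {z : ι → TropNum} (hz : z ∈ flipDomain P) {q : ι}
    (h : P q) : (flipSign P z q : EReal) = -(z q : EReal) := by
  rw [flipSign, dif_pos ⟨h, hz q h⟩]

theorem flipSign_apply_of_not {P : ι → Prop} (z : ι → TropNum) {q : ι} (h : ¬ P q) :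
    flipSign P z q = z q := dif_neg fun h' => h h'.1

theorem flipSign_mem {P : ι → Prop} {z : ι → TropNum} (hz : z ∈ flipDomain P) :
    flipSign P z ∈ flipDomain P := by
  intro q hq
  rw [flipSign_apply_of_mem hz hq, Ne, EReal.neg_eq_bot_iff]
  exact (z q).2

theorem flipSign_flipSign {P : ι → Prop} {z : ι → TropNum} (hz : z ∈ flipDomain P) :
    flipSign P (flipSign P z) = z := by
  ext1 q
  by_cases h : P q
  · refine Subtype.ext ?_
    rw [flipSign_apply_of_mem (flipSign_mem hz) h, flipSign_apply_of_mem hz h, neg_neg]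
  · rw [flipSign_apply_of_not _ h, flipSign_apply_of_not _ h]

theorem isOpen_flipDomain [Finite ι] (P : ι → Prop) : IsOpen (flipDomain P) := by
  have h : flipDomain P = ⋂ q, ⋂ (_ : P q), (fun z : ι → TropNum => (z q : EReal)) ⁻¹' {⊥}ᶜ := by
    ext z
    simp [flipDomain]
  rw [h]
  refine isOpen_iInter_of_finite fun q => isOpen_iInter_of_finite fun _ => ?_
  exact isOpen_compl_singleton.preimage (continuous_subtype_val.comp (continuous_apply q))

theorem continuousOn_flipSign (P : ι → Prop) : ContinuousOn (flipSign P) (flipDomain P) := by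
  refine continuousOn_pi.2 fun q => ?_
  by_cases h : P q
  · refine Topology.IsInducing.subtypeVal.continuousOn_iff.2 ?_
    refine ContinuousOn.congr (f := fun z : ι → TropNum => -(z q : EReal)) ?_ fun z hz =>
      flipSign_apply_of_mem hz h
    exact (continuous_neg.comp (continuous_subtype_val.comp (continuous_apply q))).continuousOn
  · refine (continuous_apply q).continuousOn.congr fun z _ => ?_
    exact flipSign_apply_of_not z h

/-- Reversing finite coordinates changes the signs of exponents, which stay integers; negative
exponents of Laurent polynomials are essential here. -/
theorem IsRegularOn.comp_flipSign [Fintype ι] {G : Set (ι → TropNum)} {g : (ι → TropNum) → TropNum}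
    (hg : IsRegularOn G g) (P : ι → Prop) :
    IsRegularOn (flipDomain P ∩ flipSign P ⁻¹' G) (g ∘ flipSign P) := by
  classical
  obtain ⟨hc, L, hL⟩ := hg
  refine ⟨hc.comp ((continuousOn_flipSign P).mono Set.inter_subset_left) fun z hz => hz.2, ?_⟩
  let s : ι → ℤ := fun q => if P q then -1 else 1
  have hs : ∀ q, s q * s q = 1 := fun q => by
    by_cases h : P q <;> simp [s, h]
  -- Multiplication by the signs is an involution on exponents, so the coefficient of j in the new
  -- polynomial is that of s j in the old one.
  let L' : TropLaurent ι := ⟨L.support.image fun j => s * j, L.nonempty.image _,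
    fun j => L.coeff (s * j)⟩
  refine ⟨L', fun x hx => ?_⟩
  have hflip : flipSign P (realPoint x) = realPoint fun q => s q * x q := by
    ext1 q
    refine Subtype.ext ?_
    by_cases h : P q
    · rw [flipSign_apply_of_mem hx.1 h]
      simp [realPoint, TropNum.ofReal, s, h]
    · rw [flipSign_apply_of_not _ h]
      simp [realPoint, TropNum.ofReal, s, h]
  have hx2 := hx.2
  rw [Set.mem_preimage, hflip] at hx2
  rw [Function.comp_apply, hflip, hL _ hx2]
  congr 1
  simp only [TropLaurent.eval, L']
  rw [Finset.sup'_image]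
  refine Finset.sup'_congr _ rfl fun j _ => ?_
  have hss : s * (s * j) = j := by
    ext q
    simp only [Pi.mul_apply, ← mul_assoc, hs, one_mul]
  simp only [Function.comp_apply, hss, Pi.mul_apply, Int.cast_mul]
  congr 1
  exact Finset.sum_congr rfl fun q _ => by ring

theorem IsOpen.flipSign [Finite ι] {G : Set (ι → TropNum)} (hG : IsOpen G) (P : ι → Prop) :
    IsOpen (flipDomain P ∩ flipSign P ⁻¹' G) :=
  (continuousOn_flipSign P).isOpen_inter_preimage (isOpen_flipDomain P) hG

end FlipSign

/-! ## The charts of the moduli space -/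

section Chart

variable {n : ℕ}

open Classical in
/-- The signs of the coordinates near `x`. -/
noncomputable def coordSign (x : ModuliBar n) (q : DoublePair n) : ℤ := if ratios x q = ⊤ then -1 else 1

theorem coordSign_mul_self (x : ModuliBar n) (q : DoublePair n) :
    coordSign x q * coordSign x q = 1 := by
  by_cases h : ratios x q = ⊤ <;> simp [coordSign, h]

theorem doubleRatioCoord_of_eq_top {x : ModuliBar n} (y : ModuliBar n) {q : DoublePair n}
    (h : ratios x q = ⊤) : doubleRatioCoord x y q = -ratios y q := if_pos h

theorem doubleRatioCoord_of_ne_top {x : ModuliBar n} (y : ModuliBar n) {q : DoublePair n}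
    (h : ratios x q ≠ ⊤) : doubleRatioCoord x y q = ratios y q := if_neg h

theorem continuous_doubleRatioCoord (x : ModuliBar n) : Continuous (doubleRatioCoord x) := by
  refine continuous_pi fun q => ?_
  by_cases h : ratios x q = ⊤
  · simp only [doubleRatioCoord_of_eq_top _ h]
    exact continuous_neg.comp (continuous_ratios q)
  · simp only [doubleRatioCoord_of_ne_top _ h]
    exact continuous_ratios q

theorem doubleRatioCoord_injective (hn : 3 ≤ n) (x : ModuliBar n) :
    Function.Injective (doubleRatioCoord x) := by
  intro y y' he
  refine ratios_injective hn (funext fun q => ?_)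
  have := congrFun he q
  by_cases h : ratios x q = ⊤
  · rw [doubleRatioCoord_of_eq_top _ h, doubleRatioCoord_of_eq_top _ h] at this
    exact neg_injective this
  · rwa [doubleRatioCoord_of_ne_top _ h, doubleRatioCoord_of_ne_top _ h] at this

theorem t2Space_moduliBar (hn : 3 ≤ n) : T2Space (ModuliBar n) :=
  T2Space.of_injective_continuous (ratios_injective hn) (continuous_pi continuous_ratios)

theorem isClosedEmbedding_doubleRatioCoord (hn : 3 ≤ n) (x : ModuliBar n) :
    IsClosedEmbedding (doubleRatioCoord x) := by
  have := compactSpace_moduliBar hn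
  exact (continuous_doubleRatioCoord x).isClosedEmbedding (doubleRatioCoord_injective hn x)

/-- Infinite weights are limits of finite ones. -/
theorem tendsto_weightRatio_min {r : Fin n} {w : Finset (Fin n) → ℝ≥0∞} (hw : IsTreeWeight r w)
    (q : DoublePair n) : Filter.Tendsto (fun m : ℕ => weightRatio (fun A => min (w A) m) q)
      Filter.atTop (𝓝 (weightRatio w q)) := by
  have hsum : ∀ s : Finset (Finset (Fin n)), Filter.Tendsto
      (fun m : ℕ => ((∑ A ∈ s, min (w A) m : ℝ≥0∞) : EReal)) Filter.atTop
      (𝓝 ((∑ A ∈ s, w A : ℝ≥0∞) : EReal)) := by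
    intro s
    refine (continuous_coe_ennreal_ereal.tendsto _).comp (tendsto_finsetSum _ fun A _ => ?_)
    have h := (tendsto_const_nhds (x := w A)).min ENNReal.tendsto_nat_nhds_top
    rwa [min_eq_left le_top] at h
  have hzero : ∀ s : Finset (Finset (Fin n)), ∑ A ∈ s, w A = 0 → ∀ m : ℕ,
      ∑ A ∈ s, min (w A) m = 0 := by
    intro s hs m
    refine Finset.sum_eq_zero fun A hA => ?_
    rw [(Finset.sum_eq_zero_iff.1 hs) A hA, min_eq_left zero_le]
  unfold weightRatio
  -- One of the two sums vanishes before and after truncation, so no continuity of subtraction is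
  -- needed.
  rcases hw.sum_eq_zero_or q with h | h
  · simp only [h, hzero _ h, EReal.coe_ennreal_zero, zero_sub]
    exact (continuous_neg.tendsto _).comp (hsum _)
  · simp only [h, hzero _ h, EReal.coe_ennreal_zero, sub_zero]
    exact hsum _

/-- The fan that is the image of the finite part of the moduli space under the coordinates at `x`. -/
theorem isSmoothFan_coord (hn : 3 ≤ n) (r : Fin n) (x : ModuliBar n) :
    IsSmoothFan (n - 3) {σ | IsLaminar r σ} fun A q => coordSign x q * splitVec A q :=
  (isSmoothFan_splitVec hn r).flip (coordSign x) (coordSign_mul_self x)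

theorem coordSign_weightMap {σ : Finset (Finset (Fin n))} {w : Finset (Fin n) → ℝ}
    (hw : IsWeightOn σ w) (x : ModuliBar n) (q : DoublePair n) :
    ((realPoint (weightMap (fun A q => coordSign x q * splitVec A q) w) q : TropNum) : EReal) =
      if ratios x q = ⊤ then -weightRatio (fun A => ENNReal.ofReal (w A)) q
      else weightRatio (fun A => ENNReal.ofReal (w A)) q := by
  rw [weightRatio_ofReal hw]
  simp only [realPoint, TropNum.ofReal, weightMap_mul, coordSign]
  split_ifs <;> simp

/-- The range of the coordinates is closed by compactness and contains the finite points of the fan,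
hence their closure. Conversely, truncating the weights of a tree at m gives finite points of the
fan converging to its coordinates. -/
theorem mem_carrier_iff (hn : 3 ≤ n) (r : Fin n) (x : ModuliBar n) (p : DoublePair n → TropNum) :
    p ∈ (isSmoothFan_coord hn r x).polyComplex.carrier ↔
      ∃ y, ∀ q, doubleRatioCoord x y q = p q := by
  classical
  have hcoord : ∀ (y : ModuliBar n) w, ratios y = weightRatio w → ∀ q, doubleRatioCoord x y q =
      if ratios x q = ⊤ then -weightRatio w q else weightRatio w q := by
    intro y w h q
    split_ifs with h'
    · rw [doubleRatioCoord_of_eq_top _ h', h]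
    · rw [doubleRatioCoord_of_ne_top _ h', h]
  constructor
  · intro hp
    have hcont : Continuous fun (p : DoublePair n → TropNum) q => (p q : EReal) :=
      continuous_pi fun q => continuous_subtype_val.comp (continuous_apply q)
    have hcl := (isClosedEmbedding_doubleRatioCoord hn x).isClosed_range
    have := map_mem_closure (t := Set.range (doubleRatioCoord x)) hcont hp ?_
    · rw [hcl.closure_eq] at this
      obtain ⟨y, hy⟩ := this
      exact ⟨y, congrFun hy⟩
    · rintro _ ⟨v, hv, rfl⟩
      obtain ⟨σ, hσ, w, hw, rfl⟩ := (isSmoothFan_coord hn r x).mem_finitePart.1 hv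
      obtain ⟨y, hy⟩ := exists_ratios_eq hn (w := fun A => ENNReal.ofReal (w A))
        ⟨σ, hσ, fun A hA => by simp only [hw.2 A hA, ENNReal.ofReal_zero]⟩
      refine ⟨y, funext fun q => ?_⟩
      rw [hcoord y _ hy]
      exact (coordSign_weightMap hw x q).symm
  · rintro ⟨y, hy⟩
    obtain ⟨w, hw, hyw⟩ := exists_isTreeWeight r y
    have ⟨σ, hσ, h0⟩ := hw
    have hne : ∀ (m : ℕ) A, min (w A) m ≠ ⊤ := fun m A =>
      ne_top_of_le_ne_top (ENNReal.natCast_ne_top m) (min_le_right _ _)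
    have hwm : ∀ m : ℕ, IsWeightOn σ fun A => (min (w A) m).toReal := fun m =>
      ⟨fun A => ENNReal.toReal_nonneg, fun A hA => by
        simp only [h0 A hA, min_eq_left zero_le, ENNReal.toReal_zero]⟩
    refine mem_closure_of_tendsto (b := Filter.atTop) (f := fun m : ℕ => realPoint
      (weightMap (fun A q => coordSign x q * splitVec A q) fun A => (min (w A) m).toReal)) ?_
      (Filter.Eventually.of_forall fun m => ⟨_, (isSmoothFan_coord hn r x).mem_finitePart.2
        ⟨σ, hσ, _, hwm m, rfl⟩, rfl⟩)
    refine tendsto_pi_nhds.2 fun q => tendsto_subtype_rng.2 ?_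
    rw [← hy q, hcoord y w hyw]
    simp only [coordSign_weightMap (hwm _), ENNReal.ofReal_toReal (hne _ _)]
    split_ifs
    · exact (continuous_neg.tendsto _).comp (tendsto_weightRatio_min hw q)
    · exact tendsto_weightRatio_min hw q

/-- The change of signs between the coordinates at `x` and those at a nearby point `y`. -/
def SignChange (x y : ModuliBar n) (q : DoublePair n) : Prop := ratios x q = ⊤ ∧ ratios y q ≠ ⊤

theorem doubleRatioCoord_eq_neg {x y : ModuliBar n} {q : DoublePair n} (h : SignChange x y q)
    (z : ModuliBar n) : doubleRatioCoord y z q = -doubleRatioCoord x z q := by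
  rw [doubleRatioCoord_of_ne_top _ h.2, doubleRatioCoord_of_eq_top _ h.1, neg_neg]

/-- In the chart at `x`, a double ratio that is not +∞ at `x` is not +∞ at `y` either, so the sign
conventions differ only for those that are +∞ at `x` and not at `y`. -/
theorem doubleRatioCoord_eq {x y : ModuliBar n} {q : DoublePair n} (h : ¬ SignChange x y q)
    (hy : doubleRatioCoord x y q ≠ ⊤) (z : ModuliBar n) :
    doubleRatioCoord y z q = doubleRatioCoord x z q := by
  by_cases hx : ratios x q = ⊤
  · have hyq : ratios y q = ⊤ := by
      by_contra hne
      exact h ⟨hx, hne⟩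
    rw [doubleRatioCoord_of_eq_top _ hx, doubleRatioCoord_of_eq_top _ hyq]
  · rw [doubleRatioCoord_of_ne_top _ hx] at hy ⊢
    rw [doubleRatioCoord_of_ne_top _ hy]

theorem doubleRatioCoord_ne_bot {x y : ModuliBar n} {q : DoublePair n} (h : SignChange x y q) :
    doubleRatioCoord x y q ≠ ⊥ := by
  rw [doubleRatioCoord_of_eq_top _ h.1, Ne, EReal.neg_eq_bot_iff]
  exact h.2

theorem doubleRatioCoord_self_ne_top (x : ModuliBar n) (q : DoublePair n) :
    doubleRatioCoord x x q ≠ ⊤ := by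
  by_cases h : ratios x q = ⊤
  · rw [doubleRatioCoord_of_eq_top _ h, h]
    simp
  · rwa [doubleRatioCoord_of_ne_top _ h]

theorem coe_flipSign_eq {x y z : ModuliBar n} {p : DoublePair n → TropNum}
    (hy : ∀ q, doubleRatioCoord x y q ≠ ⊤) (hp : ∀ q, doubleRatioCoord x z q = p q)
    (hmem : p ∈ flipDomain (SignChange x y)) (q : DoublePair n) :
    (flipSign (SignChange x y) p q : EReal) = doubleRatioCoord y z q := by
  by_cases h : SignChange x y q
  · rw [flipSign_apply_of_mem hmem h, doubleRatioCoord_eq_neg h, hp]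
  · rw [flipSign_apply_of_not _ h, doubleRatioCoord_eq h (hy q), hp]

/-- The double ratios at `x` are an isomorphism of an open neighbourhood onto a complex. -/
theorem exists_chart (hn : 3 ≤ n) (x : ModuliBar n) : ∃ Y : PolyComplex (DoublePair n) (n - 3),
    Y.IsSimplyBalanced ∧ ∃ e : OpenPartialHomeomorph (ModuliBar n) Y.carrier, x ∈ e.source ∧
      (∀ y ∈ e.source, ∀ q, (((e y).1 q : TropNum) : EReal) = doubleRatioCoord x y q) ∧
      IsSheafIso e (ModuliBar.sheaf n) Y.sheaf := by
  let r : Fin n := ⟨0, by omega⟩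
  set Y := (isSmoothFan_coord hn r x).polyComplex with hY
  have hcarrier : ∀ p, p ∈ Y.carrier ↔ ∃ y, ∀ q, doubleRatioCoord x y q = p q :=
    mem_carrier_iff hn r x
  have hemb := (isClosedEmbedding_doubleRatioCoord hn x).isEmbedding
  -- `g` is the inverse of the chart. Composed with the embedding by coordinates it is the inclusion
  -- of the carrier, so it is itself an embedding; its image is the open set where no coordinate is
  -- +∞.
  choose g hg using fun p : Y.carrier => (hcarrier p.1).1 p.2
  have hcoe : IsEmbedding fun (p : Y.carrier) q => (p.1 q : EReal) := by
    have h1 : IsEmbedding fun (p : DoublePair n → TropNum) q => (p q : EReal) :=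
      IsEmbedding.piMap fun _ => IsEmbedding.subtypeVal
    exact h1.comp IsEmbedding.subtypeVal
  have hcomp : doubleRatioCoord x ∘ g = fun (p : Y.carrier) q => (p.1 q : EReal) :=
    funext fun p => funext (hg p)
  have hgcont : Continuous g := hemb.isInducing.continuous_iff.2 (hcomp ▸ hcoe.continuous)
  have hgemb : IsEmbedding g := IsEmbedding.of_comp hgcont hemb.continuous (hcomp ▸ hcoe)
  have hrange : Set.range g = {y | ∀ q, doubleRatioCoord x y q ≠ ⊤} := by
    ext y
    constructor
    · rintro ⟨p, rfl⟩ q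
      rw [hg p q]
      exact (p.1 q).2
    · intro hy
      refine ⟨⟨fun q => ⟨doubleRatioCoord x y q, hy q⟩, (hcarrier _).2 ⟨y, fun q => rfl⟩⟩, ?_⟩
      exact hemb.injective (funext fun q => hg _ q)
  have hopen : IsOpen (Set.range g) := by
    have : Set.range g = ⋂ q, (fun y => doubleRatioCoord x y q) ⁻¹' {⊤}ᶜ := by
      rw [hrange]
      ext y
      simp
    rw [this]
    exact isOpen_iInter_of_finite fun q => isOpen_compl_singleton.preimage
      ((continuous_apply q).comp (continuous_doubleRatioCoord x))
  have hgopen : IsOpenEmbedding g := ⟨hgemb, hopen⟩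
  have hx : x ∈ Set.range g := by
    rw [hrange]
    exact doubleRatioCoord_self_ne_top x
  have : Nonempty Y.carrier := by
    obtain ⟨p, -⟩ := hx
    exact ⟨p⟩
  let e := (hgopen.toOpenPartialHomeomorph g).symm
  have hsource : e.source = Set.range g := by simp [e]
  have heg : ∀ p, e (g p) = p := fun p => hgopen.toOpenPartialHomeomorph_left_inv g
  refine ⟨Y, (isSmoothFan_coord hn r x).isSimplyBalanced, e, hsource ▸ hx, fun y hy q => ?_, ?_⟩
  · rw [hsource] at hy
    obtain ⟨p, rfl⟩ := hy
    rw [heg, hg]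
  intro U V hU hUV f f' hff'
  have hgV : ∀ p ∈ V, g p ∈ U := by
    intro p hp
    obtain ⟨y, hy, hyp⟩ : p ∈ e '' U := hUV.superset hp
    obtain ⟨p', rfl⟩ : y ∈ Set.range g := hsource ▸ hU hy
    rw [heg] at hyp
    exact hyp ▸ hy
  have hff : ∀ (p : Y.carrier) (hp : p ∈ V), f ⟨g p, hgV p hp⟩ = f' ⟨p, hp⟩ := fun p hp =>
    hff' _ _ (heg p)
  have hUg : ∀ y ∈ U, ∃ p ∈ V, g p = y := by
    intro y hy
    obtain ⟨p, rfl⟩ : y ∈ Set.range g := hsource ▸ hU hy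
    refine ⟨p, hUV.subset ⟨g p, hy, heg p⟩, rfl⟩
  -- The coordinates whose sign has to be changed are finite at the point itself, so `flipSign` is
  -- continuous near it.
  have hdom : ∀ p : Y.carrier, p.1 ∈ flipDomain (SignChange x (g p)) := fun p q hq => by
    rw [← hg p q]
    exact doubleRatioCoord_ne_bot hq
  have htop : ∀ (p : Y.carrier) q, doubleRatioCoord x (g p) q ≠ ⊤ := fun p q => by
    rw [hg p q]
    exact (p.1 q).2
  -- Near a point the coordinates used for the moduli space and those used for the complex differ by
  -- `flipSign`, which is its own inverse on `flipDomain`; local presentations are carried over by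
  -- composing with it in both directions.
  constructor
  · rintro hf ⟨p, hp⟩
    obtain ⟨W, G, φ, hpW, hG, hφ, H⟩ := hf ⟨g p, hgV p hp⟩
    refine ⟨⟨g ⁻¹' W ∩ Subtype.val ⁻¹' flipDomain (SignChange x (g p)),
      (W.2.preimage hgcont).inter ((isOpen_flipDomain _).preimage continuous_subtype_val)⟩, _, _,
      ⟨hpW, hdom p⟩, hG.flipSign (SignChange x (g p)), hφ.comp_flipSign (SignChange x (g p)), ?_⟩
    rintro ⟨p', hp'⟩ ⟨hW, hD⟩
    obtain ⟨z, hz, hzq, hzf⟩ := H ⟨g p', hgV p' hp'⟩ hW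
    have hzp : flipSign (SignChange x (g p)) p'.1 = z := by
      ext1 q
      refine Subtype.ext ?_
      rw [coe_flipSign_eq (htop p) (hg p') hD, hzq]
    refine ⟨p'.1, ⟨hD, ?_⟩, fun q => rfl, ?_⟩
    · rw [Set.mem_preimage, hzp]
      exact hz
    · rw [Function.comp_apply, hzp, ← hzf, hff]
  · rintro hf ⟨y, hy⟩
    obtain ⟨p, hp, rfl⟩ := hUg y hy
    obtain ⟨W, G, φ, hpW, hG, hφ, H⟩ := hf ⟨p, hp⟩
    refine ⟨⟨g '' (W ∩ Subtype.val ⁻¹' flipDomain (SignChange x (g p))),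
      hgopen.isOpenMap _ (W.2.inter ((isOpen_flipDomain _).preimage continuous_subtype_val))⟩, _, _,
      ⟨p, ⟨hpW, hdom p⟩, rfl⟩, hG.flipSign (SignChange x (g p)),
      hφ.comp_flipSign (SignChange x (g p)), ?_⟩
    rintro ⟨y', hy'⟩ ⟨p', ⟨hW, hD⟩, hp'⟩
    obtain rfl : g p' = y' := hp'
    have hpV : p' ∈ V := by
      obtain ⟨p'', h1, h2⟩ := hUg _ hy'
      rwa [← hgemb.injective h2]
    obtain ⟨z, hz, hzq, hzf⟩ := H ⟨p', hpV⟩ hW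
    have hzp : p'.1 = z := by
      ext1 q
      exact Subtype.ext (hzq q).symm
    refine ⟨flipSign (SignChange x (g p)) p'.1, ⟨flipSign_mem hD, ?_⟩,
      coe_flipSign_eq (htop p) (hg p') hD, ?_⟩
    · rw [Set.mem_preimage, flipSign_flipSign hD, hzp]
      exact hz
    · rw [Function.comp_apply, flipSign_flipSign hD, hzp, ← hzf, ← hff]

end Chart

theorem mainTheorem2 (n : ℕ) (hn : 3 ≤ n) :
    CompactSpace (ModuliBar n) ∧ T2Space (ModuliBar n) ∧
    IsSmoothTropicalVariety (n - 3) (ModuliBar n) (ModuliBar.sheaf n) ∧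
    ∀ x : ModuliBar n, ∃ Y : PolyComplex (DoublePair n) (n - 3), Y.IsSimplyBalanced ∧
      ∃ e : OpenPartialHomeomorph (ModuliBar n) Y.carrier, x ∈ e.source ∧
        (∀ y ∈ e.source, ∀ q : DoublePair n,
          (((e y).1 q : TropNum) : EReal) = doubleRatioCoord x y q) ∧
        IsSheafIso e (ModuliBar.sheaf n) Y.sheaf := by
  refine ⟨compactSpace_moduliBar hn, t2Space_moduliBar hn, fun x => ?_, exists_chart hn⟩
  obtain ⟨Y, hY, e, hx, -, he⟩ := exists_chart hn x
  exact ⟨DoublePair n, inferInstance, Y, hY, e, hx, he⟩
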